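/- Let $G$ be a finite simple graph of order $n\ge 3$. Its signless Laplacian is $Q(G)=D(G)+A(G)$, where $D(G)$ is the diagonal matrix of vertex degrees and $A(G)$ the adjacency matrix, and $q(G)$ denotes the least eigenvalue of $Q(G)$. Call $G$ $2$-connected if it is connected, has at least three vertices, and has no cut vertex. Let $C_n=v_0v_1\cdots v_{n-1}v_0$ be the cycle of order $n$. For odd $n\ge 5$ and indices $1\le i_1\le\cdots\le i_k\le\frac{n-3}{2}$ with $1\le k\le \frac{n-3}{2}$, let $H(i_1,\dots,i_k)=C_n+v_{i_1}v_{n-i_1}+\cdots+v_{i_k}v_{n-i_k}$ be the cycle $C_n$ together with the chords $v_{i_j}v_{n-i_j}$. For even $n\ge 4$, let $\Theta$ be the graph of order $n$ consisting of the odd cycle $v_1v_2\cdots v_{n-1}v_1$ and a further vertex $v_0$ joined exactly to $v_2$ and $v_{n-1}$. Theorem. Let $G$ be a nonbipartite $2$-connected graph of order $n\ge 3$. (i) If $n$ is odd, then $q(C_n)\le q(G)$. Moreover, if equality holds, then $G\cong C_n$ or $G\cong H(i_1,\dots,i_k)$ for some $k$ and some indices $i_1,\dots,i_k$ as above. (ii)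 If $n$ is even, then $q(\Theta)\le q(G)$, with equality if and only if $G\cong\Theta$. -/

import Mathlib

open Classical in
/-- The signless Laplacian matrix `Q(G) = D(G) + A(G)` of a finite simple graph. -/
noncomputable def signlessLaplacian {V : Type*} [Fintype V] (G : SimpleGraph V) : Matrix V V ℝ :=
  G.degMatrix ℝ + G.adjMatrix ℝ

open Classical in
/-- The set of (real) eigenvalues of the signless Laplacian matrix. -/
def qEigenvalues {V : Type*} [Fintype V] (G : SimpleGraph V) : Set ℝ :=
  {μ | Module.End.HasEigenvalue (Matrix.toLin' (signlessLaplacian G)) μ}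

/-- The least eigenvalue `q(G)` of the signless Laplacian matrix. The set of eigenvalues is finite,
and it is nonempty as soon as `G` has a vertex, so that the infimum is then a minimum;
see `isLeast_leastQEigenvalue`. -/
noncomputable def leastQEigenvalue {V : Type*} [Fintype V] (G : SimpleGraph V) : ℝ :=
  sInf (qEigenvalues G)

open Classical in
theorem isLeast_leastQEigenvalue {V : Type*} [Fintype V] [Nonempty V] (G : SimpleGraph V) :
    IsLeast (qEigenvalues G) (leastQEigenvalue G) := by
  have hfin : (qEigenvalues G).Finite :=
    Module.End.finite_hasEigenvalue (Matrix.toLin' (signlessLaplacian G))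
  have hH : (signlessLaplacian G).IsHermitian := by
    unfold signlessLaplacian
    refine Matrix.IsHermitian.add ?_ ?_
    · exact Matrix.isHermitian_diagonal _
    · ext a b
      simp [SimpleGraph.adj_comm]
  have hne : (qEigenvalues G).Nonempty := by
    obtain ⟨v⟩ := ‹Nonempty V›
    refine ⟨hH.eigenvalues v, ?_⟩
    show Module.End.HasEigenvalue _ _
    refine Module.End.hasEigenvalue_of_hasEigenvector (x := ⇑(hH.eigenvectorBasis v)) ⟨?_, ?_⟩
    · rw [Module.End.mem_eigenspace_iff, Matrix.toLin'_apply]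
      exact hH.mulVec_eigenvectorBasis v
    · intro h
      apply (hH.eigenvectorBasis.orthonormal.ne_zero v)
      ext i
      exact congrFun h i
  exact ⟨hne.csInf_mem hfin, fun _ hx => csInf_le hfin.bddBelow hx⟩

/-- A finite graph is `k`-connected if it has at least `k + 1` vertices and the removal of fewer than
`k` vertices never disconnects it. -/
def IsKConnected {V : Type*} [Fintype V] (G : SimpleGraph V) (k : ℕ) : Prop :=
  k + 1 ≤ Fintype.card V ∧
    ∀ S : Finset V, S.card < k → (G.induce {v : V | v ∉ S}).Connected

/-- For odd `n` and a set `I` of indices: the cycle `v_0 v_1 ⋯ v_{n-1} v_0` together with the chords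
`v_i v_{n-i}` for `i ∈ I`. Vertex `v_i` is the element of `Fin n` with value `i`. -/
def chordedCycle (n : ℕ) (I : Finset ℕ) : SimpleGraph (Fin n) :=
  SimpleGraph.cycleGraph n ⊔
    SimpleGraph.fromRel fun a b : Fin n => (a : ℕ) ∈ I ∧ (a : ℕ) + (b : ℕ) = n

/-- The graph `Θ` on `v_0, …, v_{n-1}`: the cycle `v_1 v_2 ⋯ v_{n-1} v_1` of length `n - 1`,
together with the vertex `v_0` joined to `v_2` and `v_{n-1}`. -/
def thetaGraph (n : ℕ) : SimpleGraph (Fin n) :=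
  SimpleGraph.fromRel fun a b : Fin n =>
    -- the edges `v_i v_{i+1}` with `1 ≤ i ≤ n - 2`
    (1 ≤ (a : ℕ) ∧ (b : ℕ) = a + 1) ∨
    -- the edge `v_1 v_{n-1}`
    ((a : ℕ) = 1 ∧ (b : ℕ) + 1 = n) ∨
    -- the edges `v_0 v_2` and `v_0 v_{n-1}`
    ((a : ℕ) = 0 ∧ ((b : ℕ) = 2 ∨ (b : ℕ) + 1 = n))

/-!
The least eigenvalue `q(G)` is the minimum of the form `xᵀ Q(G) x`, the sum of `(x u + x v) ^ 2`
over all edges `u v`, on unit vectors. Let `x` be an eigenvector for `q(G)`, and rank the vertices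
by `|x|`, with sorted values `A 1 ≤ ⋯ ≤ A n` and `A 0 = -A 1`. An edge with ends of opposite sign
contributes the square of a sum of consecutive gaps `A (k + 1) - A k`. An edge with ends of equal
sign descends through zero, and contributes the square of such a sum in which the gaps below its
lower end count twice. Hence the form is a quadratic form in the nonnegative gaps whose coefficients
count the edges crossing one gap or two gaps (`IsSignedRanking.qForm_eq`, `card_gapDarts_le`). As
`G` is not bipartite and has neither a bridge nor a cut vertex, two edges cross every gap and one
edge crosses any two consecutive gaps. These are the counts of the cycle `⋯, 5, 3, 1, 2, 4, 6, ⋯`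
through the ranks, so that the form is at least the zigzag sum of all `(A (k + 2) - A k) ^ 2`
(`IsSignedRanking.zigzag_add_le_qForm`).

For odd `n` the zigzag sum is attained on `C_n` by a vector with alternating signs
(`cycle_rayleigh`), whence `q(C_n) ≤ q(G)`. If equality holds, then the sequence `A` satisfies the
recurrence of an eigenvector, and all gaps of one parity are positive
(`IsZigzagMinimizer.gaps_pos`). At positive gaps the edge counts must be the least possible ones. So
all vertices but one fall into pairs, edges stay within a pair or join consecutive pairs, and two
consecutive pairs are joined by two edges: `G` is a cycle with chords across it
(`IsLadder.nonempty_iso_chordedCycle`).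

For even `n` the zigzag sum belongs to no choice of signs: just one edge of the zigzag cycle would
join vertices of equal sign, which is impossible on a cycle of even length. In general, parity
forces additional edges near some gap (`exists_defect`). With them the form is at least that of the
zigzag cycle through `n - 1` of the ranks, together with the remaining vertex joined to one of the
levels formed by the pairs of equal position on the two sides (`HasSplitDefect.le_qForm`,
`HasTwinDefect.le_qForm`). Split such a vector into its symmetric and antisymmetric part. The
antisymmetric part has too much energy, since `q(Θ)` is less than the least eigenvalue of the odd
cycle. In the symmetric part, attaching the vertex just below the top is best, and this gives `Θ`
(`levels_of_energy_le`). In the case of equality the edge counts are again determined at every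
second gap, and `G` is a ladder with two nonadjacent vertices on top, that is, `Θ`
(`IsLadder.nonempty_iso_thetaGraph`).
-/

/-! ### The quadratic form of the signless Laplacian -/

open Classical in
/-- The symmetric bilinear form `yᵀ Q(G) x` of the signless Laplacian, written as a sum over
ordered pairs of adjacent vertices. -/
noncomputable def qForm {V : Type*} [Fintype V] (G : SimpleGraph V) (x y : V → ℝ) : ℝ :=
  ∑ u, ∑ v, if G.Adj u v then y u * (x u + x v) else 0

open Classical in
theorem signlessLaplacian_mulVec {V : Type*} [Fintype V] (G : SimpleGraph V) (x : V → ℝ) (u : V) :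
    (signlessLaplacian G).mulVec x u = ∑ v, if G.Adj u v then x u + x v else 0 := by
  unfold signlessLaplacian
  rw [Matrix.add_mulVec, Pi.add_apply, SimpleGraph.degMatrix, Matrix.mulVec_diagonal,
    SimpleGraph.adjMatrix_mulVec_apply, ← Finset.sum_filter, Finset.sum_add_distrib]
  congr 1
  · rw [Finset.sum_const, nsmul_eq_mul, ← SimpleGraph.card_neighborFinset_eq_degree]
    congr 2
    congr 1
    ext v
    simp
  · refine Finset.sum_congr ?_ fun _ _ => rfl
    ext v
    simp

theorem dotProduct_signlessLaplacian {V : Type*} [Fintype V] (G : SimpleGraph V) (x y : V → ℝ) :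
    y ⬝ᵥ (signlessLaplacian G).mulVec x = qForm G x y := by
  unfold qForm dotProduct
  refine Finset.sum_congr rfl fun u _ => ?_
  rw [signlessLaplacian_mulVec, Finset.mul_sum]
  exact Finset.sum_congr rfl fun v _ => by split_ifs <;> simp

open Classical in
theorem two_mul_qForm {V : Type*} [Fintype V] (G : SimpleGraph V) (x y : V → ℝ) :
    2 * qForm G x y = ∑ u, ∑ v, if G.Adj u v then (x u + x v) * (y u + y v) else 0 := by
  have h : qForm G x y = ∑ u, ∑ v, if G.Adj u v then y v * (x u + x v) else 0 := by
    unfold qForm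
    rw [Finset.sum_comm]
    refine Finset.sum_congr rfl fun u _ => Finset.sum_congr rfl fun v _ => ?_
    rw [G.adj_comm, add_comm]
  rw [two_mul]
  nth_rewrite 2 [h]
  unfold qForm
  simp only [← Finset.sum_add_distrib]
  refine Finset.sum_congr rfl fun u _ => Finset.sum_congr rfl fun v _ => ?_
  split_ifs <;> ring

theorem qForm_comm {V : Type*} [Fintype V] (G : SimpleGraph V) (x y : V → ℝ) :
    qForm G x y = qForm G y x := by
  have h : 2 * qForm G x y = 2 * qForm G y x := by
    rw [two_mul_qForm, two_mul_qForm]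
    simp only [mul_comm]
  linarith

theorem signlessLaplacian_isHermitian {V : Type*} [Fintype V] (G : SimpleGraph V) :
    (signlessLaplacian G).IsHermitian := by
  classical
  unfold signlessLaplacian
  refine Matrix.IsHermitian.add (Matrix.isHermitian_diagonal _) ?_
  ext a b
  simp [SimpleGraph.adj_comm]

/-- An eigenvector for the least eigenvalue, with the eigenvalue equation at every vertex. -/
theorem exists_leastQEigenvector {V : Type*} [Fintype V] [Nonempty V] (G : SimpleGraph V) :
    ∃ x : V → ℝ, x ≠ 0 ∧ (signlessLaplacian G).mulVec x = leastQEigenvalue G • x := by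
  classical
  obtain ⟨x, hx⟩ := Module.End.HasEigenvalue.exists_hasEigenvector (isLeast_leastQEigenvalue G).1
  refine ⟨x, hx.2, ?_⟩
  have := hx.apply_eq_smul
  rwa [Matrix.toLin'_apply] at this

open Classical in
theorem posSemidef_sub_leastQEigenvalue {V : Type*} [Fintype V] [Nonempty V]
    (G : SimpleGraph V) :
    (signlessLaplacian G - leastQEigenvalue G • (1 : Matrix V V ℝ)).PosSemidef := by
  have hH : (signlessLaplacian G - leastQEigenvalue G • (1 : Matrix V V ℝ)).IsHermitian :=
    (signlessLaplacian_isHermitian G).sub (by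
      ext i j
      simp [Matrix.one_apply, eq_comm])
  rw [hH.posSemidef_iff_eigenvalues_nonneg]
  intro i
  have h1 := hH.mulVec_eigenvectorBasis i
  have h2 : hH.eigenvalues i + leastQEigenvalue G ∈ qEigenvalues G := by
    show Module.End.HasEigenvalue _ _
    refine Module.End.hasEigenvalue_of_hasEigenvector (x := ⇑(hH.eigenvectorBasis i)) ⟨?_, ?_⟩
    · rw [Module.End.mem_eigenspace_iff, Matrix.toLin'_apply, add_smul, ← h1, Matrix.sub_mulVec,
        Matrix.smul_mulVec, Matrix.one_mulVec, sub_add_cancel]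
    · intro h
      apply (hH.eigenvectorBasis.orthonormal.ne_zero i)
      ext j
      exact congrFun h j
  have h3 := (isLeast_leastQEigenvalue G).2 h2
  simpa using h3

open Classical in
theorem qForm_sub_leastQEigenvalue {V : Type*} [Fintype V] [Nonempty V]
    (G : SimpleGraph V) (x : V → ℝ) :
    x ⬝ᵥ (signlessLaplacian G - leastQEigenvalue G • (1 : Matrix V V ℝ)).mulVec x =
      qForm G x x - leastQEigenvalue G * ∑ v, x v ^ 2 := by
  rw [Matrix.sub_mulVec, dotProduct_sub, dotProduct_signlessLaplacian, Matrix.smul_mulVec,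
    Matrix.one_mulVec, dotProduct_smul, smul_eq_mul]
  simp [dotProduct, sq]

/-- Rayleigh's principle for the least eigenvalue. -/
theorem leastQEigenvalue_mul_le {V : Type*} [Fintype V] [Nonempty V] (G : SimpleGraph V)
    (x : V → ℝ) : leastQEigenvalue G * ∑ v, x v ^ 2 ≤ qForm G x x := by
  classical
  have h := (posSemidef_sub_leastQEigenvalue G).dotProduct_mulVec_nonneg x
  rw [star_trivial, qForm_sub_leastQEigenvalue] at h
  linarith

theorem sum_sq_pos {V : Type*} [Fintype V] {x : V → ℝ} (hx : x ≠ 0) : 0 < ∑ v, x v ^ 2 := by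
  obtain ⟨v, hv⟩ := Function.ne_iff.1 hx
  refine Finset.sum_pos' (fun _ _ => sq_nonneg _) ⟨v, Finset.mem_univ _, ?_⟩
  have : x v ≠ 0 := hv
  positivity

theorem qForm_self_of_mulVec {V : Type*} [Fintype V] {G : SimpleGraph V} {x : V → ℝ} {q : ℝ}
    (h : (signlessLaplacian G).mulVec x = q • x) : qForm G x x = q * ∑ v, x v ^ 2 := by
  rw [← dotProduct_signlessLaplacian, h, dotProduct_smul, smul_eq_mul]
  simp [dotProduct, sq]

theorem leastQEigenvalue_le_of_iso {V W : Type*} [Fintype V] [Fintype W] [Nonempty V]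
    {G : SimpleGraph V} {H : SimpleGraph W} (f : G ≃g H) :
    leastQEigenvalue G ≤ leastQEigenvalue H := by
  classical
  have : Nonempty W := ⟨f (Classical.arbitrary V)⟩
  obtain ⟨x, hx0, hx⟩ := exists_leastQEigenvector H
  have h1 := leastQEigenvalue_mul_le G (x ∘ f)
  have h2 : qForm G (x ∘ f) (x ∘ f) = qForm H x x := by
    unfold qForm
    rw [← f.toEquiv.sum_comp]
    refine Finset.sum_congr rfl fun u _ => ?_
    rw [← f.toEquiv.sum_comp]
    refine Finset.sum_congr rfl fun v _ => ?_
    have : H.Adj (f.toEquiv u) (f.toEquiv v) ↔ G.Adj u v := f.map_adj_iff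
    simp only [this]
    rfl
  have h3 : ∑ v, (x ∘ f) v ^ 2 = ∑ v, x v ^ 2 := f.toEquiv.sum_comp (fun v => x v ^ 2)
  rw [h2, h3, qForm_self_of_mulVec hx] at h1
  exact le_of_mul_le_mul_right h1 (sum_sq_pos hx0)

theorem leastQEigenvalue_eq_of_iso {V W : Type*} [Fintype V] [Fintype W] [Nonempty V]
    {G : SimpleGraph V} {H : SimpleGraph W} (f : G ≃g H) :
    leastQEigenvalue G = leastQEigenvalue H :=
  have : Nonempty W := ⟨f (Classical.arbitrary V)⟩
  le_antisymm (leastQEigenvalue_le_of_iso f) (leastQEigenvalue_le_of_iso f.symm)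

/-! ### Ranking the vertices by the absolute value of an eigenvector -/

/-- The real sign `±1` encoded by a Boolean. -/
def boolSign (b : Bool) : ℝ := if b then 1 else -1

theorem boolSign_mul_self (b : Bool) : boolSign b * boolSign b = 1 := by
  cases b <;> norm_num [boolSign]

/-- `A 1 ≤ A 2 ≤ ⋯ ≤ A n` are the absolute values of the entries of `x`, sorted by the ranking `ρ`
(whose values start at `0`), and `s` records the signs of the entries. An entry `0` may carry either
sign. The sequence is continued by `A 0 = -A 1` and by `A k = A n` for `k > n`: with this
convention the two ends of the sequence need no separate treatment. -/
structure IsSignedRanking {V : Type*} {n : ℕ} (x : V → ℝ) (ρ : V ≃ Fin n) (s : V → Bool)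
    (A : ℕ → ℝ) : Prop where
  eq_sign_mul : ∀ v, x v = boolSign (s v) * A (ρ v + 1)
  zero : A 0 = -A 1
  top : ∀ k, n ≤ k → A k = A n
  mono : Monotone A

/-- The ranking and the sorted sequence serve all admissible choices of signs at the zeros of `x`.
-/
theorem exists_isSignedRanking {V : Type*} [Fintype V] {n : ℕ} (hn : 0 < n)
    (hV : Fintype.card V = n) (x : V → ℝ) :
    ∃ (ρ : V ≃ Fin n) (A : ℕ → ℝ), ∀ s : V → Bool, (∀ v, boolSign (s v) * x v = |x v|) →
      IsSignedRanking x ρ s A := by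
  obtain ⟨e⟩ : Nonempty (V ≃ Fin n) := ⟨Fintype.equivFinOfCardEq hV⟩
  let f : Fin n → ℝ := fun i => |x (e.symm i)|
  let ρ : V ≃ Fin n := e.trans (Tuple.sort f).symm
  have hmono : Monotone (f ∘ Tuple.sort f) := Tuple.monotone_sort f
  have hf : ∀ v, (f ∘ Tuple.sort f) (ρ v) = |x v| := fun v => by simp [f, ρ]
  let g : ℕ → Fin n := fun k => ⟨min (k - 1) (n - 1), by omega⟩
  let A : ℕ → ℝ := fun k => if k = 0 then -(f ∘ Tuple.sort f) (g 1) else (f ∘ Tuple.sort f) (g k)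
  refine ⟨ρ, A, fun s hs => ⟨fun v => ?_, ?_, fun k hk => ?_, ?_⟩⟩
  · have h1 : A (ρ v + 1) = |x v| := by
      rw [← hf]
      have : g (ρ v + 1) = ρ v := by
        ext
        simp only [g]
        omega
      simp [A, this]
    rw [h1, ← hs, ← mul_assoc, boolSign_mul_self, one_mul]
  · simp [A]
  · have : g k = g n := by
      ext
      simp only [g]
      omega
    simp [A, this, show k ≠ 0 by omega, show n ≠ 0 by omega]
  · refine monotone_nat_of_le_succ fun k => ?_
    rcases Nat.eq_zero_or_pos k with rfl | hk
    · have : 0 ≤ (f ∘ Tuple.sort f) (g 1) := abs_nonneg _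
      simp only [A, if_true, zero_add, one_ne_zero, if_false]
      linarith
    · simp only [A, if_neg hk.ne', if_neg (Nat.succ_ne_zero k)]
      apply hmono
      simp only [g, Fin.mk_le_mk]
      omega

namespace IsSignedRanking

variable {V : Type*} {n : ℕ} {x : V → ℝ} {ρ : V ≃ Fin n} {s : V → Bool} {A : ℕ → ℝ}

theorem one_nonneg (h : IsSignedRanking x ρ s A) : 0 ≤ A 1 := by
  have h1 := h.mono (Nat.zero_le 1)
  have h2 := h.zero
  linarith

theorem nonneg (h : IsSignedRanking x ρ s A) {k : ℕ} (hk : 1 ≤ k) : 0 ≤ A k :=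
  h.one_nonneg.trans (h.mono hk)

theorem abs_eq (h : IsSignedRanking x ρ s A) (v : V) : |x v| = A (ρ v + 1) := by
  have : |boolSign (s v)| = 1 := by
    unfold boolSign
    split_ifs <;> simp
  rw [h.eq_sign_mul, abs_mul, this, one_mul, abs_of_nonneg (h.nonneg (by omega))]

theorem sum_sq [Fintype V] (h : IsSignedRanking x ρ s A) :
    ∑ v, x v ^ 2 = ∑ k ∈ Finset.range n, A (k + 1) ^ 2 := by
  rw [Finset.sum_range, ← ρ.sum_comp]
  refine Finset.sum_congr rfl fun v _ => ?_
  rw [← h.abs_eq, sq_abs]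

end IsSignedRanking

/-- The signed indicator of the vertices of rank at least `k`. For `k = 0` it is halved, since
the lowest gap `A 1 - A 0 = 2 * A 1` is counted twice. -/
noncomputable def layer {V : Type*} {n : ℕ} (ρ : V ≃ Fin n) (s : V → Bool) (k : ℕ) (v : V) : ℝ :=
  if k ≤ ρ v then (if k = 0 then boolSign (s v) / 2 else boolSign (s v)) else 0

theorem IsSignedRanking.eq_sum_layer {V : Type*} {n : ℕ} {x : V → ℝ} {ρ : V ≃ Fin n}
    {s : V → Bool} {A : ℕ → ℝ} (h : IsSignedRanking x ρ s A) (v : V) :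
    x v = ∑ k ∈ Finset.range n, (A (k + 1) - A k) * layer ρ s k v := by
  have key : ∀ m ≤ (ρ v : ℕ), ∑ k ∈ Finset.range (m + 1), (A (k + 1) - A k) * layer ρ s k v =
      boolSign (s v) * A (m + 1) := by
    intro m
    induction m with
    | zero =>
      intro _
      have := h.zero
      simp [layer, this]
      ring
    | succ m ih =>
      intro hm
      rw [Finset.sum_range_succ, ih (by omega)]
      simp only [layer, if_pos hm, Nat.succ_ne_zero, if_false]
      ring
  rw [h.eq_sign_mul, ← key _ le_rfl]
  refine Finset.sum_subset (by
    intro k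
    simp only [Finset.mem_range]
    omega) fun k _ hk => ?_
  have : ¬ k ≤ (ρ v : ℕ) := by
    simp only [Finset.mem_range] at hk
    omega
  simp [layer, this]

/-! ### Counting the edges above a gap -/

open Classical in
/-- Ordered edges `(u, v)` whose upper end `u` has rank at least `l` and whose lower end `v`, taken
with the sign opposite to that of `u`, lies below the gap `k`: either `v` has rank less than `k`, or
`u` and `v` have equal signs, so that the edge descends through zero. -/
noncomputable def gapDarts {V : Type*} [Fintype V] {n : ℕ} (G : SimpleGraph V) (ρ : V ≃ Fin n)
    (s : V → Bool) (k l : ℕ) : Finset (V × V) :=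
  Finset.univ.filter fun p => G.Adj p.1 p.2 ∧ l ≤ ρ p.1 ∧ ((ρ p.2 : ℕ) < k ∨ s p.1 = s p.2)

section GapForm

variable {V : Type*} [Fintype V] {n : ℕ} {G : SimpleGraph V} {ρ : V ≃ Fin n} {s : V → Bool}

theorem mem_gapDarts {k l : ℕ} {u v : V} : (u, v) ∈ gapDarts G ρ s k l ↔
    G.Adj u v ∧ l ≤ ρ u ∧ ((ρ v : ℕ) < k ∨ s u = s v) := by
  simp [gapDarts]

/-- The form of two layers counts the edges crossing both of them: a dart of `gapDarts G ρ s k l`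
contributes `1` or `2`, any other pair a nonnegative amount. -/
theorem card_gapDarts_le {k l : ℕ} (hkl : k ≤ l) (hl : 1 ≤ l) :
    ((gapDarts G ρ s k l).card : ℝ) ≤ qForm G (layer ρ s k) (layer ρ s l) := by
  classical
  unfold gapDarts qForm
  rw [Finset.card_filter, Nat.cast_sum, Fintype.sum_prod_type]
  refine Finset.sum_le_sum fun u _ => Finset.sum_le_sum fun v _ => ?_
  simp only [layer]
  by_cases hadj : G.Adj u v
  · rcases Nat.eq_zero_or_pos k with rfl | hk
    · simp only [hadj, true_and, Nat.not_lt_zero, false_or, Nat.zero_le, if_true,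
        show l ≠ 0 by omega, if_false]
      by_cases h1 : l ≤ (ρ u : ℕ) <;> cases s u <;> cases s v <;> norm_num [h1, boolSign]
    · simp only [hadj, true_and, show l ≠ 0 by omega, show k ≠ 0 by omega, if_false, if_true]
      by_cases h1 : l ≤ (ρ u : ℕ)
      · have h2 : k ≤ (ρ u : ℕ) := by omega
        by_cases h3 : k ≤ (ρ v : ℕ)
        · have h4 : ¬ (ρ v : ℕ) < k := by omega
          cases s u <;> cases s v <;> norm_num [h1, h2, h3, h4, boolSign]
        · have h4 : (ρ v : ℕ) < k := by omega
          cases s u <;> cases s v <;> norm_num [h1, h2, h3, h4, boolSign]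
      · norm_num [h1]
  · simp [hadj]

/-- The lowest layer takes the values `±1/2`, so that only edges with ends of equal sign contribute,
and each such edge gives two darts. -/
theorem qForm_layer_zero :
    qForm G (layer ρ s 0) (layer ρ s 0) = ((gapDarts G ρ s 0 0).card : ℝ) / 2 := by
  classical
  unfold gapDarts qForm
  rw [Finset.card_filter, Nat.cast_sum, Fintype.sum_prod_type, Finset.sum_div]
  refine Finset.sum_congr rfl fun u _ => ?_
  push_cast
  rw [Finset.sum_div]
  refine Finset.sum_congr rfl fun v _ => ?_
  by_cases hadj : G.Adj u v
  · cases hu : s u <;> cases hv : s v <;> norm_num [hadj, boolSign, layer, hu, hv]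
  · simp [hadj]

/-- The form at `x` is a quadratic form in the nonnegative gaps of the sequence, whose coefficients
are bounded from below by edge counts. -/
theorem IsSignedRanking.qForm_eq {x : V → ℝ} {A : ℕ → ℝ} (h : IsSignedRanking x ρ s A) :
    qForm G x x = ∑ k ∈ Finset.range n, ∑ l ∈ Finset.range n,
      (A (k + 1) - A k) * (A (l + 1) - A l) * qForm G (layer ρ s k) (layer ρ s l) := by
  classical
  have hx : x = fun v => ∑ k ∈ Finset.range n, (A (k + 1) - A k) * layer ρ s k v := by
    funext v
    exact h.eq_sum_layer v
  have h1 : ∀ (c : ℕ → ℝ) (y : V → ℝ),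
      qForm G (fun v => ∑ k ∈ Finset.range n, c k * layer ρ s k v) y =
        ∑ k ∈ Finset.range n, c k * qForm G (layer ρ s k) y := by
    intro c y
    unfold qForm
    simp only [Finset.mul_sum]
    rw [Finset.sum_comm (s := Finset.range n)]
    refine Finset.sum_congr rfl fun u _ => ?_
    rw [Finset.sum_comm (s := Finset.range n)]
    refine Finset.sum_congr rfl fun v _ => ?_
    split_ifs
    · rw [← Finset.sum_add_distrib, Finset.mul_sum]
      exact Finset.sum_congr rfl fun k _ => by ring
    · simp
  rw [hx, h1]
  refine Finset.sum_congr rfl fun k _ => ?_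
  rw [qForm_comm, h1, Finset.mul_sum]
  refine Finset.sum_congr rfl fun l _ => ?_
  rw [qForm_comm]
  ring

end GapForm

/-- Coefficients, in terms of the gaps of `A`, of the quadratic form of the cycle that runs through
the ranked vertices in the zigzag order `⋯, 5, 3, 1, 2, 4, 6, ⋯`. -/
noncomputable def zigzagCoeff (k l : ℕ) : ℝ :=
  if k = l then (if k = 0 then 1 else 2) else if k + 1 = l ∨ l + 1 = k then 1 else 0

theorem sum_range_succ_sq (n : ℕ) (f : ℕ → ℕ → ℝ) (hf : ∀ k l, f k l = f l k) :
    ∑ k ∈ Finset.range (n + 1), ∑ l ∈ Finset.range (n + 1), f k l =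
      ∑ k ∈ Finset.range n, ∑ l ∈ Finset.range n, f k l +
        2 * ∑ k ∈ Finset.range n, f k n + f n n := by
  simp only [Finset.sum_range_succ, Finset.sum_add_distrib]
  rw [Finset.sum_congr rfl fun l _ => hf n l]
  ring

theorem zigzagCoeff_comm (k l : ℕ) : zigzagCoeff k l = zigzagCoeff l k := by
  unfold zigzagCoeff
  by_cases h : k = l
  · simp [h]
  · simp [h, Ne.symm h, or_comm]

/-- The two terms at the end involve the gap above the last one, which vanishes for the sequence of
a ranking. -/
theorem sum_zigzagCoeff (n : ℕ) (D : ℕ → ℝ) :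
    ∑ k ∈ Finset.range (n + 1), (D k + D (k + 1)) ^ 2 =
      ∑ k ∈ Finset.range (n + 1), ∑ l ∈ Finset.range (n + 1), D k * D l * zigzagCoeff k l +
        2 * (D n * D (n + 1)) + D (n + 1) ^ 2 := by
  induction n with
  | zero =>
    simp [zigzagCoeff]
    ring
  | succ n ih =>
    rw [Finset.sum_range_succ, ih, sum_range_succ_sq (n + 1)]
    · have h1 : ∑ k ∈ Finset.range (n + 1), D k * D (n + 1) * zigzagCoeff k (n + 1) =
          D n * D (n + 1) := by
        rw [Finset.sum_range_succ, Finset.sum_eq_zero]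
        · simp [zigzagCoeff]
        · intro k hk
          have := Finset.mem_range.1 hk
          simp [zigzagCoeff, show k ≠ n + 1 by omega, show k ≠ n by omega,
            show n + 1 + 1 ≠ k by omega]
      rw [h1]
      simp [zigzagCoeff]
      ring
    · intro k l
      rw [zigzagCoeff_comm]
      ring

/-- The zigzag form of a ranking in terms of its gaps. -/
theorem IsSignedRanking.sum_zigzag {V : Type*} {n : ℕ} {x : V → ℝ} {ρ : V ≃ Fin n}
    {s : V → Bool} {A : ℕ → ℝ} (h : IsSignedRanking x ρ s A) (hn : 0 < n) :
    ∑ k ∈ Finset.range n, (A (k + 2) - A k) ^ 2 =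
      ∑ k ∈ Finset.range n, ∑ l ∈ Finset.range n,
        (A (k + 1) - A k) * (A (l + 1) - A l) * zigzagCoeff k l := by
  obtain ⟨m, rfl⟩ := Nat.exists_eq_succ_of_ne_zero hn.ne'
  have h1 := sum_zigzagCoeff m fun k => A (k + 1) - A k
  have h2 : A (m + 1 + 1) - A (m + 1) = 0 := by
    rw [h.top (m + 1 + 1) (by simp)]
    simp
  simp only [h2] at h1
  simp only [Nat.succ_eq_add_one]
  rw [← add_zero (∑ k ∈ Finset.range (m + 1), ∑ l ∈ _, _)]
  convert h1 using 1
  · exact Finset.sum_congr rfl fun k _ => by ring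
  · ring

/-! ### Edges forced by 2-connectivity -/

namespace IsKConnected

variable {V : Type*} [Fintype V] {G : SimpleGraph V}

theorem exists_adj_of_notMem (h : IsKConnected G 2) (S : Finset V) (hS : S.card < 2)
    (P : V → Prop) {a b : V} (ha : P a) (hb : ¬ P b) (haS : a ∉ S) (hbS : b ∉ S) :
    ∃ u v, G.Adj u v ∧ P u ∧ ¬ P v ∧ u ∉ S ∧ v ∉ S := by
  obtain ⟨p⟩ := (h.2 S hS).preconnected ⟨a, haS⟩ ⟨b, hbS⟩
  obtain ⟨d, -, hd1, hd2⟩ := p.exists_boundary_dart {v | P v.1} ha hb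
  exact ⟨d.fst.1, d.snd.1, d.adj, hd1, hd2, d.fst.2, d.snd.2⟩

/-- Every cut is crossed by an edge. -/
theorem exists_adj (h : IsKConnected G 2) (P : V → Prop) {a b : V} (ha : P a) (hb : ¬ P b) :
    ∃ u v, G.Adj u v ∧ P u ∧ ¬ P v := by
  obtain ⟨u, v, h1, h2, h3, -⟩ := h.exists_adj_of_notMem ∅ (by simp) P ha hb (by simp) (by simp)
  exact ⟨u, v, h1, h2, h3⟩

/-- Every cut of the graph with one vertex `c` removed is crossed by an edge. -/
theorem exists_adj_ne (h : IsKConnected G 2) (c : V) (P : V → Prop) {a b : V} (ha : P a)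
    (hb : ¬ P b) (hac : a ≠ c) (hbc : b ≠ c) :
    ∃ u v, G.Adj u v ∧ P u ∧ ¬ P v ∧ u ≠ c ∧ v ≠ c := by
  obtain ⟨u, v, h1, h2, h3, h4, h5⟩ :=
    h.exists_adj_of_notMem {c} (by simp) P ha hb (by simpa using hac) (by simpa using hbc)
  exact ⟨u, v, h1, h2, h3, by simpa using h4, by simpa using h5⟩

theorem exists_adj_vertex_ne (h : IsKConnected G 2) (u c : V) : ∃ v, G.Adj u v ∧ v ≠ c := by
  classical
  have h3 : 3 ≤ (Finset.univ : Finset V).card := h.1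
  obtain ⟨b, -, hb⟩ := Finset.exists_mem_notMem_of_card_lt_card
    (s := {u, c}) (t := Finset.univ) (lt_of_le_of_lt Finset.card_le_two (by omega))
  simp only [Finset.mem_insert, Finset.mem_singleton, not_or] at hb
  by_cases huc : u = c
  · obtain ⟨u', v, h1, h2, h3⟩ := h.exists_adj (· = u) rfl hb.1
    exact ⟨v, h2 ▸ h1, huc ▸ h3⟩
  · obtain ⟨u', v, h1, h2, h3, -, h5⟩ := h.exists_adj_ne c (· = u) rfl hb.1 huc hb.2
    exact ⟨v, h2 ▸ h1, h5⟩

end IsKConnected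

theorem exists_adj_same_sign {V : Type*} {G : SimpleGraph V} (h : ¬ G.IsBipartite)
    (s : V → Bool) : ∃ u v, G.Adj u v ∧ s u = s v := by
  by_contra! hs
  exact h (SimpleGraph.Coloring.mk s fun {u v} huv => hs u v huv).colorable

theorem rank_symm {V : Type*} {n : ℕ} {ρ : V ≃ Fin n} {i : ℕ} (hi : i < n) :
    (ρ (ρ.symm ⟨i, hi⟩) : ℕ) = i := by simp

theorem ne_of_rank_ne {V : Type*} {n : ℕ} {ρ : V ≃ Fin n} {u v : V} (h : (ρ u : ℕ) ≠ ρ v) :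
    u ≠ v := fun h' => h (by rw [h'])

theorem rank_ne {V : Type*} {n : ℕ} {ρ : V ≃ Fin n} {u v : V} (h : u ≠ v) :
    (ρ u : ℕ) ≠ ρ v :=
  fun h' => h (ρ.injective (Fin.ext h'))

section GapBounds

variable {V : Type*} [Fintype V] {n : ℕ} {G : SimpleGraph V} {ρ : V ≃ Fin n} {s : V → Bool}

theorem one_le_card_gapDarts {k l : ℕ} {u v : V} (h : (u, v) ∈ gapDarts G ρ s k l) :
    1 ≤ (gapDarts G ρ s k l).card :=
  Finset.card_pos.2 ⟨_, h⟩

theorem two_le_card_gapDarts {k l : ℕ} {p q : V × V} (hp : p ∈ gapDarts G ρ s k l)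
    (hq : q ∈ gapDarts G ρ s k l) (hpq : p ≠ q) : 2 ≤ (gapDarts G ρ s k l).card :=
  Finset.one_lt_card.2 ⟨p, hp, q, hq, hpq⟩

theorem three_le_card_gapDarts {k l : ℕ} {p q r : V × V} (hp : p ∈ gapDarts G ρ s k l)
    (hq : q ∈ gapDarts G ρ s k l) (hr : r ∈ gapDarts G ρ s k l) (hpq : p ≠ q) (hpr : p ≠ r)
    (hqr : q ≠ r) : 3 ≤ (gapDarts G ρ s k l).card :=
  Finset.two_lt_card.2 ⟨p, hp, q, hq, r, hr, hpq, hpr, hqr⟩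

theorem four_le_card_gapDarts {k l : ℕ} {p q r t : V × V} (hp : p ∈ gapDarts G ρ s k l)
    (hq : q ∈ gapDarts G ρ s k l) (hr : r ∈ gapDarts G ρ s k l) (ht : t ∈ gapDarts G ρ s k l)
    (hpq : p ≠ q) (hpr : p ≠ r) (hpt : p ≠ t) (hqr : q ≠ r) (hqt : q ≠ t) (hrt : r ≠ t) :
    4 ≤ (gapDarts G ρ s k l).card := by
  classical
  have h : ({p, q, r, t} : Finset (V × V)).card = 4 := by
    rw [Finset.card_insert_of_notMem, Finset.card_insert_of_notMem, Finset.card_pair hrt] <;>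
      simp [*]
  rw [← h]
  refine Finset.card_le_card fun y hy => ?_
  simp only [Finset.mem_insert, Finset.mem_singleton] at hy
  rcases hy with rfl | rfl | rfl | rfl <;> assumption

/-- Two edges cross every gap, since a 2-connected graph has no bridge. -/
theorem two_le_card_gapDarts_self (hG : IsKConnected G 2) (hb : ¬ G.IsBipartite) {k : ℕ}
    (hk : k < n) : 2 ≤ (gapDarts G ρ s k k).card := by
  have hn : 3 ≤ n := by
    have := hG.1
    rwa [Fintype.card_congr ρ, Fintype.card_fin] at this
  rcases Nat.eq_zero_or_pos k with rfl | hk0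
  · obtain ⟨u, v, huv, hs⟩ := exists_adj_same_sign hb s
    refine two_le_card_gapDarts (p := (u, v)) (q := (v, u)) ?_ ?_ ?_
    · simp [mem_gapDarts, huv, hs]
    · simp [mem_gapDarts, huv.symm, hs]
    · simpa using fun h => absurd h huv.ne
  · let P : V → Prop := fun v => k ≤ (ρ v : ℕ)
    have hmem : ∀ u v, G.Adj u v → P u → ¬ P v → (u, v) ∈ gapDarts G ρ s k k :=
      fun u v h1 h2 h3 => mem_gapDarts.2 ⟨h1, h2, Or.inl (not_le.1 h3)⟩
    have ha : P (ρ.symm ⟨k, hk⟩) := by simp [P]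
    have hz : ¬ P (ρ.symm ⟨0, by omega⟩) := by
      simp only [P, rank_symm]
      omega
    obtain ⟨u, v, huv, hu, hv⟩ := hG.exists_adj P ha hz
    by_cases hu' : ∃ u', P u' ∧ u' ≠ u
    · obtain ⟨u', hu', hne⟩ := hu'
      obtain ⟨u2, v2, h1, h2, h3, h4, -⟩ := hG.exists_adj_ne u P hu' hz hne
        (fun h => hz (h ▸ hu))
      exact two_le_card_gapDarts (hmem _ _ huv hu hv) (hmem _ _ h1 h2 h3) (by simp [h4.symm])
    · have hk1 : k + 1 = n := by
        by_contra hkn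
        push Not at hu'
        have e1 := hu' (ρ.symm ⟨k, hk⟩) ha
        have e2 := hu' (ρ.symm ⟨k + 1, by omega⟩) (by simp [P])
        have := ρ.symm.injective (e1.trans e2.symm)
        simp at this
      obtain ⟨w, hw, hwv⟩ : ∃ w, ¬ P w ∧ w ≠ v := by
        by_cases h0 : (ρ v : ℕ) = 0
        · refine ⟨ρ.symm ⟨1, by omega⟩, ?_, ne_of_rank_ne (ρ := ρ) ?_⟩
          · simp only [P, rank_symm]
            omega
          · rw [rank_symm, h0]
            omega
        · exact ⟨_, hz, ne_of_rank_ne (ρ := ρ) (by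
            rw [rank_symm]
            exact Ne.symm h0)⟩
      obtain ⟨u2, v2, h1, h2, h3, -, h4⟩ := hG.exists_adj_ne v P hu hw
        (fun h => hv (h ▸ hu)) hwv
      exact two_le_card_gapDarts (hmem _ _ huv hu hv) (hmem _ _ h1 h2 h3) (by simp [h4.symm])

/-- An edge skips every vertex, since a 2-connected graph has no cut vertex. -/
theorem one_le_card_gapDarts_succ (hG : IsKConnected G 2) (hb : ¬ G.IsBipartite) {k : ℕ}
    (hk : k + 1 < n) : 1 ≤ (gapDarts G ρ s k (k + 1)).card := by
  rcases Nat.eq_zero_or_pos k with rfl | hk0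
  · obtain ⟨u, v, huv, hs⟩ := exists_adj_same_sign hb s
    have := rank_ne (ρ := ρ) huv.ne
    by_cases hu : (ρ u : ℕ) = 0
    · exact one_le_card_gapDarts (u := v) (v := u)
        (mem_gapDarts.2 ⟨huv.symm, by omega, Or.inr hs.symm⟩)
    · exact one_le_card_gapDarts (u := u) (v := v) (mem_gapDarts.2 ⟨huv, by omega, Or.inr hs⟩)
  · obtain ⟨u, v, h1, h2, h3, h4, h5⟩ := hG.exists_adj_ne (ρ.symm ⟨k, by omega⟩)
      (fun v => k ≤ (ρ v : ℕ)) (a := ρ.symm ⟨k + 1, hk⟩) (b := ρ.symm ⟨0, by omega⟩)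
      (by simp) (by simp; omega) (by simp) (by simp; omega)
    have h6 : (ρ u : ℕ) ≠ k := by
      intro h
      apply h4
      rw [Equiv.eq_symm_apply]
      exact Fin.ext h
    exact one_le_card_gapDarts (u := u) (v := v)
      (mem_gapDarts.2 ⟨h1, by omega, Or.inl (not_le.1 h3)⟩)

/-- The zigzag cycle has the least edge counts among all 2-connected nonbipartite graphs. -/
theorem zigzagCoeff_le (hG : IsKConnected G 2) (hb : ¬ G.IsBipartite) {k l : ℕ} (hk : k < n)
    (hl : l < n) : zigzagCoeff k l ≤ qForm G (layer ρ s k) (layer ρ s l) := by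
  wlog hkl : k ≤ l generalizing k l
  · rw [qForm_comm, zigzagCoeff_comm]
    exact this hl hk (by omega)
  rcases Nat.eq_zero_or_pos l with rfl | hl0
  · obtain rfl : k = 0 := by omega
    have : (2 : ℝ) ≤ (gapDarts G ρ s 0 0).card :=
      mod_cast two_le_card_gapDarts_self hG hb hk
    rw [qForm_layer_zero]
    norm_num [zigzagCoeff]
    linarith
  · refine le_trans ?_ (card_gapDarts_le hkl hl0)
    unfold zigzagCoeff
    split_ifs with h1 h2 h3
    · omega
    · subst h1
      exact_mod_cast two_le_card_gapDarts_self hG hb hk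
    · obtain rfl : k + 1 = l := by omega
      exact_mod_cast one_le_card_gapDarts_succ hG hb hl
    · positivity

/-- The form of `G` exceeds that of the zigzag cycle by a sum over pairs of gaps with nonnegative
terms, of which any selection `S` may be kept. -/
theorem IsSignedRanking.zigzag_add_le_qForm {x : V → ℝ} {A : ℕ → ℝ}
    (h : IsSignedRanking x ρ s A) (hG : IsKConnected G 2) (hb : ¬ G.IsBipartite)
    (S : Finset (ℕ × ℕ)) (X : ℕ × ℕ → ℝ)
    (hX : ∀ p ∈ S, p.1 < n → p.2 < n →
      zigzagCoeff p.1 p.2 + X p ≤ qForm G (layer ρ s p.1) (layer ρ s p.2)) :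
    ∑ k ∈ Finset.range n, (A (k + 2) - A k) ^ 2 +
        ∑ p ∈ S, (A (p.1 + 1) - A p.1) * (A (p.2 + 1) - A p.2) * X p ≤ qForm G x x := by
  classical
  have hn : 0 < n := by
    have := hG.1
    rw [Fintype.card_congr ρ, Fintype.card_fin] at this
    omega
  have hD : ∀ k, 0 ≤ A (k + 1) - A k := fun k => sub_nonneg.2 (h.mono (Nat.le_succ k))
  have hD0 : ∀ k, n ≤ k → A (k + 1) - A k = 0 := fun k hk => by
    rw [h.top _ hk, h.top (k + 1) (by omega), sub_self]
  rw [h.sum_zigzag hn, h.qForm_eq, ← Finset.sum_product', ← Finset.sum_product',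
    ← le_sub_iff_add_le', ← Finset.sum_sub_distrib]
  have h1 : ∑ p ∈ S, (A (p.1 + 1) - A p.1) * (A (p.2 + 1) - A p.2) * X p =
      ∑ p ∈ S.filter (fun p => p.1 < n ∧ p.2 < n),
        (A (p.1 + 1) - A p.1) * (A (p.2 + 1) - A p.2) * X p := by
    rw [Finset.sum_filter]
    refine Finset.sum_congr rfl fun p _ => ?_
    split_ifs with hp
    · rfl
    · rcases not_and_or.1 hp with hp | hp
      · rw [hD0 p.1 (by omega)]
        ring
      · rw [hD0 p.2 (by omega)]
        ring
  rw [h1]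
  refine le_trans (Finset.sum_le_sum (g := fun p : ℕ × ℕ => (A (p.1 + 1) - A p.1) *
      (A (p.2 + 1) - A p.2) * qForm G (layer ρ s p.1) (layer ρ s p.2) -
      (A (p.1 + 1) - A p.1) * (A (p.2 + 1) - A p.2) * zigzagCoeff p.1 p.2) fun p hp => ?_) ?_
  · obtain ⟨hp1, hp2, hp3⟩ := Finset.mem_filter.1 hp
    have := mul_le_mul_of_nonneg_left (hX p hp1 hp2 hp3) (mul_nonneg (hD p.1) (hD p.2))
    linarith
  · refine Finset.sum_le_sum_of_subset_of_nonneg (fun p hp => ?_) fun p hp _ => ?_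
    · simpa using (Finset.mem_filter.1 hp).2
    · rw [Finset.mem_product, Finset.mem_range, Finset.mem_range] at hp
      rw [← mul_sub]
      exact mul_nonneg (mul_nonneg (hD _) (hD _)) (sub_nonneg.2 (zigzagCoeff_le hG hb hp.1 hp.2))

end GapBounds

/-! ### Defects of a ranking of even order -/

theorem fst_ne_of_sign_ne {V : Type*} {s : V → Bool} {u v u' v' : V} (h : s u ≠ s u') :
    (u, v) ≠ (u', v') :=
  fun h' => h (by rw [(Prod.mk.inj h').1])

theorem fst_ne_of_rank_ne {V : Type*} {n : ℕ} {ρ : V ≃ Fin n} {u v u' v' : V}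
    (h : (ρ u : ℕ) ≠ ρ u') : (u, v) ≠ (u', v') :=
  fun h' => h (by rw [(Prod.mk.inj h').1])

theorem snd_ne_of_ne {V : Type*} {u v u' v' : V} (h : v ≠ v') : (u, v) ≠ (u', v') :=
  fun h' => h (Prod.mk.inj h').2

section Defects

variable {V : Type*} [Fintype V] {n : ℕ} {G : SimpleGraph V} {ρ : V ≃ Fin n} {s : V → Bool}

/-- Edge counts which make the form of `G` at least that of the zigzag cycle through all vertices
but the one of rank `i + 1`, with that vertex joined to those of ranks `i` and `i + 2`. -/
structure HasSplitDefect (G : SimpleGraph V) (ρ : V ≃ Fin n) (s : V → Bool) (i : ℕ) : Prop where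
  card₁₁ : 3 ≤ (gapDarts G ρ s (i + 1) (i + 1)).card
  card₂₂ : 3 ≤ (gapDarts G ρ s (i + 2) (i + 2)).card
  card₁₂ : 2 ≤ (gapDarts G ρ s (i + 1) (i + 2)).card
  card₀₂ : 1 ≤ (gapDarts G ρ s i (i + 2)).card
  card₁₃ : 1 ≤ (gapDarts G ρ s (i + 1) (i + 3)).card

/-- Edge counts which make the form of `G` at least that of the zigzag cycle through all vertices
but the one of rank `i + 2`, with that vertex joined to those of ranks `i` and `i + 1`. -/
structure HasTwinDefect (G : SimpleGraph V) (ρ : V ≃ Fin n) (s : V → Bool) (i : ℕ) : Prop where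
  card₁₁ : 3 ≤ (gapDarts G ρ s (i + 1) (i + 1)).card
  card₂₂ : 4 ≤ (gapDarts G ρ s (i + 2) (i + 2)).card
  card₁₂ : 2 ≤ (gapDarts G ρ s (i + 1) (i + 2)).card
  card₁₃ : 1 ≤ (gapDarts G ρ s (i + 1) (i + 3)).card
  card₂₃ : 2 ≤ (gapDarts G ρ s (i + 2) (i + 3)).card
  card₂₄ : i + 4 < n → 1 ≤ (gapDarts G ρ s (i + 2) (i + 4)).card

theorem mem_gapDarts_of_le {k l k' l' : ℕ} {u v : V} (h : (u, v) ∈ gapDarts G ρ s k l)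
    (hk : k ≤ k') (hl : l' ≤ (ρ u : ℕ)) : (u, v) ∈ gapDarts G ρ s k' l' := by
  obtain ⟨h1, -, h2⟩ := mem_gapDarts.1 h
  exact mem_gapDarts.2 ⟨h1, hl, h2.imp_left fun h => h.trans_le hk⟩

/-- There is a twin defect if the vertices of ranks `i + 2` and `i + 3` are `sk` and `ot` in some
order and have the same sign, and if no neighbour of `sk` of the opposite sign lies above the gap
`i + 2`, provided that a further edge rises from below that gap past both vertices or that they are
the two highest ones and `ot` has the property of `sk` as well. -/
theorem hasTwinDefect_of_sink (hG : IsKConnected G 2) {i : ℕ}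
    (hsrc : ∀ u, ∃ v, G.Adj u v ∧ ((ρ v : ℕ) < ρ u ∨ s u = s v)) {sk ot : V} {c : Bool}
    (hranks : ((ρ sk : ℕ) = i + 2 ∧ (ρ ot : ℕ) = i + 3) ∨
      ((ρ sk : ℕ) = i + 3 ∧ (ρ ot : ℕ) = i + 2))
    (hsk : s sk = c) (hot : s ot = c)
    (hsink : ∀ v, G.Adj sk v → (sk, v) ∈ gapDarts G ρ s (i + 2) (i + 2))
    (hextra : (gapDarts G ρ s (i + 2) (i + 4)).Nonempty ∨
      (n = i + 4 ∧ ∀ v, G.Adj ot v → (ot, v) ∈ gapDarts G ρ s (i + 2) (i + 2))) :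
    HasTwinDefect G ρ s i := by
  have hin : i + 3 < n := by
    rcases hranks with ⟨-, h⟩ | ⟨h, -⟩
    · exact h ▸ (ρ ot).2
    · exact h ▸ (ρ sk).2
  obtain ⟨o, ho⟩ : ∃ o, (ρ o : ℕ) = i + 1 := ⟨ρ.symm ⟨i + 1, by omega⟩, rank_symm _⟩
  obtain ⟨z, hz⟩ : ∃ z, (ρ z : ℕ) = 0 := ⟨ρ.symm ⟨0, by omega⟩, rank_symm _⟩
  have hoeq : ∀ v, (ρ v : ℕ) = i + 1 → v = o := fun v hv => ρ.injective (Fin.ext (hv.trans ho.symm))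
  have hskr : i + 2 ≤ (ρ sk : ℕ) := by omega
  have hotr : i + 2 ≤ (ρ ot : ℕ) := by omega
  have hskot : (ρ sk : ℕ) ≠ ρ ot := by omega
  obtain ⟨y₁, hy₁, hy₁o⟩ := hG.exists_adj_vertex_ne sk o
  obtain ⟨y₂, hy₂, hy₁₂⟩ := hG.exists_adj_vertex_ne sk y₁
  have m₁ : (sk, y₁) ∈ gapDarts G ρ s (i + 1) (i + 2) := by
    obtain ⟨-, -, h⟩ := mem_gapDarts.1 (hsink y₁ hy₁)
    have h' : (ρ y₁ : ℕ) ≠ i + 1 := fun h' => hy₁o (hoeq _ h')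
    exact mem_gapDarts.2 ⟨hy₁, hskr, h.imp_left fun h => by omega⟩
  have m₂ := hsink y₂ hy₂
  obtain ⟨v₅, m₅⟩ : ∃ v, (ot, v) ∈ gapDarts G ρ s (i + 2) (i + 2) := by
    obtain ⟨v, hv, h⟩ := hsrc ot
    refine ⟨v, mem_gapDarts.2 ⟨hv, hotr, ?_⟩⟩
    rcases h with h | h
    · by_cases hvsk : v = sk
      · exact Or.inr (by rw [hvsk, hsk, hot])
      · have := rank_ne (ρ := ρ) hvsk
        left
        omega
    · exact Or.inr h
  -- even without `o`, the part above is joined to the part below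
  obtain ⟨u₄, v₄, hu₄, hu₄sk, m₄⟩ : ∃ u v, i + 2 ≤ (ρ u : ℕ) ∧ (ρ u : ℕ) ≠ ρ sk ∧
      (u, v) ∈ gapDarts G ρ s (i + 1) (i + 2) := by
    obtain ⟨u₄, v₄, h₄, hu₄, hv₄, hu₄o, hv₄o⟩ := hG.exists_adj_ne o
      (fun v => i + 2 ≤ (ρ v : ℕ) ∧ (ρ v : ℕ) ≠ ρ sk) (a := ot) (b := z)
      ⟨hotr, hskot.symm⟩ (fun h => by omega)
      (ne_of_rank_ne (ρ := ρ) (by omega)) (ne_of_rank_ne (ρ := ρ) (by omega))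
    refine ⟨u₄, v₄, hu₄.1, hu₄.2, mem_gapDarts.2 ⟨h₄, hu₄.1, ?_⟩⟩
    by_cases hv₄sk : (ρ v₄ : ℕ) = ρ sk
    · right
      obtain rfl : v₄ = sk := ρ.injective (Fin.ext hv₄sk)
      obtain ⟨-, -, h⟩ := mem_gapDarts.1 (hsink u₄ h₄.symm)
      exact (h.resolve_left (not_lt.2 hu₄.1)).symm
    · left
      have h1 : ¬ (i + 2 ≤ (ρ v₄ : ℕ)) := fun h => hv₄ ⟨h, hv₄sk⟩
      have h2 : (ρ v₄ : ℕ) ≠ i + 1 := fun h' => hv₄o (hoeq _ h')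
      omega
  -- no vertex is a source, so that `o` reaches below the gap `i + 1`
  obtain ⟨v₆, m₆⟩ : ∃ v, (o, v) ∈ gapDarts G ρ s (i + 1) (i + 1) := by
    obtain ⟨v, hv, h⟩ := hsrc o
    exact ⟨v, mem_gapDarts.2 ⟨hv, ho.ge, ho ▸ h⟩⟩
  -- the upper of the two vertices reaches below the gap `i + 2`
  obtain ⟨q, w, hqr, mq, hqo⟩ : ∃ q w, (ρ q : ℕ) = i + 3 ∧
      (q, w) ∈ gapDarts G ρ s (i + 2) (i + 3) ∧ (q = sk ∨ q = ot) := by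
    rcases hranks with ⟨h1, h2⟩ | ⟨h1, h2⟩
    · exact ⟨ot, v₅, h2, mem_gapDarts_of_le m₅ le_rfl h2.ge, Or.inr rfl⟩
    · exact ⟨sk, y₁, h1, mem_gapDarts_of_le m₁ (by omega) h1.ge, Or.inl rfl⟩
  refine ⟨?_, ?_, ?_, ?_, ?_, ?_⟩
  · exact three_le_card_gapDarts (mem_gapDarts_of_le m₁ le_rfl (by omega))
      (mem_gapDarts_of_le m₄ le_rfl (by omega)) m₆
      (fst_ne_of_rank_ne (ρ := ρ) hu₄sk.symm) (fst_ne_of_rank_ne (ρ := ρ) (by omega))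
      (fst_ne_of_rank_ne (ρ := ρ) (by omega))
  · have m₁' : (sk, y₁) ∈ gapDarts G ρ s (i + 2) (i + 2) :=
      mem_gapDarts_of_le m₁ (by omega) hskr
    rcases hextra with ⟨⟨u, v⟩, huv⟩ | ⟨-, hot'⟩
    · have hu := (mem_gapDarts.1 huv).2.1
      exact four_le_card_gapDarts m₁' m₂ m₅ (mem_gapDarts_of_le huv le_rfl (by omega))
        (snd_ne_of_ne hy₁₂.symm) (fst_ne_of_rank_ne (ρ := ρ) hskot)
        (fst_ne_of_rank_ne (ρ := ρ) (by omega)) (fst_ne_of_rank_ne (ρ := ρ) hskot)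
        (fst_ne_of_rank_ne (ρ := ρ) (by omega)) (fst_ne_of_rank_ne (ρ := ρ) (by omega))
    · obtain ⟨y₃, hy₃, hy₃₅⟩ := hG.exists_adj_vertex_ne ot v₅
      exact four_le_card_gapDarts m₁' m₂ m₅ (hot' y₃ hy₃)
        (snd_ne_of_ne hy₁₂.symm) (fst_ne_of_rank_ne (ρ := ρ) hskot)
        (fst_ne_of_rank_ne (ρ := ρ) hskot) (fst_ne_of_rank_ne (ρ := ρ) hskot)
        (fst_ne_of_rank_ne (ρ := ρ) hskot) (snd_ne_of_ne hy₃₅.symm)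
  · exact two_le_card_gapDarts m₁ m₄ (fst_ne_of_rank_ne (ρ := ρ) hu₄sk.symm)
  · rcases hranks with ⟨h1, h2⟩ | ⟨h1, h2⟩
    · exact one_le_card_gapDarts (mem_gapDarts_of_le m₄ le_rfl (by omega))
    · exact one_le_card_gapDarts (mem_gapDarts_of_le m₁ le_rfl (by omega))
  · rcases hextra with ⟨⟨u, v⟩, huv⟩ | ⟨-, hot'⟩
    · have hu := (mem_gapDarts.1 huv).2.1
      exact two_le_card_gapDarts mq (mem_gapDarts_of_le huv le_rfl (by omega))
        (fst_ne_of_rank_ne (ρ := ρ) (by omega))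
    · obtain ⟨w', hw', hww'⟩ := hG.exists_adj_vertex_ne q w
      refine two_le_card_gapDarts mq (q := (q, w'))
        (mem_gapDarts_of_le (k := i + 2) (l := i + 2) ?_ le_rfl hqr.ge) (snd_ne_of_ne hww'.symm)
      rcases hqo with rfl | rfl
      · exact hsink _ hw'
      · exact hot' _ hw'
  · intro h4
    rcases hextra with h | ⟨h, -⟩
    · exact Finset.card_pos.2 h
    · omega

/-- If all edges above the gap `i` have upper ends of the same sign, then either the same holds for
the gap `i + 2`, or there is a defect near the gap `i + 2`, or one of the two vertices between these
gaps has only neighbours of its own sign. -/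
theorem monochromatic_step (hG : IsKConnected G 2) (hb : ¬ G.IsBipartite) {i : ℕ}
    (hie : Even i) (hi : i + 2 < n)
    (hsrc : ∀ u, ∃ v, G.Adj u v ∧ ((ρ v : ℕ) < ρ u ∨ s u = s v)) {c : Bool}
    (hmono : ∀ u v, (u, v) ∈ gapDarts G ρ s i i → s u = c) :
    (∃ c', ∀ u v, (u, v) ∈ gapDarts G ρ s (i + 2) (i + 2) → s u = c') ∨
      HasSplitDefect G ρ s i ∨ (∃ j, i = j + 2 ∧ HasTwinDefect G ρ s j) ∨
      (i = 0 ∧ ∃ u, ∀ v, G.Adj u v → s u = s v) := by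
  by_cases hbi : ∃ c', ∀ u v, (u, v) ∈ gapDarts G ρ s (i + 2) (i + 2) → s u = c'
  · exact Or.inl hbi
  right
  push Not at hbi
  obtain ⟨p, hp⟩ : ∃ p, (ρ p : ℕ) = i := ⟨ρ.symm ⟨i, by omega⟩, rank_symm _⟩
  obtain ⟨q, hq⟩ : ∃ q, (ρ q : ℕ) = i + 1 := ⟨ρ.symm ⟨i + 1, by omega⟩, rank_symm _⟩
  have hpeq : ∀ v, (ρ v : ℕ) = i → v = p := fun v hv => ρ.injective (Fin.ext (hv.trans hp.symm))
  have hqeq : ∀ v, (ρ v : ℕ) = i + 1 → v = q :=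
    fun v hv => ρ.injective (Fin.ext (hv.trans hq.symm))
  have hmono' : ∀ u v, G.Adj u v → i ≤ (ρ u : ℕ) → ((ρ v : ℕ) < i ∨ s u = s v) → s u = c :=
    fun u v h1 h2 h3 => hmono u v (mem_gapDarts.2 ⟨h1, h2, h3⟩)
  have hsp : s p = c := by
    obtain ⟨v, h1, h2⟩ := hsrc p
    exact hmono' p v h1 hp.ge (h2.imp_left (by omega))
  have hpq : p ≠ q := ne_of_rank_ne (ρ := ρ) (by omega)
  -- an edge whose upper end has the sign `!c`: its lower end is `p` or `q`
  obtain ⟨u₂, v₂, hmem₂, hu₂c⟩ := hbi c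
  obtain ⟨h₂, hu₂, hv₂⟩ := mem_gapDarts.1 hmem₂
  have hv₂s : s u₂ ≠ s v₂ := fun h => hu₂c (hmono' _ _ h₂ (by omega) (Or.inr h))
  have hv₂pq : v₂ = p ∨ v₂ = q := by
    rcases hv₂ with h | h
    · have h3 : ¬ (ρ v₂ : ℕ) < i := fun h' => hu₂c (hmono' _ _ h₂ (by omega) (Or.inl h'))
      rcases (show (ρ v₂ : ℕ) = i ∨ (ρ v₂ : ℕ) = i + 1 by omega) with h4 | h4
      · exact Or.inl (hpeq _ h4)
      · exact Or.inr (hqeq _ h4)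
    · exact absurd h hv₂s
  have hv₂c : s v₂ = c := by
    revert hu₂c hv₂s
    cases s u₂ <;> cases s v₂ <;> cases c <;> simp
  by_cases hsq : s q = c
  · -- an edge whose upper end has the sign `c`
    obtain ⟨u₃, v₃, hmem₃, hu₃c⟩ := hbi (!c)
    obtain ⟨h₃, hu₃, hv₃⟩ := mem_gapDarts.1 hmem₃
    have hu₃c : s u₃ = c := by
      revert hu₃c
      cases s u₃ <;> cases c <;> simp
    have hv₃' : (ρ v₃ : ℕ) < i ∨ s u₃ = s v₃ := by
      rcases hv₃ with h | h
      · by_cases h5 : (ρ v₃ : ℕ) < i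
        · exact Or.inl h5
        · right
          rcases (show (ρ v₃ : ℕ) = i ∨ (ρ v₃ : ℕ) = i + 1 by omega) with h4 | h4
          · rw [hpeq _ h4, hsp, hu₃c]
          · rw [hqeq _ h4, hsq, hu₃c]
      · exact Or.inr h
    have hu₂₃ : s u₂ ≠ s u₃ := by rwa [hu₃c]
    have hranku : (ρ u₂ : ℕ) ≠ ρ u₃ := fun h => hu₂₃ (by rw [ρ.injective (Fin.ext h)])
    -- a split defect, unless `p` or `q` has no neighbour of sign `!c` above both
    by_cases hreg : (∃ z, G.Adj z p ∧ i + 2 ≤ (ρ z : ℕ) ∧ s z ≠ c) ∧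
        (∃ z, G.Adj z q ∧ i + 2 ≤ (ρ z : ℕ) ∧ s z ≠ c)
    · left
      obtain ⟨⟨zp, hzp, hzpr, hzps⟩, ⟨zq, hzq, hzqr, hzqs⟩⟩ := hreg
      obtain ⟨vq, hvq, hvq'⟩ := hsrc q
      have hzu : s u₃ ≠ s zp := by rw [hu₃c]; exact hzps.symm
      have hzu' : s u₃ ≠ s zq := by rw [hu₃c]; exact hzqs.symm
      have hranku : (ρ u₃ : ℕ) ≠ ρ zp := fun h => hzu (by rw [ρ.injective (Fin.ext h)])
      have m3 : ∀ k l, i ≤ k → l ≤ (ρ u₃ : ℕ) → (u₃, v₃) ∈ gapDarts G ρ s k l :=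
        fun k l hk hl => mem_gapDarts.2 ⟨h₃, hl, hv₃'.imp_left (by omega)⟩
      have mzp : ∀ k l, i + 1 ≤ k → l ≤ (ρ zp : ℕ) → (zp, p) ∈ gapDarts G ρ s k l :=
        fun k l hk hl => mem_gapDarts.2 ⟨hzp, hl, Or.inl (by omega)⟩
      refine ⟨?_, ?_, ?_, ?_, ?_⟩
      · exact three_le_card_gapDarts (p := (q, vq)) (q := (u₃, v₃)) (r := (zp, p))
          (mem_gapDarts.2 ⟨hvq, by omega, hvq'.imp_left (by omega)⟩)
          (m3 _ _ (by omega) (by omega)) (mzp _ _ (by omega) (by omega))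
          (fst_ne_of_rank_ne (ρ := ρ) (by omega)) (fst_ne_of_rank_ne (ρ := ρ) (by omega))
          (fst_ne_of_sign_ne hzu)
      · exact three_le_card_gapDarts (p := (u₃, v₃)) (q := (zp, p)) (r := (zq, q))
          (m3 _ _ (by omega) (by omega)) (mzp _ _ (by omega) (by omega))
          (mem_gapDarts.2 ⟨hzq, by omega, Or.inl (by omega)⟩)
          (fst_ne_of_sign_ne hzu) (fst_ne_of_sign_ne hzu') (snd_ne_of_ne hpq)
      · exact two_le_card_gapDarts (p := (u₃, v₃)) (q := (zp, p))
          (m3 _ _ (by omega) (by omega)) (mzp _ _ (by omega) (by omega)) (fst_ne_of_sign_ne hzu)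
      · exact one_le_card_gapDarts (m3 _ _ (by omega) (by omega))
      · by_cases h : i + 3 ≤ (ρ u₃ : ℕ)
        · exact one_le_card_gapDarts (m3 _ _ (by omega) h)
        · exact one_le_card_gapDarts (mzp _ _ (by omega) (by omega))
    · right
      -- `sk` is the vertex without a neighbour of sign `!c` above, `ot` the other one
      obtain ⟨sk, ot, hranks, hsk, hot, hsink⟩ : ∃ sk ot,
          (((ρ sk : ℕ) = i ∧ (ρ ot : ℕ) = i + 1) ∨ ((ρ sk : ℕ) = i + 1 ∧ (ρ ot : ℕ) = i)) ∧
          s sk = c ∧ s ot = c ∧ ∀ v, G.Adj sk v → (ρ v : ℕ) < i ∨ s sk = s v := by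
        have aux : ∀ w, s w = c → ¬ (∃ z, G.Adj z w ∧ i + 2 ≤ (ρ z : ℕ) ∧ s z ≠ c) →
            ∀ v, G.Adj w v → (ρ v : ℕ) < i ∨ s w = s v := by
          intro w hw hno v hv
          by_contra! hcon
          refine hno ⟨v, hv.symm, ?_, fun h => hcon.2 (by rw [hw, h])⟩
          by_contra! h
          rcases (show (ρ v : ℕ) = i ∨ (ρ v : ℕ) = i + 1 by omega) with h4 | h4
          · exact hcon.2 (by rw [hpeq _ h4, hw, hsp])
          · exact hcon.2 (by rw [hqeq _ h4, hw, hsq])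
        rcases not_and_or.1 hreg with h | h
        · exact ⟨p, q, Or.inl ⟨hp, hq⟩, hsp, hsq, aux p hsp h⟩
        · exact ⟨q, p, Or.inr ⟨hq, hp⟩, hsq, hsp, aux q hsq h⟩
      rcases (show i = 0 ∨ ∃ j, i = j + 2 from by
        rcases i with _ | _ | j
        · exact Or.inl rfl
        · exact absurd hie (by decide)
        · exact Or.inr ⟨j, rfl⟩) with h0 | ⟨j, rfl⟩
      · exact Or.inr ⟨h0, sk, fun v hv => (hsink v hv).resolve_left (by omega)⟩
      · refine Or.inl ⟨j, rfl, hasTwinDefect_of_sink hG hsrc hranks hsk hot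
          (fun v hv => mem_gapDarts.2 ⟨hv, by omega, hsink v hv⟩)
          (Or.inl ⟨(u₃, v₃), mem_gapDarts.2 ⟨h₃, by omega, hv₃'⟩⟩)⟩
  · left
    have hv₂p : v₂ = p := hv₂pq.resolve_right fun h => hsq (h ▸ hv₂c)
    subst hv₂p
    -- all neighbours of `q` except `v₂` lie above it and have the sign `c`
    have hqn : ∀ v, G.Adj q v → v ≠ v₂ → i + 2 ≤ (ρ v : ℕ) ∧ s v = c := by
      intro v hv hvp
      have h1 : ¬ ((ρ v : ℕ) < i ∨ s q = s v) := fun h => hsq (hmono' q v hv (by omega) h)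
      rw [not_or] at h1
      have h2 := rank_ne (ρ := ρ) hvp
      have h3 := rank_ne (ρ := ρ) hv.ne
      refine ⟨by omega, ?_⟩
      have h4 := h1.2
      revert h4 hsq
      cases s q <;> cases s v <;> cases c <;> simp
    have hqp : G.Adj q v₂ := by
      obtain ⟨v, hv, hv'⟩ := hsrc q
      by_contra hcon
      have h1 := hqn v hv (fun h => hcon (h ▸ hv))
      rcases hv' with h | h
      · omega
      · exact hsq (h.trans h1.2)
    obtain ⟨z, hz, hzp⟩ := hG.exists_adj_vertex_ne q v₂
    obtain ⟨hzr, hzs⟩ := hqn z hz hzp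
    -- an edge reaching below the gap `i` even without `v₂`; if `i = 0`, one with equal signs
    obtain ⟨u₃, v₃, h₃, hu₃, hu₃c, hv₃⟩ : ∃ u v, G.Adj u v ∧ i + 2 ≤ (ρ u : ℕ) ∧ s u = c ∧
        ((ρ v : ℕ) < i ∨ s u = s v) := by
      rcases Nat.eq_zero_or_pos i with rfl | hi0
      · obtain ⟨u, v, huv, hs⟩ := exists_adj_same_sign hb s
        have hu := hmono' u v huv (Nat.zero_le _) (Or.inr hs)
        have hv := hmono' v u huv.symm (Nat.zero_le _) (Or.inr hs.symm)
        have key : ∀ w, s w = c → w ≠ v₂ → 0 + 2 ≤ (ρ w : ℕ) := fun w hw hwp => by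
          have h1 : (ρ w : ℕ) ≠ 0 + 1 := fun h => hsq (hqeq _ h ▸ hw)
          have h2 : (ρ w : ℕ) ≠ 0 := fun h => hwp (hpeq _ h)
          omega
        by_cases hup : u = v₂
        · exact ⟨v, u, huv.symm, key v hv (fun h => huv.ne (hup.trans h.symm)), hv,
            Or.inr hs.symm⟩
        · exact ⟨u, v, huv, key u hu hup, hu, Or.inr hs⟩
      · obtain ⟨y, hy⟩ : ∃ y, (ρ y : ℕ) = 0 := ⟨ρ.symm ⟨0, by omega⟩, rank_symm _⟩
        obtain ⟨u, v, huv, hu, hv, hup, hvp⟩ := hG.exists_adj_ne v₂ (fun v => i ≤ (ρ v : ℕ))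
          (a := q) (b := y) (by omega) (by omega) hpq.symm
          (ne_of_rank_ne (ρ := ρ) (by omega))
        have huc := hmono' u v huv hu (Or.inl (not_le.1 hv))
        have h1 := rank_ne (ρ := ρ) hup
        have h2 : (ρ u : ℕ) ≠ i + 1 := fun h => hsq (hqeq _ h ▸ huc)
        exact ⟨u, v, huv, by omega, huc, Or.inl (not_le.1 hv)⟩
    have hu₂₃ : s u₂ ≠ s u₃ := by rwa [hu₃c]
    have hranku : (ρ u₂ : ℕ) ≠ ρ u₃ := fun h => hu₂₃ (by rw [ρ.injective (Fin.ext h)])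
    have m3 : ∀ k l, i ≤ k → l ≤ (ρ u₃ : ℕ) → (u₃, v₃) ∈ gapDarts G ρ s k l :=
      fun k l hk hl => mem_gapDarts.2 ⟨h₃, hl, hv₃.imp_left (by omega)⟩
    have m2 : ∀ k l, i + 1 ≤ k → l ≤ (ρ u₂ : ℕ) → (u₂, v₂) ∈ gapDarts G ρ s k l :=
      fun k l hk hl => mem_gapDarts.2 ⟨h₂, hl, Or.inl (by omega)⟩
    have hv₃q : v₃ ≠ q := by
      rintro rfl
      rcases hv₃ with h | h
      · omega
      · exact hsq (h ▸ hu₃c)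
    refine ⟨?_, ?_, ?_, ?_, ?_⟩
    · exact three_le_card_gapDarts (p := (q, v₂)) (q := (u₂, v₂)) (r := (u₃, v₃))
        (mem_gapDarts.2 ⟨hqp, by omega, Or.inl (by omega)⟩)
        (m2 _ _ (by omega) (by omega)) (m3 _ _ (by omega) (by omega))
        (fst_ne_of_rank_ne (ρ := ρ) (by omega)) (fst_ne_of_rank_ne (ρ := ρ) (by omega))
        (fst_ne_of_sign_ne hu₂₃)
    · exact three_le_card_gapDarts (p := (z, q)) (q := (u₂, v₂)) (r := (u₃, v₃))
        (mem_gapDarts.2 ⟨hz.symm, by omega, Or.inl (by omega)⟩)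
        (m2 _ _ (by omega) (by omega)) (m3 _ _ (by omega) (by omega))
        (fst_ne_of_sign_ne (s := s) (show s z ≠ s u₂ by rw [hzs]; exact hu₂c.symm))
        (snd_ne_of_ne hv₃q.symm)
        (fst_ne_of_sign_ne hu₂₃)
    · exact two_le_card_gapDarts (p := (u₂, v₂)) (q := (u₃, v₃))
        (m2 _ _ (by omega) (by omega)) (m3 _ _ (by omega) (by omega)) (fst_ne_of_sign_ne hu₂₃)
    · exact one_le_card_gapDarts (m3 _ _ (by omega) (by omega))
    · by_cases h : i + 3 ≤ (ρ u₃ : ℕ)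
      · exact one_le_card_gapDarts (m3 _ _ (by omega) h)
      · exact one_le_card_gapDarts (m2 _ _ (by omega) (by omega))

/-- The two lowest vertices have opposite signs, and each has one neighbour besides the other; that
neighbour has its sign. -/
structure IsLowPair (G : SimpleGraph V) (ρ : V ≃ Fin n) (s : V → Bool) (p q u v : V) : Prop where
  sign_ne : s p ≠ s q
  rank_left : (ρ p : ℕ) < 2
  rank_right : (ρ q : ℕ) < 2
  sign_left : s u = s p
  sign_right : s v = s q
  le_left : 2 ≤ (ρ u : ℕ)
  le_right : 2 ≤ (ρ v : ℕ)
  adj_left : ∀ w, G.Adj p w → w = q ∨ w = u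
  adj_right : ∀ w, G.Adj q w → w = p ∨ w = v

/-- If edges with ends of the same sign occur for both signs, then there is a defect at the bottom,
or an exceptional pair of lowest vertices. -/
theorem hasSplitDefect_zero (hG : IsKConnected G 2)
    (hbi : ∀ c, ∃ u v, (u, v) ∈ gapDarts G ρ s 0 0 ∧ s u ≠ c) :
    HasSplitDefect G ρ s 0 ∨ ∃ p q u v, IsLowPair G ρ s p q u v := by
  have aux : ∀ c, ∃ u v, G.Adj u v ∧ s u = c ∧ s v = c ∧ (ρ v : ℕ) < ρ u := by
    intro c
    obtain ⟨u, v, huv, hu⟩ := hbi (!c)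
    obtain ⟨h1, -, h2⟩ := mem_gapDarts.1 huv
    have h3 := h2.resolve_left (Nat.not_lt_zero _)
    have h4 : s u = c := by
      revert hu
      cases s u <;> cases c <;> simp
    rcases lt_or_gt_of_ne (rank_ne (ρ := ρ) h1.ne) with h | h
    · exact ⟨v, u, h1.symm, h3 ▸ h4, h4, h⟩
    · exact ⟨u, v, h1, h4, h3 ▸ h4, h⟩
  obtain ⟨u, u', huu, hu, hu', hur⟩ := aux true
  obtain ⟨y, y', hyy, hy, hy', hyr⟩ := aux false
  have m : ∀ v w, G.Adj v w → s v = s w → ∀ k l, l ≤ (ρ v : ℕ) → (v, w) ∈ gapDarts G ρ s k l :=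
    fun v w h1 h2 k l hl => mem_gapDarts.2 ⟨h1, hl, Or.inr h2⟩
  have mu := m u u' huu (by rw [hu, hu'])
  have mu' := m u' u huu.symm (by rw [hu, hu'])
  have my := m y y' hyy (by rw [hy, hy'])
  have my' := m y' y hyy.symm (by rw [hy, hy'])
  have hne : ∀ v w, s v = true → s w = false → (ρ v : ℕ) ≠ ρ w := fun v w h1 h2 h => by
    rw [ρ.injective (Fin.ext h), h2] at h1
    exact Bool.false_ne_true h1
  have n1 := hne u y hu hy
  have n2 := hne u y' hu hy'
  have n3 := hne u' y hu' hy
  have n4 := hne u' y' hu' hy'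
  -- a lowest vertex on the lower of the two edges has a further neighbour
  have third : ∀ (a a' b b' : V), (∀ k l, l ≤ (ρ a : ℕ) → (a, a') ∈ gapDarts G ρ s k l) →
      (∀ k l, l ≤ (ρ a' : ℕ) → (a', a) ∈ gapDarts G ρ s k l) → (ρ a : ℕ) ≠ ρ b →
      (ρ a' : ℕ) ≠ ρ b → (ρ a' : ℕ) < ρ a → (ρ b' : ℕ) < ρ b → 2 ≤ (ρ a' : ℕ) → (ρ b : ℕ) < 2 →
      3 ≤ (gapDarts G ρ s 2 2).card := by
    intro a a' b b' ma ma' h1 h2 h3 h4 h5 h6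
    obtain ⟨z, hz, hzb⟩ := hG.exists_adj_vertex_ne b b'
    have h7 := rank_ne (ρ := ρ) hz.ne
    have h8 := rank_ne (ρ := ρ) hzb
    refine three_le_card_gapDarts (ma 2 2 (by omega)) (ma' 2 2 h5) (r := (z, b))
      (mem_gapDarts.2 ⟨hz.symm, by omega, Or.inl h6⟩) (fst_ne_of_rank_ne (ρ := ρ) (by omega)) ?_ ?_
    · exact snd_ne_of_ne (ne_of_rank_ne (ρ := ρ) h2)
    · exact snd_ne_of_ne (ne_of_rank_ne (ρ := ρ) h1)
  -- the other counts of a split defect come from the edges `u u'` and `y y'` alone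
  have split_of : 3 ≤ (gapDarts G ρ s 2 2).card → HasSplitDefect G ρ s 0 := by
    intro h22
    refine ⟨?_, h22, ?_, ?_, ?_⟩
    · by_cases h : 1 ≤ (ρ u' : ℕ)
      · exact three_le_card_gapDarts (mu' _ _ h) (mu _ _ (by omega)) (my _ _ (by omega))
          (fst_ne_of_rank_ne (ρ := ρ) (by omega)) (fst_ne_of_rank_ne (ρ := ρ) (by omega))
          (fst_ne_of_rank_ne (ρ := ρ) (by omega))
      · exact three_le_card_gapDarts (my' _ _ (by omega)) (mu _ _ (by omega)) (my _ _ (by omega))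
          (fst_ne_of_rank_ne (ρ := ρ) (by omega)) (fst_ne_of_rank_ne (ρ := ρ) (by omega))
          (fst_ne_of_rank_ne (ρ := ρ) (by omega))
    · by_cases h : 2 ≤ (ρ y : ℕ)
      · by_cases h' : 2 ≤ (ρ u : ℕ)
        · exact two_le_card_gapDarts (mu _ _ h') (my _ _ h) (fst_ne_of_rank_ne (ρ := ρ) n1)
        · exact two_le_card_gapDarts (my' _ _ (by omega)) (my _ _ h)
            (fst_ne_of_rank_ne (ρ := ρ) (by omega))
      · exact two_le_card_gapDarts (mu' _ _ (by omega)) (mu _ _ (by omega))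
            (fst_ne_of_rank_ne (ρ := ρ) (by omega))
    · by_cases h : 2 ≤ (ρ y : ℕ)
      · exact one_le_card_gapDarts (my _ _ h)
      · exact one_le_card_gapDarts (mu _ _ (by omega))
    · by_cases h : 3 ≤ (ρ y : ℕ)
      · exact one_le_card_gapDarts (my _ _ h)
      · exact one_le_card_gapDarts (mu _ _ (by omega))
  by_cases h1 : 2 ≤ (ρ u' : ℕ)
  · left
    apply split_of
    by_cases h2 : 2 ≤ (ρ y : ℕ)
    · exact three_le_card_gapDarts (mu' _ _ h1) (mu _ _ (by omega)) (my _ _ h2)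
          (fst_ne_of_rank_ne (ρ := ρ) (by omega)) (fst_ne_of_rank_ne (ρ := ρ) n3)
          (fst_ne_of_rank_ne (ρ := ρ) n1)
    · exact third u u' y y' mu mu' n1 n3 hur hyr h1 (by omega)
  by_cases h2 : 2 ≤ (ρ y' : ℕ)
  · left
    apply split_of
    by_cases h3 : 2 ≤ (ρ u : ℕ)
    · exact three_le_card_gapDarts (my' _ _ h2) (my _ _ (by omega)) (mu _ _ h3)
          (fst_ne_of_rank_ne (ρ := ρ) (by omega)) (fst_ne_of_rank_ne (ρ := ρ) n2.symm)
          (fst_ne_of_rank_ne (ρ := ρ) n1.symm)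
    · exact third y y' u u' my my' n1.symm n2.symm hyr hur h2 (by omega)
  by_cases h3 : ∃ w a b, G.Adj w b ∧ ((a = u ∧ b = u') ∨ (a = y ∧ b = y')) ∧ 2 ≤ (ρ w : ℕ) ∧ w ≠ a
  · left
    apply split_of
    obtain ⟨w, a, b, hwb, hab, hw, hwa⟩ := h3
    refine three_le_card_gapDarts (p := (w, b)) (mem_gapDarts.2 ⟨hwb, hw, Or.inl ?_⟩)
      (mu _ _ (by omega)) (my _ _ (by omega)) ?_ ?_ (fst_ne_of_rank_ne (ρ := ρ) n1)
    · rcases hab with ⟨-, rfl⟩ | ⟨-, rfl⟩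
      · exact not_le.1 h1
      · exact not_le.1 h2
    · rcases hab with ⟨rfl, rfl⟩ | ⟨rfl, rfl⟩
      · exact fun h => hwa (Prod.mk.inj h).1
      · exact snd_ne_of_ne (ne_of_rank_ne (ρ := ρ) n4.symm)
    · rcases hab with ⟨rfl, rfl⟩ | ⟨rfl, rfl⟩
      · exact snd_ne_of_ne (ne_of_rank_ne (ρ := ρ) n4)
      · exact fun h => hwa (Prod.mk.inj h).1
  · right
    push Not at h3
    have low : ∀ w, (ρ w : ℕ) < 2 → w = u' ∨ w = y' := fun w hw => by
      rcases (show (ρ w : ℕ) = ρ u' ∨ (ρ w : ℕ) = ρ y' by omega) with h | h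
      · exact Or.inl (ρ.injective (Fin.ext h))
      · exact Or.inr (ρ.injective (Fin.ext h))
    refine ⟨u', y', u, y, by rw [hu', hy']; simp, by omega, by omega, by rw [hu, hu'],
      by rw [hy, hy'], by omega, by omega, fun w hw => ?_, fun w hw => ?_⟩
    · by_cases h : 2 ≤ (ρ w : ℕ)
      · exact Or.inr (h3 w u u' hw.symm (Or.inl ⟨rfl, rfl⟩) h)
      · exact Or.inl ((low w (by omega)).resolve_left hw.ne')
    · by_cases h : 2 ≤ (ρ w : ℕ)
      · exact Or.inr (h3 w y y' hw.symm (Or.inr ⟨rfl, rfl⟩) h)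
      · exact Or.inl ((low w (by omega)).resolve_right hw.ne')

/-- A ranking of an even number of vertices without sources has a defect, or an exceptional vertex
or pair of vertices. Otherwise all edges rising through an even gap would have upper ends of the
same sign, by induction on the gap; but at the gap below the two highest vertices this is itself a
twin defect. -/
theorem exists_defect (hG : IsKConnected G 2) (hb : ¬ G.IsBipartite) (hn : Even n)
    (hsrc : ∀ u, ∃ v, G.Adj u v ∧ ((ρ v : ℕ) < ρ u ∨ s u = s v)) :
    (∃ u, ∀ v, G.Adj u v → s u = s v) ∨ (∃ p q u v, IsLowPair G ρ s p q u v) ∨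
      ∃ i, Even i ∧ i + 4 ≤ n ∧ (HasSplitDefect G ρ s i ∨ HasTwinDefect G ρ s i) := by
  have hn3 : 3 ≤ n := by
    have := hG.1
    rwa [Fintype.card_congr ρ, Fintype.card_fin] at this
  have hn4 : 4 ≤ n := by
    rcases hn with ⟨r, hr⟩
    omega
  by_contra! hcon
  obtain ⟨h1, h2, h3⟩ := hcon
  have h3s : ∀ i, Even i → i + 4 ≤ n → ¬ HasSplitDefect G ρ s i := fun i hi hi' => (h3 i hi hi').1
  have h3t : ∀ i, Even i → i + 4 ≤ n → ¬ HasTwinDefect G ρ s i := fun i hi hi' => (h3 i hi hi').2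
  have hmono : ∀ j, 2 * j + 2 ≤ n →
      ∃ c, ∀ u v, (u, v) ∈ gapDarts G ρ s (2 * j) (2 * j) → s u = c := by
    intro j
    induction j with
    | zero =>
      intro _
      by_contra! hbi
      rcases hasSplitDefect_zero hG hbi with h | ⟨p, q, u, v, h⟩
      · exact h3s 0 (by simp) hn4 h
      · exact h2 p q u v h
    | succ j ih =>
      intro hj
      obtain ⟨c, hc⟩ := ih (by omega)
      rcases monochromatic_step hG hb (by simp) (by omega) hsrc hc with
        h | h | ⟨i, hi, h⟩ | ⟨-, u, h⟩
      · exact h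
      · exact absurd h (h3s _ (by simp) (by omega))
      · have hie : Even i := by
          rcases Nat.even_or_odd' i with ⟨r, h | h⟩
          · exact ⟨r, by omega⟩
          · omega
        exact absurd h (h3t i hie (by omega))
      · obtain ⟨v, hv, hv'⟩ := h1 u
        exact absurd (h v hv) hv'
  obtain ⟨m, hm⟩ := hn
  obtain ⟨c, hc⟩ := hmono (m - 1) (by omega)
  obtain ⟨i, rfl⟩ : ∃ i, n = i + 4 := ⟨n - 4, by omega⟩
  have hmi : 2 * (m - 1) = i + 2 := by omega
  rw [hmi] at hc
  obtain ⟨p, hp⟩ : ∃ p, (ρ p : ℕ) = i + 2 := ⟨ρ.symm ⟨i + 2, by omega⟩, rank_symm _⟩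
  obtain ⟨q, hq⟩ : ∃ q, (ρ q : ℕ) = i + 3 := ⟨ρ.symm ⟨i + 3, by omega⟩, rank_symm _⟩
  have hsp : s p = c := by
    obtain ⟨v, hv, h⟩ := hsrc p
    exact hc p v (mem_gapDarts.2 ⟨hv, hp.ge, by rwa [hp] at h⟩)
  have hup : ∀ v, i + 2 ≤ (ρ v : ℕ) → v = p ∨ v = q := fun v hv => by
    have := (ρ v).2
    rcases (show (ρ v : ℕ) = ρ p ∨ (ρ v : ℕ) = ρ q by omega) with h | h
    · exact Or.inl (ρ.injective (Fin.ext h))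
    · exact Or.inr (ρ.injective (Fin.ext h))
  have hsq : s q = c := by
    by_contra hsq
    obtain ⟨v, hv, hvp⟩ := hG.exists_adj_vertex_ne q p
    refine hsq (hc q v (mem_gapDarts.2 ⟨hv, by omega, Or.inl ?_⟩))
    by_contra! h
    rcases hup v h with h | h
    · exact hvp h
    · exact hv.ne h.symm
  have hall : ∀ w, (w = p ∨ w = q) → ∀ v, G.Adj w v → (w, v) ∈ gapDarts G ρ s (i + 2) (i + 2) := by
    intro w hw v hv
    have hws : s w = c ∧ i + 2 ≤ (ρ w : ℕ) := by
      rcases hw with rfl | rfl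
      · exact ⟨hsp, hp.ge⟩
      · exact ⟨hsq, by omega⟩
    refine mem_gapDarts.2 ⟨hv, hws.2, ?_⟩
    by_cases h : (ρ v : ℕ) < i + 2
    · exact Or.inl h
    · right
      rcases hup v (by omega) with rfl | rfl
      · rw [hws.1, hsp]
      · rw [hws.1, hsq]
  exact h3t i ⟨m - 2, by omega⟩ (by omega) (hasTwinDefect_of_sink hG hsrc (Or.inr ⟨hq, hp⟩) hsq hsp
    (hall q (Or.inr rfl)) (Or.inr ⟨rfl, hall p (Or.inl rfl)⟩))

end Defects

/-! ### Removing a vertex from the zigzag cycle -/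

/-- The sequence `A` without its term of index `W`. -/
def eraseTerm (A : ℕ → ℝ) (W k : ℕ) : ℝ := if k < W then A k else A (k + 1)

theorem eraseTerm_mono {A : ℕ → ℝ} (hA : Monotone A) (W : ℕ) : Monotone (eraseTerm A W) := by
  refine monotone_nat_of_le_succ fun k => ?_
  unfold eraseTerm
  split_ifs
  · exact hA (by omega)
  · exact hA (by omega)
  · omega
  · exact hA (by omega)

theorem sum_eraseTerm (A : ℕ → ℝ) (r m : ℕ) :
    ∑ k ∈ Finset.range (m + 2 + r), eraseTerm A (m + 2) (k + 1) ^ 2 + A (m + 2) ^ 2 =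
      ∑ k ∈ Finset.range (m + 2 + r + 1), A (k + 1) ^ 2 := by
  rw [show m + 2 + r + 1 = (m + 1) + (1 + 1 + r) by ring,
    show m + 2 + r = (m + 1) + (1 + r) by ring]
  simp only [Finset.sum_range_add, Finset.sum_range_one]
  have h1 : ∑ k ∈ Finset.range m, eraseTerm A (m + 2) (k + 1) ^ 2 =
      ∑ k ∈ Finset.range m, A (k + 1) ^ 2 :=
    Finset.sum_congr rfl fun k hk => by
      rw [eraseTerm, if_pos (by have := Finset.mem_range.1 hk; omega)]
  have h2 : ∑ k ∈ Finset.range r, eraseTerm A (m + 2) (m + 1 + (1 + k) + 1) ^ 2 =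
      ∑ k ∈ Finset.range r, A (m + 1 + (1 + 1 + k) + 1) ^ 2 :=
    Finset.sum_congr rfl fun k _ => by
      rw [eraseTerm, if_neg (by omega)]
      congr 2
      omega
  have e1 : eraseTerm A (m + 2) (m + 0 + 1) = A (m + 1) := if_pos (by omega)
  have e2 : eraseTerm A (m + 2) (m + 1 + 0 + 1) = A (m + 3) := if_neg (by omega)
  rw [h1, h2, e1, e2]
  ring_nf

/-- Removing the term `A (m + 2)` replaces the three squares of the zigzag sum that involve it or
bridge it by two squares. -/
theorem zigzag_eraseTerm (A : ℕ → ℝ) (r m : ℕ) :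
    ∑ k ∈ Finset.range (m + 2 + r), (eraseTerm A (m + 2) (k + 2) - eraseTerm A (m + 2) k) ^ 2 +
        ((A (m + 2) - A m) ^ 2 + (A (m + 3) - A (m + 1)) ^ 2 + (A (m + 4) - A (m + 2)) ^ 2) =
      ∑ k ∈ Finset.range (m + 2 + r + 1), (A (k + 2) - A k) ^ 2 +
        ((A (m + 3) - A m) ^ 2 + (A (m + 4) - A (m + 1)) ^ 2) := by
  rw [show m + 2 + r + 1 = m + (1 + 1 + 1 + r) by ring, show m + 2 + r = m + (1 + 1 + r) by ring]
  simp only [Finset.sum_range_add, Finset.sum_range_one]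
  have h1 : ∑ k ∈ Finset.range m, (eraseTerm A (m + 2) (k + 2) - eraseTerm A (m + 2) k) ^ 2 =
      ∑ k ∈ Finset.range m, (A (k + 2) - A k) ^ 2 :=
    Finset.sum_congr rfl fun k hk => by
      have := Finset.mem_range.1 hk
      rw [eraseTerm, eraseTerm, if_pos (by omega), if_pos (by omega)]
  have h2 : ∑ k ∈ Finset.range r, (eraseTerm A (m + 2) (m + (1 + 1 + k) + 2) -
        eraseTerm A (m + 2) (m + (1 + 1 + k))) ^ 2 =
      ∑ k ∈ Finset.range r, (A (m + (1 + 1 + 1 + k) + 2) - A (m + (1 + 1 + 1 + k))) ^ 2 :=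
    Finset.sum_congr rfl fun k _ => by
      rw [eraseTerm, eraseTerm, if_neg (by omega), if_neg (by omega)]
      congr 3 <;> omega
  rw [h1, h2]
  have e1 : eraseTerm A (m + 2) (m + 0 + 2) = A (m + 3) := if_neg (by omega)
  have e2 : eraseTerm A (m + 2) (m + 0) = A m := if_pos (by omega)
  have e3 : eraseTerm A (m + 2) (m + (1 + 0) + 2) = A (m + 4) := by
    rw [eraseTerm, if_neg (by omega)]
  have e4 : eraseTerm A (m + 2) (m + (1 + 0)) = A (m + 1) := by
    rw [eraseTerm, if_pos (by omega)]
  rw [e1, e2, e3, e4]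
  ring_nf

section Defects

variable {V : Type*} [Fintype V] {n : ℕ} {G : SimpleGraph V} {ρ : V ≃ Fin n} {s : V → Bool}
  {x : V → ℝ} {A : ℕ → ℝ}

/-- If the bound `IsSignedRanking.zigzag_add_le_qForm` is attained, then every coefficient belonging
to two positive gaps is as small as the bound allows. -/
theorem qForm_layer_le_of_eq (h : IsSignedRanking x ρ s A) (hG : IsKConnected G 2)
    (hb : ¬ G.IsBipartite) (S : Finset (ℕ × ℕ)) (X : ℕ × ℕ → ℝ)
    (hX : ∀ p ∈ S, p.1 < n → p.2 < n →
      zigzagCoeff p.1 p.2 + X p ≤ qForm G (layer ρ s p.1) (layer ρ s p.2))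
    (heq : qForm G x x = ∑ k ∈ Finset.range n, (A (k + 2) - A k) ^ 2 +
      ∑ p ∈ S, (A (p.1 + 1) - A p.1) * (A (p.2 + 1) - A p.2) * X p)
    {k l : ℕ} (hDk : A k < A (k + 1)) (hDl : A l < A (l + 1)) :
    qForm G (layer ρ s k) (layer ρ s l) ≤
      zigzagCoeff k l + ∑ p ∈ S with p = (k, l), X p := by
  classical
  set Q := qForm G (layer ρ s k) (layer ρ s l) with hQ
  have h1 := h.zigzag_add_le_qForm hG hb (insert (k, l) (S.erase (k, l)))
    (fun p => if p = (k, l) then Q - zigzagCoeff k l else X p) (fun p hp h1 h2 => by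
      split_ifs with hpk
      · subst hpk
        rw [hQ]
        exact (add_sub_cancel _ _).le
      · exact hX p (Finset.mem_of_mem_erase (Finset.mem_of_mem_insert_of_ne hp hpk)) h1 h2)
  rw [Finset.sum_insert (Finset.notMem_erase _ _), if_pos rfl, heq] at h1
  have h2 : ∑ p ∈ S.erase (k, l), (A (p.1 + 1) - A p.1) * (A (p.2 + 1) - A p.2) *
      (if p = (k, l) then Q - zigzagCoeff k l else X p) =
      ∑ p ∈ S.erase (k, l), (A (p.1 + 1) - A p.1) * (A (p.2 + 1) - A p.2) * X p :=
    Finset.sum_congr rfl fun p hp => by rw [if_neg (Finset.ne_of_mem_erase hp)]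
  have hpos : 0 < (A (k + 1) - A k) * (A (l + 1) - A l) :=
    mul_pos (sub_pos.2 hDk) (sub_pos.2 hDl)
  rw [h2] at h1
  rw [Finset.sum_filter, Finset.sum_ite_eq']
  dsimp only at h1
  split_ifs with hkl
  · rw [← Finset.add_sum_erase _ _ hkl] at h1
    dsimp only at h1
    have : (A (k + 1) - A k) * (A (l + 1) - A l) * (Q - zigzagCoeff k l) ≤
      (A (k + 1) - A k) * (A (l + 1) - A l) * X (k, l) := by linarith
    have := le_of_mul_le_mul_left this hpos
    linarith
  · rw [Finset.erase_eq_of_notMem hkl] at h1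
    have : (A (k + 1) - A k) * (A (l + 1) - A l) * (Q - zigzagCoeff k l) ≤
      (A (k + 1) - A k) * (A (l + 1) - A l) * 0 := by linarith
    have := le_of_mul_le_mul_left this hpos
    linarith

theorem le_qForm_layer {k l N : ℕ} (hkl : k ≤ l) (hl : 1 ≤ l)
    (h : N ≤ (gapDarts G ρ s k l).card) : (N : ℝ) ≤ qForm G (layer ρ s k) (layer ρ s l) :=
  le_trans (mod_cast h) (card_gapDarts_le hkl hl)

/-- A split defect at `i` makes the form at least that of the zigzag cycle without the vertex of
rank `i + 1`, with this vertex joined to those of ranks `i` and `i + 2`. -/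
theorem HasSplitDefect.le_qForm (hd : HasSplitDefect G ρ s i) (h : IsSignedRanking x ρ s A)
    (hG : IsKConnected G 2) (hb : ¬ G.IsBipartite) (hi : i + 4 ≤ n) :
    ∑ k ∈ Finset.range (n - 1), (eraseTerm A (i + 2) (k + 2) - eraseTerm A (i + 2) k) ^ 2 +
      (A (i + 2) - A (i + 1)) ^ 2 + (A (i + 2) - A (i + 3)) ^ 2 ≤ qForm G x x := by
  refine le_trans (le_of_eq ?_) (h.zigzag_add_le_qForm hG hb
    {(i + 1, i + 1), (i + 2, i + 2), (i + 1, i + 2), (i + 2, i + 1), (i, i + 2), (i + 2, i),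
      (i + 1, i + 3), (i + 3, i + 1)} (fun _ => 1) ?_)
  · obtain ⟨r, rfl⟩ : ∃ r, n = i + 2 + r + 1 := ⟨n - i - 3, by omega⟩
    have := zigzag_eraseTerm A r i
    simp [Finset.sum_insert]
    linear_combination this
  · have h11 := le_qForm_layer le_rfl (by omega) hd.card₁₁
    have h22 := le_qForm_layer le_rfl (by omega) hd.card₂₂
    have h12 := le_qForm_layer (by omega) (by omega) hd.card₁₂
    have h02 := le_qForm_layer (by omega) (by omega) hd.card₀₂
    have h13 := le_qForm_layer (by omega) (by omega) hd.card₁₃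
    intro p hp _ _
    simp only [Finset.mem_insert, Finset.mem_singleton] at hp
    rcases hp with rfl | rfl | rfl | rfl | rfl | rfl | rfl | rfl
    · norm_num [zigzagCoeff] at h11 ⊢
      linarith
    · norm_num [zigzagCoeff] at h22 ⊢
      linarith
    · norm_num [zigzagCoeff] at h12 ⊢
      linarith
    · rw [qForm_comm]
      norm_num [zigzagCoeff] at h12 ⊢
      linarith
    · norm_num [zigzagCoeff, show i + 2 + 1 ≠ i by omega] at h02 ⊢
      linarith
    · rw [qForm_comm]
      norm_num [zigzagCoeff, show i + 2 + 1 ≠ i by omega] at h02 ⊢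
      linarith
    · norm_num [zigzagCoeff] at h13 ⊢
      linarith
    · rw [qForm_comm]
      norm_num [zigzagCoeff] at h13 ⊢
      linarith

/-- A twin defect at `i` makes the form at least that of the zigzag cycle without the vertex of
rank `i + 2`, with this vertex joined to those of ranks `i` and `i + 1`. -/
theorem HasTwinDefect.le_qForm (hd : HasTwinDefect G ρ s i) (h : IsSignedRanking x ρ s A)
    (hG : IsKConnected G 2) (hb : ¬ G.IsBipartite) (hi : i + 4 ≤ n) :
    ∑ k ∈ Finset.range (n - 1), (eraseTerm A (i + 3) (k + 2) - eraseTerm A (i + 3) k) ^ 2 +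
      (A (i + 3) - A (i + 1)) ^ 2 + (A (i + 3) - A (i + 2)) ^ 2 ≤ qForm G x x := by
  refine le_trans (le_of_eq ?_) (h.zigzag_add_le_qForm hG hb
    {(i + 1, i + 1), (i + 2, i + 2), (i + 1, i + 2), (i + 2, i + 1),
      (i + 1, i + 3), (i + 3, i + 1), (i + 2, i + 3), (i + 3, i + 2), (i + 2, i + 4),
      (i + 4, i + 2)} (fun p => if p = (i + 2, i + 2) then 2 else 1) ?_)
  · obtain ⟨r, rfl⟩ : ∃ r, n = i + 3 + r + 1 := ⟨n - i - 4, by omega⟩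
    have := zigzag_eraseTerm A r (i + 1)
    simp [Finset.sum_insert]
    linear_combination this
  · have h11 := le_qForm_layer le_rfl (by omega) hd.card₁₁
    have h22 := le_qForm_layer le_rfl (by omega) hd.card₂₂
    have h12 := le_qForm_layer (by omega) (by omega) hd.card₁₂
    have h13 := le_qForm_layer (by omega) (by omega) hd.card₁₃
    have h23 := le_qForm_layer (by omega) (by omega) hd.card₂₃
    have h24 := fun hn => le_qForm_layer (by omega) (by omega) (hd.card₂₄ hn)
    intro p hp hp1 hp2
    simp only [Finset.mem_insert, Finset.mem_singleton] at hp
    rcases hp with rfl | rfl | rfl | rfl | rfl | rfl | rfl | rfl | rfl | rfl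
    · norm_num [zigzagCoeff] at h11 ⊢
      linarith
    · norm_num [zigzagCoeff] at h22 ⊢
      linarith
    · norm_num [zigzagCoeff] at h12 ⊢
      linarith
    · rw [qForm_comm]
      norm_num [zigzagCoeff] at h12 ⊢
      linarith
    · norm_num [zigzagCoeff] at h13 ⊢
      linarith
    · rw [qForm_comm]
      norm_num [zigzagCoeff] at h13 ⊢
      linarith
    · norm_num [zigzagCoeff] at h23 ⊢
      linarith
    · rw [qForm_comm]
      norm_num [zigzagCoeff] at h23 ⊢
      linarith
    · have := h24 hp2
      norm_num [zigzagCoeff] at this ⊢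
      linarith
    · have := h24 hp1
      rw [qForm_comm]
      norm_num [zigzagCoeff] at this ⊢
      linarith

end Defects

/-! ### The form of `Θ` in terms of levels -/

/-- The form of a graph is at most the sum over any family of pairs covering its edges. -/
theorem qForm_le_sum_of_cover {V ι : Type*} [Fintype V] {G : SimpleGraph V} (x : V → ℝ)
    (T : Finset ι) (e : ι → V × V)
    (h : ∀ u v, G.Adj u v → ∃ i ∈ T, e i = (u, v) ∨ e i = (v, u)) :
    qForm G x x ≤ ∑ i ∈ T, (x (e i).1 + x (e i).2) ^ 2 := by
  classical
  have h1 := two_mul_qForm G x x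
  have h2 : ∀ u v, (if G.Adj u v then (x u + x v) * (x u + x v) else 0) ≤
      ∑ i ∈ T, ((if e i = (u, v) then (x u + x v) ^ 2 else 0) +
        if e i = (v, u) then (x u + x v) ^ 2 else 0) := by
    intro u v
    have hnn : ∀ i ∈ T, 0 ≤ (if e i = (u, v) then (x u + x v) ^ 2 else 0) +
        if e i = (v, u) then (x u + x v) ^ 2 else 0 := fun i _ => by positivity
    split_ifs with huv
    · obtain ⟨i, hi, hi'⟩ := h u v huv
      refine le_trans ?_ (Finset.single_le_sum hnn hi)
      rcases hi' with hi' | hi'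
      · rw [if_pos hi', ← sq]
        exact le_add_of_nonneg_right (by positivity)
      · rw [if_pos hi', ← sq]
        exact le_add_of_nonneg_left (by positivity)
    · exact Finset.sum_nonneg hnn
  have h3 : ∑ u, ∑ v, ∑ i ∈ T, ((if e i = (u, v) then (x u + x v) ^ 2 else 0) +
        if e i = (v, u) then (x u + x v) ^ 2 else 0) =
      ∑ i ∈ T, 2 * (x (e i).1 + x (e i).2) ^ 2 := by
    simp_rw [Finset.sum_comm (s := Finset.univ) (t := T)]
    refine Finset.sum_congr rfl fun i _ => ?_
    simp only [Finset.sum_add_distrib]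
    have e1 : ∑ u, ∑ v, (if e i = (u, v) then (x u + x v) ^ 2 else 0) =
        (x (e i).1 + x (e i).2) ^ 2 := by
      rw [Finset.sum_eq_single (e i).1, Finset.sum_eq_single (e i).2, if_pos rfl]
      · intro b _ hb
        rw [if_neg fun h => hb (by rw [h])]
      · simp
      · intro b _ hb
        exact Finset.sum_eq_zero fun c _ => if_neg fun h => hb (by rw [h])
      · simp
    have e2 : ∑ u, ∑ v, (if e i = (v, u) then (x u + x v) ^ 2 else 0) =
        (x (e i).1 + x (e i).2) ^ 2 := by
      rw [Finset.sum_comm, ← e1]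
      simp_rw [add_comm]
    rw [e1, e2]
    ring
  have h4 := Finset.sum_le_sum fun u (_ : u ∈ Finset.univ) =>
    Finset.sum_le_sum fun v (_ : v ∈ Finset.univ) => h2 u v
  rw [h3, ← Finset.mul_sum] at h4
  linarith

/-- The vector on `Θ` with value `w` at `v_0` and values `± b i` on the vertices at distance
`p - i` from `v_1` along the cycle, with alternating signs. -/
noncomputable def thetaVector (p : ℕ) (b : ℕ → ℝ) (w : ℝ) (a : ℕ) : ℝ :=
  if a = 0 then w else if a ≤ p + 1 then (-1) ^ (a - 1) * b (p + 1 - a)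
  else (-1) ^ a * b (a - p - 2)

theorem thetaVector_zero (p : ℕ) (b : ℕ → ℝ) (w : ℝ) : thetaVector p b w 0 = w := if_pos rfl

theorem thetaVector_left {p i k : ℕ} (b : ℕ → ℝ) (w : ℝ) (h : i + k = p) :
    thetaVector p b w (k + 1) = (-1) ^ k * b i := by
  rw [thetaVector, if_neg (by omega), if_pos (by omega)]
  congr 2
  omega

theorem thetaVector_right (p i : ℕ) (b : ℕ → ℝ) (w : ℝ) :
    thetaVector p b w (p + 2 + i) = (-1) ^ (p + i) * b i := by
  rw [thetaVector, if_neg (by omega), if_neg (by omega), show p + 2 + i = p + i + 2 by ring,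
    pow_add, neg_one_sq, mul_one]
  congr 2
  omega

theorem neg_one_pow_mul_sq (k : ℕ) (y : ℝ) : ((-1) ^ k * y) ^ 2 = y ^ 2 := by
  rw [mul_pow, ← pow_mul, mul_comm k, pow_mul, neg_one_sq, one_pow, one_mul]

theorem sum_thetaVector_sq (p : ℕ) (b : ℕ → ℝ) (w : ℝ) :
    ∑ a ∈ Finset.range (2 * p + 2), thetaVector p b w a ^ 2 =
      2 * ∑ i ∈ Finset.range p, b i ^ 2 + b p ^ 2 + w ^ 2 := by
  rw [show 2 * p + 2 = 1 + (p + 1) + p by ring, Finset.sum_range_add, Finset.sum_range_add,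
    Finset.sum_range_one, thetaVector_zero]
  have h1 : ∑ k ∈ Finset.range (p + 1), thetaVector p b w (1 + k) ^ 2 =
      ∑ i ∈ Finset.range (p + 1), b i ^ 2 := by
    rw [← Finset.sum_range_reflect]
    refine Finset.sum_congr rfl fun k hk => ?_
    have := Finset.mem_range.1 hk
    rw [add_comm 1, thetaVector_left (i := k) b w (by omega), neg_one_pow_mul_sq]
  have h2 : ∑ k ∈ Finset.range p, thetaVector p b w (1 + (p + 1) + k) ^ 2 =
      ∑ i ∈ Finset.range p, b i ^ 2 :=
    Finset.sum_congr rfl fun k _ => by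
      rw [show 1 + (p + 1) + k = p + 2 + k by ring, thetaVector_right, neg_one_pow_mul_sq]
  rw [h1, h2, Finset.sum_range_succ]
  ring

/-- Rayleigh's principle for `Θ` and a vector that takes values of equal modulus on the two sides:
the edge at the bottom contributes `4 * b 0 ^ 2`, and the last term comes from the vertex `v_0`
joined to the two vertices just below the top. -/
theorem theta_rayleigh {p : ℕ} (hp : 1 ≤ p) (b : ℕ → ℝ) (w : ℝ) :
    leastQEigenvalue (thetaGraph (2 * p + 2)) *
        (2 * ∑ i ∈ Finset.range p, b i ^ 2 + b p ^ 2 + w ^ 2) ≤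
      4 * b 0 ^ 2 + 2 * ∑ i ∈ Finset.range p, (b (i + 1) - b i) ^ 2 + 2 * (w - b (p - 1)) ^ 2 := by
  have h1 := leastQEigenvalue_mul_le (thetaGraph (2 * p + 2)) (fun a => thetaVector p b w a)
  rw [Fin.sum_univ_eq_sum_range (fun a => thetaVector p b w a ^ 2), sum_thetaVector_sq] at h1
  refine h1.trans ?_
  let v : ℕ → Fin (2 * p + 2) := Fin.ofNat _
  have hv : ∀ k, k < 2 * p + 2 → (v k : ℕ) = k := fun k hk => Nat.mod_eq_of_lt hk
  have hv' : ∀ a : Fin (2 * p + 2), v a = a := fun a => Fin.ext (hv a a.2)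
  have h2 := qForm_le_sum_of_cover (G := thetaGraph (2 * p + 2)) (fun a => thetaVector p b w a)
    ((Finset.range p).disjSum ((Finset.range p).disjSum (Finset.univ : Finset (Fin 3))))
    (Sum.elim (fun i => (v (p - i), v (p + 1 - i)))
      (Sum.elim (fun i => (v (p + 2 + i), if i + 1 = p then v 1 else v (p + 3 + i)))
        ![(v 0, v 2), (v 0, v (2 * p + 1)), (v (p + 1), v (p + 2))])) ?_
  · refine h2.trans (le_of_eq ?_)
    have e0 : thetaVector p b w (2 * p + 1) = -b (p - 1) := by
      rw [show 2 * p + 1 = p + 2 + (p - 1) by omega, thetaVector_right,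
        show p + (p - 1) = 2 * (p - 1) + 1 by omega, pow_succ, pow_mul, neg_one_sq, one_pow]
      ring
    have e0' : thetaVector p b w 1 = b p := by
      simpa using thetaVector_left (i := p) (k := 0) b w rfl
    have e0'' : thetaVector p b w 2 = -b (p - 1) := by
      simpa using thetaVector_left (i := p - 1) (k := 1) b w (by omega)
    simp only [Finset.sum_disjSum, Sum.elim_inl, Sum.elim_inr, Fin.sum_univ_three]
    have e1 : ∀ i ∈ Finset.range p, (thetaVector p b w (v (p - i)) +
        thetaVector p b w (v (p + 1 - i))) ^ 2 = (b (i + 1) - b i) ^ 2 := fun i hi => by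
      have hi := Finset.mem_range.1 hi
      obtain ⟨k, hk⟩ : ∃ k, p = i + 1 + k := ⟨p - 1 - i, by omega⟩
      rw [hv _ (by omega), hv _ (by omega), show p - i = k + 1 by omega,
        show p + 1 - i = k + 1 + 1 by omega, thetaVector_left (i := i + 1) b w (by omega),
        thetaVector_left (i := i) b w (by omega), pow_succ,
        ← neg_one_pow_mul_sq k (b (i + 1) - b i)]
      ring
    have e2 : ∀ i ∈ Finset.range p, (thetaVector p b w (v (p + 2 + i)) +
        thetaVector p b w (if i + 1 = p then v 1 else v (p + 3 + i) : Fin _)) ^ 2 =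
          (b (i + 1) - b i) ^ 2 := fun i hi => by
      have hi := Finset.mem_range.1 hi
      rw [hv _ (by omega)]
      split_ifs with h
      · rw [hv _ (by omega), show p + 2 + i = 2 * p + 1 by omega, e0,
          e0', ← h]
        simp only [Nat.add_sub_cancel]
        ring
      · rw [hv _ (by omega), thetaVector_right, show p + 3 + i = p + 2 + (i + 1) by ring,
          thetaVector_right, show p + (i + 1) = p + i + 1 by ring, pow_succ,
          ← neg_one_pow_mul_sq (p + i) (b (i + 1) - b i)]
        ring
    rw [Finset.sum_congr rfl e1, Finset.sum_congr rfl e2]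
    simp only [Matrix.cons_val_zero, Matrix.cons_val_one, Matrix.cons_val]
    rw [hv 0 (by omega), hv 2 (by omega), hv (2 * p + 1) (by omega), hv (p + 1) (by omega),
      hv (p + 2) (by omega), e0, thetaVector_zero,
      e0'',
      thetaVector_left (i := 0) (k := p) b w (by omega), thetaVector_right p 0, add_zero]
    have := neg_one_pow_mul_sq p (b 0)
    linear_combination 4 * this
  · have key : ∀ a c : Fin (2 * p + 2), ((1 ≤ (a : ℕ) ∧ (c : ℕ) = a + 1) ∨
        ((a : ℕ) = 1 ∧ (c : ℕ) + 1 = 2 * p + 2) ∨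
        ((a : ℕ) = 0 ∧ ((c : ℕ) = 2 ∨ (c : ℕ) + 1 = 2 * p + 2))) →
        ∃ i ∈ (Finset.range p).disjSum ((Finset.range p).disjSum (Finset.univ : Finset (Fin 3))),
        Sum.elim (fun i => (v (p - i), v (p + 1 - i)))
          (Sum.elim (fun i => (v (p + 2 + i), if i + 1 = p then v 1 else v (p + 3 + i)))
          ![(v 0, v 2), (v 0, v (2 * p + 1)), (v (p + 1), v (p + 2))]) i = (a, c) ∨
        Sum.elim (fun i => (v (p - i), v (p + 1 - i)))
          (Sum.elim (fun i => (v (p + 2 + i), if i + 1 = p then v 1 else v (p + 3 + i)))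
          ![(v 0, v 2), (v 0, v (2 * p + 1)), (v (p + 1), v (p + 2))]) i = (c, a) := by
      intro a c h
      have ha := a.2
      have hc := c.2
      rcases h with ⟨h1, h2⟩ | ⟨h1, h2⟩ | ⟨h1, h2 | h2⟩
      · rcases lt_trichotomy (a : ℕ) (p + 1) with h3 | h3 | h3
        · refine ⟨Sum.inl (p - a), Finset.inl_mem_disjSum.2 (Finset.mem_range.2 (by omega)),
            Or.inl ?_⟩
          rw [Sum.elim_inl, show p - (p - (a : ℕ)) = a by omega,
            show p + 1 - (p - (a : ℕ)) = c by omega, hv', hv']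
        · refine ⟨Sum.inr (Sum.inr 2), by simp, Or.inl ?_⟩
          rw [Sum.elim_inr, Sum.elim_inr, ← hv' a, ← hv' c, h2, h3]
          rfl
        · refine ⟨Sum.inr (Sum.inl (a - p - 2)), by simp; omega, Or.inl ?_⟩
          rw [Sum.elim_inr, Sum.elim_inl, if_neg (by omega),
            show p + 2 + ((a : ℕ) - p - 2) = a by omega,
            show p + 3 + ((a : ℕ) - p - 2) = c by omega, hv', hv']
      · refine ⟨Sum.inr (Sum.inl (p - 1)), by simp; omega, Or.inr ?_⟩
        rw [Sum.elim_inr, Sum.elim_inl, if_pos (by omega), show p + 2 + (p - 1) = c by omega, ← h1,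
          hv', hv']
      · refine ⟨Sum.inr (Sum.inr 0), by simp, Or.inl ?_⟩
        rw [Sum.elim_inr, Sum.elim_inr, ← hv' a, ← hv' c, h1, h2]
        rfl
      · refine ⟨Sum.inr (Sum.inr 1), by simp, Or.inl ?_⟩
        rw [Sum.elim_inr, Sum.elim_inr, ← hv' a, ← hv' c, h1, show (c : ℕ) = 2 * p + 1 by omega]
        rfl
    intro a c h
    rw [thetaGraph, SimpleGraph.fromRel_adj] at h
    rcases h.2 with h | h
    · exact key a c h
    · obtain ⟨i, hi, hi'⟩ := key c a h
      exact ⟨i, hi, hi'.symm⟩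

/-! ### Comparison with the cycle of odd length -/

theorem sin_add_sin_step (α y : ℝ) :
    Real.sin (y + 2 * α) + Real.sin (y - 2 * α) = 2 * Real.cos (2 * α) * Real.sin y := by
  rw [Real.sin_add, Real.sin_sub]
  ring

theorem cos_add_cos_step (α y : ℝ) :
    Real.cos (y + 2 * α) + Real.cos (y - 2 * α) = 2 * Real.cos (2 * α) * Real.cos y := by
  rw [Real.cos_add, Real.cos_sub]
  ring

/-- Summation by parts for the sine wave, an eigenvector of the path. -/
theorem sum_sin_energy (α : ℝ) (k : ℕ) :
    4 * Real.sin α ^ 2 + 2 * ∑ i ∈ Finset.range k,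
        (Real.sin ((2 * i + 1) * α + 2 * α) - Real.sin ((2 * i + 1) * α)) ^ 2 =
      (2 - 2 * Real.cos (2 * α)) * (2 * ∑ i ∈ Finset.range k, Real.sin ((2 * i + 1) * α) ^ 2) +
        2 * Real.sin ((2 * k + 1) * α) *
          (Real.sin ((2 * k + 1) * α) - Real.sin ((2 * k + 1) * α - 2 * α)) := by
  induction k with
  | zero =>
    have : (2 * ((0 : ℕ) : ℝ) + 1) * α - 2 * α = -α := by
      push_cast
      ring
    rw [this, Real.sin_neg]
    simp
    ring
  | succ k ih =>
    rw [Finset.sum_range_succ, Finset.sum_range_succ]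
    have e1 : (2 * ((k + 1 : ℕ) : ℝ) + 1) * α = (2 * k + 1) * α + 2 * α := by
      push_cast
      ring
    rw [e1, add_sub_cancel_right]
    have := sin_add_sin_step α ((2 * k + 1) * α)
    linear_combination ih - 2 * Real.sin ((2 * k + 1) * α) * this

theorem cos_pi_div_bounds {p : ℕ} (hp : 1 ≤ p) :
    1 / 2 ≤ Real.cos (Real.pi / (2 * p + 1)) ∧ Real.cos (Real.pi / (2 * p + 1)) < 1 := by
  have hp' : (1 : ℝ) ≤ p := mod_cast hp
  have hpi := Real.pi_pos
  have h1 : Real.pi / (2 * p + 1) ≤ Real.pi / 3 := by gcongr; linarith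
  have h0 : 0 < Real.pi / (2 * p + 1) := by positivity
  constructor
  · rw [← Real.cos_pi_div_three]
    exact Real.cos_le_cos_of_nonneg_of_le_pi h0.le (by linarith) h1
  · have := Real.cos_lt_cos_of_nonneg_of_le_pi le_rfl (by linarith) h0
    rwa [Real.cos_zero] at this

/-- `q(Θ)` is less than `2 - 2 cos (π / (2p + 1))`, the least eigenvalue of the odd cycle. -/
theorem leastQEigenvalue_thetaGraph_lt {p : ℕ} (hp : 1 ≤ p) :
    leastQEigenvalue (thetaGraph (2 * p + 2)) < 2 - 2 * Real.cos (Real.pi / (2 * p + 1)) := by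
  obtain ⟨hc1, hc2⟩ := cos_pi_div_bounds hp
  obtain ⟨α, hα⟩ : ∃ α : ℝ, α = Real.pi / (2 * (2 * p + 1)) := ⟨_, rfl⟩
  have hαc : Real.pi / (2 * p + 1) = 2 * α := by
    rw [hα]
    field_simp
  have hαp : (2 * (p : ℝ) + 1) * α = Real.pi / 2 := by
    rw [hα]
    field_simp
  rw [hαc] at hc1 hc2 ⊢
  -- the eigenvector of the odd cycle, with the additional vertex copying its top
  have h1 := theta_rayleigh hp (fun i => Real.sin ((2 * i + 1) * α)) 1
  have h2 := sum_sin_energy α p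
  have e1 : ∀ i : ℕ, (2 * ((i + 1 : ℕ) : ℝ) + 1) * α = (2 * i + 1) * α + 2 * α := fun i => by
    push_cast
    ring
  have e2 : (2 * ((p - 1 : ℕ) : ℝ) + 1) * α = Real.pi / 2 - 2 * α := by
    rw [Nat.cast_sub hp, ← hαp]
    push_cast
    ring
  simp only [e1, e2, hαp, Real.sin_pi_div_two, Real.sin_pi_div_two_sub, Nat.cast_zero, mul_zero,
    zero_add, one_mul] at h1 h2
  rw [h2] at h1
  have hs : 0 ≤ ∑ i ∈ Finset.range p, Real.sin ((2 * (i : ℝ) + 1) * α) ^ 2 :=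
    Finset.sum_nonneg fun _ _ => sq_nonneg _
  set σ := ∑ i ∈ Finset.range p, Real.sin ((2 * (i : ℝ) + 1) * α) ^ 2
  set c := Real.cos (2 * α)
  by_contra! hcon
  have h3 : (2 - 2 * c) * (2 * σ + 1 ^ 2 + 1 ^ 2) ≤
    leastQEigenvalue (thetaGraph (2 * p + 2)) * (2 * σ + 1 ^ 2 + 1 ^ 2) := by gcongr
  nlinarith

/-- A sequence vanishing at `p` has energy at least that of the cosine wave vanishing at `p`. The
difference of the partial sums, multiplied by the wave, exceeds a multiple of `h k ^ 2` by a sum of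
squares. -/
theorem sum_sq_le_of_eq_zero {p : ℕ} (hp : 1 ≤ p) (h : ℕ → ℝ) (hh : h p = 0) :
    (2 - 2 * Real.cos (Real.pi / (2 * p + 1))) * ∑ i ∈ Finset.range p, h i ^ 2 ≤
      ∑ i ∈ Finset.range p, (h (i + 1) - h i) ^ 2 := by
  have hpi := Real.pi_pos
  obtain ⟨α, hα⟩ : ∃ α : ℝ, α = Real.pi / (2 * (2 * p + 1)) := ⟨_, rfl⟩
  have hαc : Real.pi / (2 * p + 1) = 2 * α := by
    rw [hα]
    field_simp
  have hαp : (2 * (p : ℝ) + 1) * α = Real.pi / 2 := by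
    rw [hα]
    field_simp
  have hα0 : 0 < α := by
    rw [hα]
    positivity
  rw [hαc]
  have e1 : ∀ i : ℕ, (2 * ((i + 1 : ℕ) : ℝ) + 1) * α = (2 * i + 1) * α + 2 * α := fun i => by
    push_cast
    ring
  have hpos : ∀ k : ℕ, k < p → 0 < Real.cos ((2 * k + 1) * α) := fun k hk => by
    refine Real.cos_pos_of_mem_Ioo ⟨?_, ?_⟩
    · have : 0 ≤ (2 * (k : ℝ) + 1) * α := by positivity
      linarith
    · rw [← hαp]
      gcongr
  set R : ℕ → ℝ := fun k => ∑ i ∈ Finset.range k, (h (i + 1) - h i) ^ 2 -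
    (2 - 2 * Real.cos (2 * α)) * ∑ i ∈ Finset.range k, h i ^ 2 with hR
  have hR1 : ∀ k, R (k + 1) = R k + (h (k + 1) - h k) ^ 2 -
      (2 - 2 * Real.cos (2 * α)) * h k ^ 2 := fun k => by
    simp only [hR, Finset.sum_range_succ]
    ring
  have key : ∀ k : ℕ, k < p → 0 ≤ R k * Real.cos ((2 * k + 1) * α) +
      (Real.cos ((2 * k + 1) * α - 2 * α) - Real.cos ((2 * k + 1) * α)) * h k ^ 2 := by
    intro k
    induction k with
    | zero =>
      intro _
      have : (2 * ((0 : ℕ) : ℝ) + 1) * α - 2 * α = -α := by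
        push_cast
        ring
      rw [this, Real.cos_neg]
      simp [hR]
    | succ k ih =>
      intro hk
      have ih := ih (by omega)
      have h1 := hpos k (by omega)
      have h2 := hpos (k + 1) hk
      have h3 := cos_add_cos_step α ((2 * k + 1) * α)
      rw [e1] at h2 ⊢
      rw [add_sub_cancel_right, hR1]
      refine nonneg_of_mul_nonneg_right ?_ h1
      have h4 := mul_nonneg ih h2.le
      have h5 := sq_nonneg (Real.cos ((2 * k + 1) * α) * h (k + 1) -
        Real.cos ((2 * k + 1) * α + 2 * α) * h k)
      have h6 : Real.cos ((2 * k + 1) * α - 2 * α) = 2 * Real.cos (2 * α) *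
        Real.cos ((2 * k + 1) * α) - Real.cos ((2 * k + 1) * α + 2 * α) := by linarith
      rw [h6] at h4
      refine le_trans (add_nonneg h4 h5) (le_of_eq ?_)
      ring
  obtain ⟨r, rfl⟩ : ∃ r, p = r + 1 := ⟨p - 1, by omega⟩
  have h1 := key r (by omega)
  have h2 := hpos r (by omega)
  have h3 := cos_add_cos_step α ((2 * r + 1) * α)
  rw [← e1, hαp, Real.cos_pi_div_two, zero_add] at h3
  rw [h3] at h1
  have h4 : 0 ≤ R (r + 1) * Real.cos ((2 * r + 1) * α) := by
    rw [hR1, hh]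
    refine le_trans h1 (le_of_eq ?_)
    ring
  have h5 := nonneg_of_mul_nonneg_left h4 h2
  simp only [hR] at h5
  linarith

/-! ### The least energy of levels with one vertex attached to a level -/

theorem leastQEigenvalue_thetaGraph_lt_one {p : ℕ} (hp : 1 ≤ p) :
    leastQEigenvalue (thetaGraph (2 * p + 2)) < 1 := by
  have h1 := leastQEigenvalue_thetaGraph_lt hp
  have h2 := (cos_pi_div_bounds hp).1
  linarith

theorem eq_of_quadratic_nonneg {B C : ℝ} (h : ∀ ε : ℝ, 0 ≤ ε * B + ε ^ 2 * C) : B = 0 := by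
  by_contra hB
  have hB2 : 0 < B ^ 2 := by positivity
  have hC : 0 < |C| + 1 := by positivity
  have h1 := h (-(B / (|C| + 1)))
  have h2 : -(B / (|C| + 1)) * B + (-(B / (|C| + 1))) ^ 2 * C =
      B ^ 2 / (|C| + 1) ^ 2 * (C - (|C| + 1)) := by
    field_simp
    ring
  rw [h2] at h1
  have h3 : C - (|C| + 1) < 0 := by
    have := le_abs_self C
    linarith
  have h4 : 0 < B ^ 2 / (|C| + 1) ^ 2 := by positivity
  nlinarith

/-- At a minimizer of the form of `Θ` the lowest level is not `0` and consecutive levels below the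
top do not agree: otherwise, raising all levels from `k` on by the same small amount costs energy of
second order only, whereas the norm grows to first order. -/
theorem theta_levels_strict {p : ℕ} (hp : 1 ≤ p) {b : ℕ → ℝ} {w : ℝ}
    (hθ0 : 0 < leastQEigenvalue (thetaGraph (2 * p + 2)))
    (hb : ∀ i, i ≤ p → 0 ≤ b i) (hw : 0 < w)
    (heq : 4 * b 0 ^ 2 + 2 * ∑ i ∈ Finset.range p, (b (i + 1) - b i) ^ 2 +
        2 * (w - b (p - 1)) ^ 2 = leastQEigenvalue (thetaGraph (2 * p + 2)) *
        (2 * ∑ i ∈ Finset.range p, b i ^ 2 + b p ^ 2 + w ^ 2)) {k : ℕ} (hk : k < p)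
    (hgap : ∀ i, i + 1 = k → b (i + 1) = b i) (hgap0 : k = 0 → b 0 = 0) : False := by
  set θ := leastQEigenvalue (thetaGraph (2 * p + 2)) with hθ
  -- small enough that the first-order gain `2 * θ * w * σ` exceeds the cost `4 * σ ^ 2`
  set σ := θ * w / 4 with hσ
  have hσ0 : 0 < σ := by positivity
  have h1 := theta_rayleigh hp (fun i => if k ≤ i then b i + σ else b i) (w + σ)
  rw [← hθ] at h1
  rw [if_pos (show k ≤ p by omega), if_pos (show k ≤ p - 1 by omega)] at h1
  have h2 : ∑ i ∈ Finset.range p, b i ^ 2 ≤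
      ∑ i ∈ Finset.range p, (if k ≤ i then b i + σ else b i) ^ 2 := by
    refine Finset.sum_le_sum fun i hi => ?_
    have := hb i (Finset.mem_range.1 hi).le
    split_ifs
    · gcongr
      linarith
    · rfl
  have h3 : 4 * (if k ≤ 0 then b 0 + σ else b 0) ^ 2 + 2 * ∑ i ∈ Finset.range p,
      ((if k ≤ i + 1 then b (i + 1) + σ else b (i + 1)) - if k ≤ i then b i + σ else b i) ^ 2 ≤
      4 * b 0 ^ 2 + 2 * ∑ i ∈ Finset.range p, (b (i + 1) - b i) ^ 2 + 4 * σ ^ 2 := by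
    rcases Nat.eq_zero_or_pos k with rfl | hk0
    · simp [hgap0 rfl]
      linarith
    · have h4 : ∑ i ∈ Finset.range p,
          ((if k ≤ i + 1 then b (i + 1) + σ else b (i + 1)) -
            if k ≤ i then b i + σ else b i) ^ 2 ≤
          ∑ i ∈ Finset.range p, ((b (i + 1) - b i) ^ 2 + if i = k - 1 then σ ^ 2 else 0) := by
        refine Finset.sum_le_sum fun i _ => ?_
        rcases lt_trichotomy i (k - 1) with h | h | h
        · rw [if_neg (by omega), if_neg (by omega), if_neg (by omega), add_zero]
        · rw [if_pos (by omega), if_neg (by omega), if_pos h, hgap i (by omega)]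
          simp
        · rw [if_pos (by omega), if_pos (by omega), if_neg (by omega)]
          simp
      rw [Finset.sum_add_distrib, Finset.sum_ite_eq', if_pos (Finset.mem_range.2 (by omega))] at h4
      rw [if_neg (by omega)]
      nlinarith [sq_nonneg σ]
  have h5 := hb p le_rfl
  have h6 : θ * (2 * ∑ i ∈ Finset.range p, b i ^ 2 + b p ^ 2 + (w ^ 2 + 2 * w * σ)) ≤
      θ * (2 * ∑ i ∈ Finset.range p, (if k ≤ i then b i + σ else b i) ^ 2 + (b p + σ) ^ 2 +
        (w + σ) ^ 2) := by
    refine mul_le_mul_of_nonneg_left ?_ hθ0.le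
    nlinarith [mul_nonneg h5 hσ0.le, sq_nonneg σ]
  have h7 : θ * (2 * w * σ) = 8 * σ ^ 2 := by
    rw [hσ]
    ring
  have h8 : (w + σ - (b (p - 1) + σ)) ^ 2 = (w - b (p - 1)) ^ 2 := by ring
  rw [h8] at h1
  nlinarith [sq_nonneg σ]

/-- `theta_rayleigh` with the top level alone moved by `ε`. -/
theorem theta_rayleigh_top {p : ℕ} (hp : 1 ≤ p) (b : ℕ → ℝ) (w ε : ℝ) :
    leastQEigenvalue (thetaGraph (2 * p + 2)) *
        (2 * ∑ i ∈ Finset.range p, b i ^ 2 + (b p + ε) ^ 2 + w ^ 2) ≤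
      4 * b 0 ^ 2 + 2 * ∑ i ∈ Finset.range p, (b (i + 1) - b i) ^ 2 +
        2 * ((b p + ε - b (p - 1)) ^ 2 - (b p - b (p - 1)) ^ 2) + 2 * (w - b (p - 1)) ^ 2 := by
  refine le_trans (le_of_eq ?_) ((theta_rayleigh hp (fun i => if i = p then b i + ε else b i)
    w).trans (le_of_eq ?_))
  · rw [if_pos rfl, Finset.sum_congr rfl fun i hi => ?_]
    have := Finset.mem_range.1 hi
    rw [if_neg (by omega)]
  · rw [if_neg (show (0 : ℕ) ≠ p by omega), if_neg (show p - 1 ≠ p by omega)]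
    obtain ⟨r, rfl⟩ : ∃ r, p = r + 1 := ⟨p - 1, by omega⟩
    rw [Finset.sum_range_succ, Finset.sum_range_succ, if_pos rfl,
      if_neg (show r ≠ r + 1 by omega), Finset.sum_congr rfl fun i hi => ?_]
    · rw [Nat.add_sub_cancel]
      ring
    · have := Finset.mem_range.1 hi
      rw [if_neg (by omega), if_neg (by omega)]

/-- Consider an odd cycle whose levels `i < p` carry the two values `b i ± h i`, and the level `p`
the value `b p`, together with a vertex of value `w` joined to the level `j`. Its energy is at least
`q(Θ)` times its norm, and equality forces `h = 0`, attachment just below the top, and strictly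
increasing levels. The part in `h` separates and is controlled by the larger eigenvalue of the odd
cycle. -/
theorem levels_of_energy_le {p : ℕ} (hp : 1 ≤ p) {b h : ℕ → ℝ} {w : ℝ} {j : ℕ} (hj : j < p)
    (hb0 : 0 ≤ b 0) (hbm : ∀ i, i < p → b i ≤ b (i + 1)) (hh : h p = 0)
    (hθ0 : 0 < leastQEigenvalue (thetaGraph (2 * p + 2)))
    (hM : 0 < 2 * ∑ i ∈ Finset.range p, b i ^ 2 + b p ^ 2 + w ^ 2 +
      2 * ∑ i ∈ Finset.range p, h i ^ 2)
    (hF : 4 * b 0 ^ 2 + 2 * ∑ i ∈ Finset.range p, (b (i + 1) - b i) ^ 2 +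
      2 * ∑ i ∈ Finset.range p, (h (i + 1) - h i) ^ 2 + 2 * (w - b j) ^ 2 + 2 * h j ^ 2 ≤
      leastQEigenvalue (thetaGraph (2 * p + 2)) * (2 * ∑ i ∈ Finset.range p, b i ^ 2 + b p ^ 2 +
        w ^ 2 + 2 * ∑ i ∈ Finset.range p, h i ^ 2)) :
    (∀ i, i < p → h i = 0) ∧ j = p - 1 ∧ 0 < b 0 ∧ (∀ i, i < p → b i < b (i + 1)) ∧ b p = w ∧
      leastQEigenvalue (thetaGraph (2 * p + 2)) * (2 * ∑ i ∈ Finset.range p, b i ^ 2 + b p ^ 2 +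
        w ^ 2 + 2 * ∑ i ∈ Finset.range p, h i ^ 2) ≤
      4 * b 0 ^ 2 + 2 * ∑ i ∈ Finset.range p, (b (i + 1) - b i) ^ 2 +
        2 * ∑ i ∈ Finset.range p, (h (i + 1) - h i) ^ 2 + 2 * (w - b j) ^ 2 + 2 * h j ^ 2 := by
  have hθ1 := leastQEigenvalue_thetaGraph_lt_one hp
  have hθl := leastQEigenvalue_thetaGraph_lt hp
  have hR := fun b w => theta_rayleigh hp b w
  have hN := sum_sq_le_of_eq_zero hp h hh
  set θ := leastQEigenvalue (thetaGraph (2 * p + 2)) with hθ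
  set μ := 2 - 2 * Real.cos (Real.pi / (2 * p + 1))
  have hmono : ∀ i k, i ≤ k → k ≤ p → b i ≤ b k := by
    intro i k hik hk
    induction k, hik using Nat.le_induction with
    | base => rfl
    | succ k hik ih => exact (ih (by omega)).trans (hbm k (by omega))
  have hbn : ∀ i, i ≤ p → 0 ≤ b i := fun i hi => hb0.trans (hmono 0 i (Nat.zero_le _) hi)
  have hH : 0 ≤ ∑ i ∈ Finset.range p, h i ^ 2 := Finset.sum_nonneg fun _ _ => sq_nonneg _
  have hHlt : (μ - θ) * ∑ i ∈ Finset.range p, h i ^ 2 ≤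
      ∑ i ∈ Finset.range p, (h (i + 1) - h i) ^ 2 - θ * ∑ i ∈ Finset.range p, h i ^ 2 := by
    linarith
  have hH' : 0 ≤ (μ - θ) * ∑ i ∈ Finset.range p, h i ^ 2 := mul_nonneg (by linarith) hH
  have hhj := sq_nonneg (h j)
  set S := 4 * b 0 ^ 2 + 2 * ∑ i ∈ Finset.range p, (b (i + 1) - b i) ^ 2 -
    θ * (2 * ∑ i ∈ Finset.range p, b i ^ 2 + b p ^ 2) with hS
  have hRS : ∀ w', 0 ≤ S + 2 * (w' - b (p - 1)) ^ 2 - θ * w' ^ 2 := fun w' => by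
    have := hR b w'
    rw [hS]
    linarith
  have hSB : S + (2 * (w - b j) ^ 2 - θ * w ^ 2) +
      2 * ((μ - θ) * ∑ i ∈ Finset.range p, h i ^ 2) ≤ 0 := by
    rw [hS]
    linarith
  have hbj := hbn j hj.le
  have hjp := hmono j (p - 1) (by omega) (by omega)
  -- the attached vertex lowers the energy, since otherwise everything vanishes
  have hB : 2 * (w - b j) ^ 2 - θ * w ^ 2 < 0 := by
    by_contra! hB
    have h1 := hRS (b (p - 1))
    have h2 : θ * b (p - 1) ^ 2 ≤ 0 := by
      rw [sub_self] at h1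
      linarith
    have h3 : b (p - 1) = 0 := by
      by_contra h3
      have : 0 < b (p - 1) ^ 2 := by positivity
      nlinarith
    have h4 : ∀ i, i < p → b i = 0 := fun i hi =>
      le_antisymm (h3 ▸ hmono i (p - 1) (by omega) (by omega)) (hbn i hi.le)
    have h5 : ∑ i ∈ Finset.range p, b i ^ 2 = 0 :=
      Finset.sum_eq_zero fun i hi => by rw [h4 i (Finset.mem_range.1 hi)]; simp
    have h6 : ∑ i ∈ Finset.range p, (b (i + 1) - b i) ^ 2 = b p ^ 2 := by
      obtain ⟨r, rfl⟩ : ∃ r, p = r + 1 := ⟨p - 1, by omega⟩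
      rw [Finset.sum_range_succ, Finset.sum_eq_zero, h4 r (by omega)]
      · ring
      · intro i hi
        have := Finset.mem_range.1 hi
        rw [h4 i (by omega), h4 (i + 1) (by omega)]
        ring
    rw [h5, h6, h4 0 (by omega)] at hS
    have h7 : S = (2 - θ) * b p ^ 2 := by
      rw [hS]
      ring
    rw [h4 j hj] at hSB
    have h8 : (2 - θ) * w ^ 2 + (2 - θ) * b p ^ 2 ≤ 0 := by nlinarith
    have h9 := sq_nonneg w
    have h10 := sq_nonneg (b p)
    have h11 : w ^ 2 + b p ^ 2 ≤ 0 := by nlinarith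
    have h12 : (μ - θ) * ∑ i ∈ Finset.range p, h i ^ 2 ≤ 0 := by nlinarith
    have h13 : ∑ i ∈ Finset.range p, h i ^ 2 ≤ 0 := by nlinarith
    rw [h5] at hM
    linarith
  have hbj0 : 0 < b j := by
    refine lt_of_le_of_ne hbj fun h0 => ?_
    rw [← h0] at hB
    nlinarith [sq_nonneg w]
  have hw0 : w ≠ 0 := by
    rintro rfl
    nlinarith [sq_nonneg (b j)]
  -- scaling the attached vertex together with its level compares with the attachment at the top
  have hscale := hRS (w * (b (p - 1) / b j))
  have hr : 1 ≤ b (p - 1) / b j := (one_le_div hbj0).2 hjp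
  have hrb : b (p - 1) = b (p - 1) / b j * b j := by field_simp
  set r := b (p - 1) / b j
  obtain ⟨B, hBdef⟩ : ∃ B, B = 2 * (w - b j) ^ 2 - θ * w ^ 2 := ⟨_, rfl⟩
  rw [← hBdef] at hB hSB
  have hscale' : 0 ≤ S + r ^ 2 * B := by
    rw [hrb] at hscale
    rw [hBdef]
    linarith
  have hr1 : r = 1 := by
    by_contra hne
    have h1 : 1 < r ^ 2 := one_lt_pow₀ (lt_of_le_of_ne hr (Ne.symm hne)) two_ne_zero
    have h2 := mul_neg_of_pos_of_neg (sub_pos.2 h1) hB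
    linarith
  rw [hr1, one_pow, one_mul] at hscale'
  rw [hr1, one_mul] at hrb
  have hH0 : ∑ i ∈ Finset.range p, h i ^ 2 = 0 := by
    refine le_antisymm ?_ hH
    by_contra! hpos
    have := mul_pos (show 0 < μ - θ by linarith) hpos
    linarith
  have hmin : S + 2 * (w - b (p - 1)) ^ 2 - θ * w ^ 2 = 0 := by
    rw [hrb]
    linarith
  -- the eigenvalue equations at the attached vertex and at the top
  have hwb : (2 - θ) * w = 2 * b (p - 1) := by
    have := eq_of_quadratic_nonneg (B := 4 * (w - b (p - 1)) - 2 * θ * w) (C := 2 - θ) fun ε => by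
      have := hRS (w + ε)
      linarith
    linarith
  have hpb : (2 - θ) * b p = 2 * b (p - 1) := by
    have := eq_of_quadratic_nonneg (B := 4 * (b p - b (p - 1)) - 2 * θ * b p) (C := 2 - θ)
      fun ε => by
        have h1 := theta_rayleigh_top hp b w ε
        rw [← hθ] at h1
        linarith
    linarith
  have hbtop : 0 < b (p - 1) := hrb ▸ hbj0
  have hw_pos : 0 < w := by
    by_contra! hcon
    have := mul_nonpos_of_nonneg_of_nonpos (show 0 ≤ 2 - θ by linarith) hcon
    linarith
  have hbp : b p = w := mul_left_cancel₀ (show (2 - θ) ≠ 0 by linarith) (hpb.trans hwb.symm)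
  have htop : b (p - 1) < b p := by
    have := mul_pos hθ0 hw_pos
    rw [hbp]
    linarith
  have heq : 4 * b 0 ^ 2 + 2 * ∑ i ∈ Finset.range p, (b (i + 1) - b i) ^ 2 +
      2 * (w - b (p - 1)) ^ 2 = θ * (2 * ∑ i ∈ Finset.range p, b i ^ 2 + b p ^ 2 + w ^ 2) := by
    rw [hS] at hmin
    linarith
  have hstrict : ∀ i, i < p → b i < b (i + 1) := by
    intro i hi
    rcases Nat.lt_or_ge (i + 1) p with h1 | h1
    · refine lt_of_le_of_ne (hbm i hi) fun hi' => ?_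
      exact theta_levels_strict hp hθ0 hbn hw_pos heq h1
        (fun i' hi'' => by
          obtain rfl : i' = i := by omega
          exact hi'.symm) (fun h => by omega)
    · obtain rfl : i = p - 1 := by omega
      rwa [Nat.sub_add_cancel hp]
  refine ⟨fun i hi => ?_, ?_, ?_, hstrict, hbp, ?_⟩
  · have := (Finset.sum_eq_zero_iff_of_nonneg fun i _ => sq_nonneg (h i)).1 hH0 i
      (Finset.mem_range.2 hi)
    exact pow_eq_zero_iff two_ne_zero |>.1 this
  · by_contra hne
    have h1 := hstrict j hj
    have h2 := hmono (j + 1) (p - 1) (by omega) (by omega)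
    linarith
  · refine lt_of_le_of_ne hb0 fun h0 => ?_
    exact theta_levels_strict hp hθ0 hbn hw_pos heq (k := 0) (by omega) (fun i hi => by omega)
      fun _ => h0.symm
  · rw [hS, hBdef] at hscale'
    linarith

/-! ### The least eigenvector of a graph of even order -/

theorem sum_range_two_mul_add_one (f : ℕ → ℝ) (p : ℕ) :
    ∑ k ∈ Finset.range (2 * p + 1), f k =
      f 0 + ∑ i ∈ Finset.range p, (f (2 * i + 1) + f (2 * i + 2)) := by
  induction p with
  | zero => simp
  | succ p ih =>
    rw [show 2 * (p + 1) + 1 = 2 * p + 1 + 1 + 1 by ring, Finset.sum_range_succ,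
      Finset.sum_range_succ, ih, Finset.sum_range_succ (n := p)]
    ring_nf

/-- The form of the zigzag cycle of odd length together with a vertex joined to one of its levels is
at least `q(Θ)`, and the vector is determined up to scaling when it is attained. -/
theorem zigzag_levels_of_energy_le {p : ℕ} (hp : 1 ≤ p) {Y : ℕ → ℝ} {w : ℝ} {j : ℕ} (hj : j < p)
    (hY : Monotone Y) (hY0 : Y 0 = -Y 1) (hYp : Y (2 * p + 2) = Y (2 * p + 1))
    (hθ0 : 0 < leastQEigenvalue (thetaGraph (2 * p + 2)))
    (hM : 0 < ∑ k ∈ Finset.range (2 * p + 1), Y (k + 1) ^ 2 + w ^ 2)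
    (hF : ∑ k ∈ Finset.range (2 * p + 1), (Y (k + 2) - Y k) ^ 2 + (w - Y (2 * j + 1)) ^ 2 +
      (w - Y (2 * j + 2)) ^ 2 ≤ leastQEigenvalue (thetaGraph (2 * p + 2)) *
        (∑ k ∈ Finset.range (2 * p + 1), Y (k + 1) ^ 2 + w ^ 2)) :
    (∀ i, i < p → Y (2 * i + 1) = Y (2 * i + 2)) ∧ j = p - 1 ∧ 0 < Y 1 ∧
      (∀ i, i < p → Y (2 * i + 2) < Y (2 * i + 3)) ∧ Y (2 * p + 1) = w ∧
      leastQEigenvalue (thetaGraph (2 * p + 2)) *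
          (∑ k ∈ Finset.range (2 * p + 1), Y (k + 1) ^ 2 + w ^ 2) ≤
        ∑ k ∈ Finset.range (2 * p + 1), (Y (k + 2) - Y k) ^ 2 + (w - Y (2 * j + 1)) ^ 2 +
          (w - Y (2 * j + 2)) ^ 2 := by
  have hY1 : 0 ≤ Y 1 := by
    have := hY (Nat.zero_le 1)
    linarith
  obtain ⟨b, hb⟩ : ∃ b : ℕ → ℝ, ∀ i, b i = (Y (2 * i + 1) + Y (2 * i + 2)) / 2 := ⟨_, fun _ => rfl⟩
  obtain ⟨h, hh⟩ : ∃ h : ℕ → ℝ, ∀ i, h i = (Y (2 * i + 2) - Y (2 * i + 1)) / 2 := ⟨_, fun _ => rfl⟩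
  have hbp : b p = Y (2 * p + 1) := by
    rw [hb, hYp]
    ring
  have e1 : ∑ k ∈ Finset.range (2 * p + 1), (Y (k + 2) - Y k) ^ 2 = 4 * b 0 ^ 2 +
      2 * ∑ i ∈ Finset.range p, (b (i + 1) - b i) ^ 2 +
      2 * ∑ i ∈ Finset.range p, (h (i + 1) - h i) ^ 2 := by
    rw [sum_range_two_mul_add_one, add_assoc, ← mul_add, ← Finset.sum_add_distrib, Finset.mul_sum]
    congr 1
    · rw [hb, hY0]
      simp only [mul_zero, zero_add]
      ring
    · refine Finset.sum_congr rfl fun i _ => ?_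
      rw [hb, hb, hh, hh]
      ring_nf
  have e2 : ∑ k ∈ Finset.range (2 * p + 1), Y (k + 1) ^ 2 = 2 * ∑ i ∈ Finset.range p, b i ^ 2 +
      b p ^ 2 + 2 * ∑ i ∈ Finset.range p, h i ^ 2 := by
    rw [hbp, Finset.sum_range_succ, add_right_comm, ← mul_add, ← Finset.sum_add_distrib,
      Finset.mul_sum]
    congr 1
    have := sum_range_two_mul_add_one (fun k => Y k ^ 2) p
    rw [Finset.sum_range_succ'] at this
    rw [add_right_cancel (this.trans (add_comm _ _))]
    refine Finset.sum_congr rfl fun i _ => ?_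
    rw [hb, hh]
    ring
  have e3 : (w - Y (2 * j + 1)) ^ 2 + (w - Y (2 * j + 2)) ^ 2 =
      2 * (w - b j) ^ 2 + 2 * h j ^ 2 := by
    rw [hb, hh]
    ring
  have e4 : ∑ k ∈ Finset.range (2 * p + 1), Y (k + 1) ^ 2 + w ^ 2 =
      2 * ∑ i ∈ Finset.range p, b i ^ 2 + b p ^ 2 + w ^ 2 +
        2 * ∑ i ∈ Finset.range p, h i ^ 2 := by
    rw [e2]
    ring
  have e5 : ∑ k ∈ Finset.range (2 * p + 1), (Y (k + 2) - Y k) ^ 2 + (w - Y (2 * j + 1)) ^ 2 +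
      (w - Y (2 * j + 2)) ^ 2 = 4 * b 0 ^ 2 +
      2 * ∑ i ∈ Finset.range p, (b (i + 1) - b i) ^ 2 +
      2 * ∑ i ∈ Finset.range p, (h (i + 1) - h i) ^ 2 + 2 * (w - b j) ^ 2 + 2 * h j ^ 2 := by
    rw [add_assoc, e3, e1]
    ring
  rw [e4] at hM
  rw [e4, e5] at hF ⊢
  obtain ⟨h1, h2, h3, h4, h5, h6⟩ := levels_of_energy_le hp hj
    (by rw [hb]; have := hY (show 1 ≤ 2 by omega); simp; linarith)
    (fun i _ => by
      rw [hb, hb]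
      have := hY (show 2 * i + 1 ≤ 2 * (i + 1) + 1 by omega)
      have := hY (show 2 * i + 2 ≤ 2 * (i + 1) + 2 by omega)
      linarith)
    (by rw [hh, hYp]; ring) hθ0 hM hF
  have h7 : ∀ i, i < p → Y (2 * i + 1) = Y (2 * i + 2) := fun i hi => by
    have := h1 i hi
    rw [hh] at this
    linarith
  refine ⟨h7, h2, ?_, fun i hi => ?_, hbp ▸ h5, h6⟩
  · rw [hb] at h3
    have := h7 0 (by omega)
    simp only [mul_zero, zero_add] at h3 this
    linarith
  · have h8 := h4 i hi
    rw [hb, hb] at h8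
    have h9 := h7 i hi
    rcases Nat.lt_or_ge (i + 1) p with h | h
    · have := h7 (i + 1) h
      rw [show 2 * (i + 1) + 1 = 2 * i + 3 by ring] at *
      linarith
    · obtain rfl : p = i + 1 := by omega
      rw [hYp, show 2 * (i + 1) + 1 = 2 * i + 3 by ring] at h8
      linarith

section LeastEigenvector

variable {V : Type*} [Fintype V] {n : ℕ} {G : SimpleGraph V} {ρ : V ≃ Fin n} {s : V → Bool}
  {x : V → ℝ} {A : ℕ → ℝ} {q : ℝ}

/-- The signless Laplacian of a nonbipartite 2-connected graph is positive definite, by comparison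
with the zigzag cycle. -/
theorem IsSignedRanking.qForm_pos (h : IsSignedRanking x ρ s A) (hG : IsKConnected G 2)
    (hb : ¬ G.IsBipartite) (hx : x ≠ 0) : 0 < qForm G x x := by
  by_contra! hcon
  have h1 := h.zigzag_add_le_qForm hG hb ∅ (fun _ => 0) (by simp)
  rw [Finset.sum_empty, add_zero] at h1
  have h2 : ∀ k < n, A (k + 2) = A k := by
    intro k hk
    have h3 := (Finset.sum_eq_zero_iff_of_nonneg fun k _ => sq_nonneg (A (k + 2) - A k)).1
      (le_antisymm (h1.trans hcon) (Finset.sum_nonneg fun k _ => sq_nonneg _)) k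
      (Finset.mem_range.2 hk)
    exact sub_eq_zero.1 (pow_eq_zero_iff two_ne_zero |>.1 h3)
  have hn : 3 ≤ n := by
    have := hG.1
    rwa [Fintype.card_congr ρ, Fintype.card_fin] at this
  have h01 := h2 0 (by omega)
  have h0 := h.zero
  have h12 := h.mono (show 1 ≤ 2 by omega)
  have h11 := h.one_nonneg
  have hA1 : A 1 = 0 := by
    simp only [zero_add] at h01
    linarith
  have hA : ∀ k, k < n → A k = 0 ∧ A (k + 1) = 0 := by
    intro k
    induction k with
    | zero => exact fun _ => ⟨by rw [h0, hA1, neg_zero], hA1⟩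
    | succ k ih => exact fun hk => ⟨(ih (by omega)).2, (h2 k (by omega)).trans (ih (by omega)).1⟩
  apply hx
  funext v
  rw [h.eq_sign_mul, (hA _ (ρ v).2).2, mul_zero, Pi.zero_apply]

/-- The eigenvalue equation at `u`, multiplied by the sign of `u`. -/
theorem IsSignedRanking.sum_neighbors (h : IsSignedRanking x ρ s A)
    (hQ : (signlessLaplacian G).mulVec x = q • x) (u : V) :
    ∑ v, (open Classical in if G.Adj u v then A (ρ u + 1) +
      (if s u = s v then A (ρ v + 1) else -A (ρ v + 1)) else 0) = q * A (ρ u + 1) := by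
  classical
  have h1 := congrFun hQ u
  rw [signlessLaplacian_mulVec, Pi.smul_apply, smul_eq_mul] at h1
  have h2 : boolSign (s u) * (q * x u) = q * A (ρ u + 1) := by
    rw [h.eq_sign_mul u]
    linear_combination q * A (ρ u + 1) * boolSign_mul_self (s u)
  rw [← h2, ← h1, Finset.mul_sum]
  refine Finset.sum_congr rfl fun v _ => ?_
  split_ifs with huv hs
  · rw [h.eq_sign_mul u, h.eq_sign_mul v, ← hs]
    linear_combination -(A (ρ u + 1) + A (ρ v + 1)) * boolSign_mul_self (s u)
  · have h3 : boolSign (s u) * boolSign (s v) = -1 := by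
      revert hs
      cases s u <;> cases s v <;> simp [boolSign]
    rw [h.eq_sign_mul u, h.eq_sign_mul v]
    linear_combination -A (ρ u + 1) * boolSign_mul_self (s u) - A (ρ v + 1) * h3
  · rw [mul_zero]

/-- For an eigenvector the signs can be chosen so that no vertex is a source, that is, has only
neighbours of opposite sign and no smaller rank. At a source the eigenvalue equation would give a
value of at most `0`; and if the vector vanishes there, the sign of the source may be reversed,
which increases the number of edges with ends of equal sign. -/
theorem exists_isSignedRanking_no_source (hG : IsKConnected G 2) (hb : ¬ G.IsBipartite)
    (hV : Fintype.card V = n) (hx : x ≠ 0) (hQ : (signlessLaplacian G).mulVec x = q • x) :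
    ∃ (ρ : V ≃ Fin n) (s : V → Bool) (A : ℕ → ℝ), IsSignedRanking x ρ s A ∧
      ∀ u, ∃ v, G.Adj u v ∧ ((ρ v : ℕ) < ρ u ∨ s u = s v) := by
  classical
  have hn : 0 < n := by
    have := hG.1
    omega
  obtain ⟨ρ, A, hA⟩ := exists_isSignedRanking hn hV x
  obtain ⟨s, hs, hmax⟩ := Finset.exists_max_image
    (Finset.univ.filter fun s : V → Bool => ∀ v, boolSign (s v) * x v = |x v|)
    (fun s => (Finset.univ.filter fun p : V × V => G.Adj p.1 p.2 ∧ s p.1 = s p.2).card)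
    ⟨fun v => decide (0 ≤ x v), by
      simp only [Finset.mem_filter, Finset.mem_univ, true_and]
      intro v
      by_cases h : 0 ≤ x v
      · simp [boolSign, h, abs_of_nonneg h]
      · simp [boolSign, h, abs_of_neg (not_le.1 h)]⟩
  rw [Finset.mem_filter] at hs
  have h := hA s hs.2
  refine ⟨ρ, s, A, h, fun u => ?_⟩
  by_contra! hcon
  have hsum := h.sum_neighbors hQ u
  rcases (h.nonneg (show 1 ≤ (ρ u : ℕ) + 1 by omega)).eq_or_lt with h0 | h0
  · have hxu : x u = 0 := by rw [h.eq_sign_mul, ← h0, mul_zero]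
    have h1 := hmax (Function.update s u (!s u)) (by
      simp only [Finset.mem_filter, Finset.mem_univ, true_and]
      intro v
      by_cases hv : v = u
      · rw [hv, hxu]
        simp
      · rw [Function.update_of_ne hv]
        exact hs.2 v)
    obtain ⟨v₀, hv₀, -⟩ := hG.exists_adj_vertex_ne u u
    refine absurd h1 (not_le.2 (Finset.card_lt_card ⟨fun p hp => ?_, fun hsub => ?_⟩))
    · simp only [Finset.mem_filter, Finset.mem_univ, true_and] at hp ⊢
      have h2 : p.1 ≠ u := by
        rintro rfl
        exact (hcon p.2 hp.1).2 hp.2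
      have h3 : p.2 ≠ u := by
        rintro rfl
        exact (hcon p.1 hp.1.symm).2 hp.2.symm
      rwa [Function.update_of_ne h2, Function.update_of_ne h3]
    · have h2 : (u, v₀) ∈ Finset.univ.filter fun p : V × V => G.Adj p.1 p.2 ∧ s p.1 = s p.2 := by
        apply hsub
        simp only [Finset.mem_filter, Finset.mem_univ, true_and]
        refine ⟨hv₀, ?_⟩
        rw [Function.update_self, Function.update_of_ne hv₀.ne']
        have := (hcon v₀ hv₀).2
        revert this
        cases s u <;> cases s v₀ <;> simp
      exact (hcon v₀ hv₀).2 (Finset.mem_filter.1 h2).2.2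
  · have hE := h.qForm_pos hG hb hx
    rw [qForm_self_of_mulVec hQ] at hE
    have hq : 0 < q := (mul_pos_iff_of_pos_right (sum_sq_pos hx)).1 hE
    have : ∑ v, (if G.Adj u v then A (ρ u + 1) +
      (if s u = s v then A (ρ v + 1) else -A (ρ v + 1)) else 0) ≤ 0 := by
      refine Finset.sum_nonpos fun v _ => ?_
      split_ifs with huv hsv
      · exact absurd hsv (hcon v huv).2
      · have := h.mono (show (ρ u : ℕ) + 1 ≤ ρ v + 1 from Nat.succ_le_succ (hcon v huv).1)
        linarith
      · rfl
    have := mul_pos hq h0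
    linarith

end LeastEigenvector

/-! ### Graphs of even order with small least eigenvalue -/

section EvenStructure

variable {V : Type*} [Fintype V] {n : ℕ} {G : SimpleGraph V} {ρ : V ≃ Fin n} {s : V → Bool}
  {x : V → ℝ} {A : ℕ → ℝ} {q : ℝ}

/-- A vertex all of whose neighbours have its sign forces three zeros of the eigenvector. -/
theorem IsSignedRanking.three_eq_zero_of_same_sign (h : IsSignedRanking x ρ s A)
    (hG : IsKConnected G 2) (hQ : (signlessLaplacian G).mulVec x = q • x) (hq : q < 1) {u : V}
    (hu : ∀ v, G.Adj u v → s u = s v) : A 3 = 0 := by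
  classical
  have hsum := h.sum_neighbors hQ u
  obtain ⟨v₁, hv₁, -⟩ := hG.exists_adj_vertex_ne u u
  obtain ⟨v₂, hv₂, hne⟩ := hG.exists_adj_vertex_ne u v₁
  have hnn : ∀ v, 0 ≤ A (ρ v + 1) := fun v => h.nonneg (by omega)
  have hterm : ∀ v ∈ Finset.univ, 0 ≤ if G.Adj u v then A (ρ u + 1) +
      (if s u = s v then A (ρ v + 1) else -A (ρ v + 1)) else 0 := by
    intro v _
    split_ifs with huv hsv
    · exact add_nonneg (hnn _) (hnn _)
    · exact absurd (hu v huv) hsv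
    · rfl
  have h1 := Finset.sum_le_sum_of_subset_of_nonneg (Finset.subset_univ {v₂, v₁})
    fun v _ _ => hterm v (Finset.mem_univ v)
  rw [hsum, Finset.sum_pair hne, if_pos hv₁, if_pos hv₂, if_pos (hu _ hv₁), if_pos (hu _ hv₂)] at h1
  have n0 := hnn u
  have n1 := hnn v₁
  have n2 := hnn v₂
  have h2 : q * A (ρ u + 1) ≤ A (ρ u + 1) := mul_le_of_le_one_left n0 hq.le
  have z0 : A (ρ u + 1) = 0 := by linarith
  rw [z0, mul_zero] at h1
  have z1 : A (ρ v₁ + 1) = 0 := by linarith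
  have z2 : A (ρ v₂ + 1) = 0 := by linarith
  have d1 := rank_ne (ρ := ρ) hv₁.ne
  have d2 := rank_ne (ρ := ρ) hv₂.ne
  have d3 := rank_ne (ρ := ρ) hne
  have h3 : ∀ v, 2 ≤ (ρ v : ℕ) → A (ρ v + 1) = 0 → A 3 = 0 := fun v hv hz =>
    le_antisymm (hz ▸ h.mono (by omega)) (h.nonneg (by omega))
  by_cases c0 : 2 ≤ (ρ u : ℕ)
  · exact h3 u c0 z0
  by_cases c1 : 2 ≤ (ρ v₁ : ℕ)
  · exact h3 v₁ c1 z1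
  · exact h3 v₂ (by omega) z2

theorem IsLowPair.adj (hG : IsKConnected G 2) {p q u v : V} (h : IsLowPair G ρ s p q u v) :
    G.Adj p q ∧ G.Adj p u ∧ G.Adj q v := by
  obtain ⟨a, ha, hau⟩ := hG.exists_adj_vertex_ne p u
  obtain ⟨b, hb, hbq⟩ := hG.exists_adj_vertex_ne p q
  obtain ⟨c, hc, hcp⟩ := hG.exists_adj_vertex_ne q p
  exact ⟨(h.adj_left a ha).resolve_right hau ▸ ha, (h.adj_left b hb).resolve_left hbq ▸ hb,
    (h.adj_right c hc).resolve_left hcp ▸ hc⟩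

/-- The eigenvalue equation at a vertex of degree two, one neighbour of each sign. -/
theorem IsSignedRanking.lowPair_equation (h : IsSignedRanking x ρ s A)
    (hQ : (signlessLaplacian G).mulVec x = q • x) {a b u : V} (hab : G.Adj a b) (hau : G.Adj a u)
    (hbu : b ≠ u) (hs : s a ≠ s b) (hs' : s a = s u) (hall : ∀ w, G.Adj a w → w = b ∨ w = u) :
    (2 - q) * A (ρ a + 1) + A (ρ u + 1) = A (ρ b + 1) := by
  classical
  have hsum := h.sum_neighbors hQ a
  rw [← Finset.sum_subset (Finset.subset_univ {b, u}), Finset.sum_pair hbu, if_pos hab, if_pos hau,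
    if_neg hs, if_pos hs'] at hsum
  · linarith
  · intro w _ hw
    rw [if_neg]
    intro haw
    exact hw (by simpa using hall w haw)

/-- The exceptional pair of lowest vertices forces three zeros of the eigenvector. -/
theorem IsLowPair.three_eq_zero {p r u v : V} (hl : IsLowPair G ρ s p r u v)
    (h : IsSignedRanking x ρ s A) (hG : IsKConnected G 2)
    (hQ : (signlessLaplacian G).mulVec x = q • x) (hq : q < 1) : A 3 = 0 := by
  obtain ⟨h1, h2, h3⟩ := hl.adj hG
  have hpr := hl.rank_left
  have hrr := hl.rank_right
  have hur := hl.le_left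
  have hvr := hl.le_right
  have e1 := h.lowPair_equation hQ h1 h2 (ne_of_rank_ne (ρ := ρ) (by omega)) hl.sign_ne
    hl.sign_left.symm hl.adj_left
  have e2 := h.lowPair_equation hQ h1.symm h3 (ne_of_rank_ne (ρ := ρ) (by omega)) hl.sign_ne.symm
    hl.sign_right.symm hl.adj_right
  have m1 : A 3 ≤ A (ρ u + 1) := h.mono (by omega)
  have m2 : A 3 ≤ A (ρ v + 1) := h.mono (by omega)
  have m3 : 0 ≤ A 3 := h.nonneg (by omega)
  have m4 : 0 ≤ A (ρ p + 1) := h.nonneg (by omega)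
  have m5 : 0 ≤ A (ρ r + 1) := h.nonneg (by omega)
  have m6 := mul_le_mul_of_nonneg_right hq.le m4
  have m7 := mul_le_mul_of_nonneg_right hq.le m5
  linarith

/-- The form of a 2-connected nonbipartite graph of even order at an eigenvector for an eigenvalue
`q < 1` is at least that of a zigzag cycle of odd length together with a vertex of value `A W`
joined to a level of the cycle. -/
theorem exists_reduced_form {p : ℕ} (hp : 1 ≤ p) (hG : IsKConnected G 2)
    (hb : ¬ G.IsBipartite) (hV : Fintype.card V = 2 * p + 2) (hx : x ≠ 0)
    (hQ : (signlessLaplacian G).mulVec x = q • x) (hq : q < 1) :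
    ∃ (ρ : V ≃ Fin (2 * p + 2)) (s : V → Bool) (A : ℕ → ℝ), IsSignedRanking x ρ s A ∧
      ∃ j W, j < p ∧ (W = 2 * j + 2 ∨ W = 2 * j + 3 ∧ HasTwinDefect G ρ s (2 * j)) ∧
      ∑ k ∈ Finset.range (2 * p + 1), (eraseTerm A W (k + 2) - eraseTerm A W k) ^ 2 +
      (A W - eraseTerm A W (2 * j + 1)) ^ 2 + (A W - eraseTerm A W (2 * j + 2)) ^ 2 ≤
        qForm G x x := by
  obtain ⟨ρ, s, A, h, hsrc⟩ := exists_isSignedRanking_no_source hG hb hV hx hQ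
  refine ⟨ρ, s, A, h, ?_⟩
  -- with three zeros, the zigzag cycle of even length already has the required form
  have hzero : A 3 = 0 → ∃ j W, j < p ∧
      (W = 2 * j + 2 ∨ W = 2 * j + 3 ∧ HasTwinDefect G ρ s (2 * j)) ∧
      ∑ k ∈ Finset.range (2 * p + 1), (eraseTerm A W (k + 2) - eraseTerm A W k) ^ 2 +
      (A W - eraseTerm A W (2 * j + 1)) ^ 2 + (A W - eraseTerm A W (2 * j + 2)) ^ 2 ≤
        qForm G x x := by
    intro h3
    have h1 := h.one_nonneg
    have h13 := h.mono (show 1 ≤ 3 by omega)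
    have h2 := h.nonneg (show 1 ≤ 2 by omega)
    have h23 := h.mono (show 2 ≤ 3 by omega)
    have z1 : A 1 = 0 := by linarith
    have z2 : A 2 = 0 := by linarith
    have z0 : A 0 = 0 := by rw [h.zero, z1, neg_zero]
    refine ⟨0, 2, by omega, Or.inl rfl, ?_⟩
    have e := zigzag_eraseTerm A (2 * p - 1) 0
    have hZ := h.zigzag_add_le_qForm hG hb ∅ (fun _ => 0) (by simp)
    rw [Finset.sum_empty, add_zero] at hZ
    rw [show 0 + 2 + (2 * p - 1) = 2 * p + 1 by omega] at e
    have e1 : eraseTerm A 2 (2 * 0 + 1) = A 1 := if_pos (by omega)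
    have e2 : eraseTerm A 2 (2 * 0 + 2) = A 3 := if_neg (by omega)
    rw [e1, e2, z1, z2, h3]
    simp only [zero_add, z0, z1, z2, h3] at e
    linarith
  rcases exists_defect hG hb ⟨p + 1, by ring⟩ hsrc with
    ⟨u, hu⟩ | ⟨a, b, u, v, hl⟩ | ⟨i, hi, hin, hd⟩
  · exact hzero (h.three_eq_zero_of_same_sign hG hQ hq hu)
  · exact hzero (hl.three_eq_zero h hG hQ hq)
  · obtain ⟨j, hj⟩ := hi
    obtain rfl : i = 2 * j := by omega
    rcases hd with hd | hd
    · refine ⟨j, 2 * j + 2, by omega, Or.inl rfl, ?_⟩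
      have e1 : eraseTerm A (2 * j + 2) (2 * j + 1) = A (2 * j + 1) := if_pos (by omega)
      have e2 : eraseTerm A (2 * j + 2) (2 * j + 2) = A (2 * j + 3) := if_neg (by omega)
      rw [e1, e2]
      exact hd.le_qForm h hG hb hin
    · refine ⟨j, 2 * j + 3, by omega, Or.inr ⟨rfl, hd⟩, ?_⟩
      have e1 : eraseTerm A (2 * j + 3) (2 * j + 1) = A (2 * j + 1) := if_pos (by omega)
      have e2 : eraseTerm A (2 * j + 3) (2 * j + 2) = A (2 * j + 2) := if_pos (by omega)
      rw [e1, e2]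
      exact hd.le_qForm h hG hb hin

/-- If `q(G) ≤ q(Θ)`, the vertices of `G` fall into pairs of which only consecutive ones are joined,
by at most two edges except at the top, and an edge outside the lowest pair joins vertices of
opposite sign. -/
theorem exists_levels_of_leastQEigenvalue_le {p : ℕ} (hp : 1 ≤ p) (hG : IsKConnected G 2)
    (hb : ¬ G.IsBipartite) (hV : Fintype.card V = 2 * p + 2)
    (hle : leastQEigenvalue G ≤ leastQEigenvalue (thetaGraph (2 * p + 2))) :
    ∃ (ρ : V ≃ Fin (2 * p + 2)) (s : V → Bool),
      (∀ i, 1 ≤ i → i < p → (gapDarts G ρ s (2 * i) (2 * i)).card ≤ 2) ∧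
      ∀ i l, i < l → l ≤ p → gapDarts G ρ s (2 * i) (2 * l) = ∅ := by
  have hne : Nonempty V := Fintype.card_pos_iff.1 (by omega)
  obtain ⟨x, hx, hQ⟩ := exists_leastQEigenvector G
  have hθ1 := leastQEigenvalue_thetaGraph_lt_one hp
  obtain ⟨ρ, s, A, h, j, W, hj, hW, hred⟩ := exists_reduced_form hp hG hb hV hx hQ
    (lt_of_le_of_lt hle hθ1)
  refine ⟨ρ, s, ?_⟩
  have hE := h.qForm_pos hG hb hx
  have hEq := qForm_self_of_mulVec hQ
  have hxx := sum_sq_pos hx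
  rw [hEq] at hE
  have hq : 0 < leastQEigenvalue G := (mul_pos_iff_of_pos_right hxx).1 hE
  have hθ0 := hq.trans_le hle
  have hEle : qForm G x x ≤ leastQEigenvalue (thetaGraph (2 * p + 2)) * ∑ v, x v ^ 2 :=
    hEq.trans_le (mul_le_mul_of_nonneg_right hle hxx.le)
  have hWb : 2 ≤ W ∧ W ≤ 2 * p + 1 := by omega
  have hmass : ∑ k ∈ Finset.range (2 * p + 1), eraseTerm A W (k + 1) ^ 2 + A W ^ 2 =
      ∑ v, x v ^ 2 := by
    rw [h.sum_sq]
    obtain ⟨m, rfl⟩ : ∃ m, W = m + 2 := ⟨W - 2, by omega⟩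
    have := sum_eraseTerm A (2 * p - 1 - m) m
    rwa [show m + 2 + (2 * p - 1 - m) = 2 * p + 1 by omega] at this
  rw [← hmass] at hxx hEle
  have ht : ∀ k, 2 * p + 2 ≤ k → A k = A (2 * p + 2) := h.top
  obtain ⟨c1, c2, c3, c4, c5, c6⟩ := zigzag_levels_of_energy_le hp hj (eraseTerm_mono h.mono W)
    (by
      have e0 : eraseTerm A W 0 = A 0 := if_pos (by omega)
      have e1 : eraseTerm A W 1 = A 1 := if_pos (by omega)
      rw [e0, e1, h.zero])
    (by
      have e0 : eraseTerm A W (2 * p + 2) = A (2 * p + 3) := if_neg (by omega)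
      have e1 : eraseTerm A W (2 * p + 1) = A (2 * p + 2) := if_neg (by omega)
      rw [e0, e1, ht _ (by omega)])
    hθ0 hxx (hred.trans hEle)
  have e1 : eraseTerm A W (2 * p + 1) = A (2 * p + 2) := if_neg (by omega)
  rw [e1] at c5
  rcases hW with hW | ⟨hW, hd⟩
  · -- a split at the top level would leave the removed value below that level
    have h1 := c4 (p - 1) (by omega)
    rw [show 2 * (p - 1) + 3 = 2 * p + 1 by omega, e1, c5] at h1
    have e2 : eraseTerm A W (2 * (p - 1) + 2) = A (2 * p + 1) := by
      rw [eraseTerm, if_neg (by omega)]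
      congr 1
      omega
    rw [e2] at h1
    exact absurd h1 (not_lt.2 (h.mono (by omega)))
  · obtain rfl : W = 2 * p + 1 := by omega
    obtain rfl : j = p - 1 := c2
    have eY : ∀ k, k ≤ 2 * p → eraseTerm A (2 * p + 1) k = A k := fun k hk => if_pos (by omega)
    have hodd : ∀ i, i ≤ p → A (2 * i + 1) = A (2 * i + 2) := by
      intro i hi
      rcases hi.lt_or_eq with hi | rfl
      · have := c1 i hi
        rwa [eY _ (by omega), eY _ (by omega)] at this
      · exact c5.symm
    have heven : ∀ i, i ≤ p → A (2 * i) < A (2 * i + 1) := by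
      intro i hi
      rcases i with _ | i
      · have h0 := h.zero
        rw [eY _ (by omega)] at c3
        simp only [mul_zero, zero_add]
        linarith
      · have := c4 i (by omega)
        rw [eY _ (by omega)] at this
        rcases hi.lt_or_eq with hi' | hi'
        · rwa [eY _ (by omega)] at this
        · rw [show 2 * i + 3 = 2 * p + 1 by omega, e1] at this
          rw [hodd _ hi, show 2 * (i + 1) + 2 = 2 * p + 2 by omega]
          exact this
    -- the twin defect at the top leaves two edges more than the zigzag cycle across the gap `2 * p`
    have hcard : ∀ k ∈ ({(2 * p, 2 * p)} : Finset (ℕ × ℕ)), k.1 < 2 * p + 2 → k.2 < 2 * p + 2 →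
        zigzagCoeff k.1 k.2 + (2 : ℝ) ≤ qForm G (layer ρ s k.1) (layer ρ s k.2) := by
      intro k hk _ _
      rw [Finset.mem_singleton] at hk
      subst hk
      have := le_qForm_layer le_rfl (by omega) hd.card₂₂
      rw [show 2 * (p - 1) + 2 = 2 * p by omega] at this
      norm_num [zigzagCoeff, show p ≠ 0 by omega] at this ⊢
      exact this
    have hcmp := h.zigzag_add_le_qForm hG hb {(2 * p, 2 * p)} (fun _ => 2) hcard
    have hexact : qForm G x x = ∑ k ∈ Finset.range (2 * p + 2), (A (k + 2) - A k) ^ 2 +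
        ∑ k ∈ ({(2 * p, 2 * p)} : Finset (ℕ × ℕ)),
          (A (k.1 + 1) - A k.1) * (A (k.2 + 1) - A k.2) * 2 := by
      refine le_antisymm (hEle.trans (c6.trans (le_of_eq ?_))) hcmp
      have e := zigzag_eraseTerm A 0 (2 * p - 1)
      have o1 := hodd (p - 1) (by omega)
      have o2 := hodd p le_rfl
      rw [show 2 * (p - 1) + 1 = 2 * p - 1 by omega, show 2 * (p - 1) + 2 = 2 * p by omega] at o1 ⊢
      rw [show 2 * p - 1 + 2 = 2 * p + 1 by omega, show 2 * p - 1 + 3 = 2 * p + 2 by omega,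
        show 2 * p - 1 + 1 = 2 * p by omega, show 2 * p - 1 + 4 = 2 * p + 3 by omega,
        ht (2 * p + 3) (by omega), o1, ← o2] at e
      rw [eY _ (by omega), eY _ (by omega), Finset.sum_singleton, o1]
      linarith
    have hbound : ∀ i l, i ≤ p → l ≤ p → qForm G (layer ρ s (2 * i)) (layer ρ s (2 * l)) ≤
        zigzagCoeff (2 * i) (2 * l) +
          ∑ k ∈ ({(2 * p, 2 * p)} : Finset (ℕ × ℕ)) with k = (2 * i, 2 * l), (2 : ℝ) :=
      fun i l hi hl => qForm_layer_le_of_eq h hG hb _ _ hcard hexact (heven i hi) (heven l hl)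
    constructor
    · intro i hi1 hi
      have h1 := hbound i i hi.le hi.le
      rw [Finset.filter_eq_empty_iff.2, Finset.sum_empty, add_zero] at h1
      · have h2 := (card_gapDarts_le le_rfl (by omega)).trans h1
        rw [zigzagCoeff, if_pos rfl, if_neg (by omega)] at h2
        exact_mod_cast h2
      · intro k hk
        rw [Finset.mem_singleton] at hk
        rw [hk, Prod.mk.injEq]
        omega
    · intro i l hil hl
      have h1 := hbound i l (by omega) hl
      rw [Finset.filter_eq_empty_iff.2, Finset.sum_empty, add_zero] at h1
      · have h2 := (card_gapDarts_le (by omega) (by omega)).trans h1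
        rw [zigzagCoeff, if_neg (by omega), if_neg (by omega)] at h2
        have h3 : (gapDarts G ρ s (2 * i) (2 * l)).card ≤ 0 := by exact_mod_cast h2
        exact Finset.card_eq_zero.1 (by omega)
      · intro k hk
        rw [Finset.mem_singleton] at hk
        rw [hk, Prod.mk.injEq]
        omega

end EvenStructure

/-! ### Graphs built from levels of two vertices -/

/-- The vertices of `G` of level less than `m` come in pairs of equal level, edges join only equal
or consecutive levels, and at most two edges join two consecutive pairs. -/
structure IsLadder {V : Type*} (G : SimpleGraph V) (lev : V → ℕ) (m : ℕ) : Prop where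
  pair : ∀ i, i < m → ∃ a b, a ≠ b ∧ ∀ v, lev v = i ↔ v = a ∨ v = b
  near : ∀ u v, G.Adj u v → lev v ≤ lev u + 1
  cross : ∀ i, i + 1 < m → ∃ S : Finset (V × V), S.card ≤ 2 ∧
    ∀ u v, G.Adj u v → lev u = i → lev v = i + 1 → (u, v) ∈ S

/-- A choice of one vertex `L i` and the other vertex `R i` on each level such that edges between
consecutive levels stay on the same side. -/
structure IsAligned {V : Type*} (G : SimpleGraph V) (lev : V → ℕ) (m : ℕ) (L R : ℕ → V) :
    Prop where
  lev_left : ∀ i, i < m → lev (L i) = i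
  lev_right : ∀ i, i < m → lev (R i) = i
  ne : ∀ i, i < m → L i ≠ R i
  eq_or : ∀ v, lev v < m → v = L (lev v) ∨ v = R (lev v)
  adj_left : ∀ i k, i < m → k < m → (G.Adj (L i) (L k) ↔ i = k + 1 ∨ k = i + 1)
  adj_right : ∀ i k, i < m → k < m → (G.Adj (R i) (R k) ↔ i = k + 1 ∨ k = i + 1)
  adj_left_right : ∀ i k, i < m → k < m → G.Adj (L i) (R k) → i = k

namespace IsLadder

variable {V : Type*} {G : SimpleGraph V} {lev : V → ℕ} {m : ℕ}

theorem exists_partner (h : IsLadder G lev m) {a : V} (ha : lev a < m) :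
    ∃ a', a' ≠ a ∧ lev a' = lev a ∧ ∀ v, lev v = lev a → v = a ∨ v = a' := by
  obtain ⟨b, c, hbc, hv⟩ := h.pair _ ha
  rcases (hv a).1 rfl with rfl | rfl
  · exact ⟨c, hbc.symm, (hv c).2 (Or.inr rfl), fun v hv' => (hv v).1 hv'⟩
  · exact ⟨b, hbc, (hv b).2 (Or.inl rfl), fun v hv' => ((hv v).1 hv').symm⟩

variable [Fintype V]

theorem exists_adj_avoiding (h : IsLadder G lev m) (hG : IsKConnected G 2) {i : ℕ} {a b : V} (c : V)
    (ha : lev a ≤ i) (hb : i < lev b) (hac : a ≠ c) (hbc : b ≠ c) :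
    ∃ u v, G.Adj u v ∧ lev u = i ∧ lev v = i + 1 ∧ u ≠ c ∧ v ≠ c := by
  obtain ⟨u, v, huv, hu, hv, huc, hvc⟩ := hG.exists_adj_ne c (fun v => lev v ≤ i) ha
    (not_le.2 hb) hac hbc
  have := h.near u v huv
  exact ⟨u, v, huv, by omega, by omega, huc, hvc⟩

/-- Every vertex has a neighbour on the next level: otherwise its partner would be a cut vertex. -/
theorem exists_adj_up (h : IsLadder G lev m) (hG : IsKConnected G 2) {a b : V}
    (ha : lev a < m) (hb : lev a < lev b) : ∃ v, G.Adj a v ∧ lev v = lev a + 1 := by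
  obtain ⟨a', hne, hla, hall⟩ := h.exists_partner ha
  obtain ⟨u, v, huv, hu, hv, hua, -⟩ := h.exists_adj_avoiding hG a' le_rfl hb hne.symm (by
    rintro rfl
    omega)
  obtain rfl := (hall u hu).resolve_right hua
  exact ⟨v, huv, hv⟩

theorem exists_adj_down (h : IsLadder G lev m) (hG : IsKConnected G 2) {a b : V} {i : ℕ}
    (hi : i + 1 < m) (ha : lev a = i) (hb : lev b = i + 1) : ∃ u, G.Adj u b ∧ lev u = i := by
  obtain ⟨b', hne, hlb, hall⟩ := h.exists_partner (a := b) (by omega)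
  obtain ⟨u, v, huv, hu, hv, -, hvb⟩ := h.exists_adj_avoiding hG b' ha.le
    (show i < lev b by omega) (by rintro rfl; omega) hne.symm
  obtain rfl := (hall v (by omega)).resolve_right hvb
  exact ⟨u, huv, hu⟩

/-- A vertex has only one neighbour on the next level: a second one, together with an edge of the
partner, would make three edges between the two levels. -/
theorem eq_of_adj_up (h : IsLadder G lev m) (hG : IsKConnected G 2) {a b b' : V} {i : ℕ}
    (hi : i + 1 < m) (ha : lev a = i) (hb : lev b = i + 1) (hb' : lev b' = i + 1)
    (hab : G.Adj a b) (hab' : G.Adj a b') : b = b' := by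
  by_contra hne
  obtain ⟨a', hne', hla, -⟩ := h.exists_partner (a := a) (by omega)
  obtain ⟨c, hc, hc'⟩ := h.exists_adj_up hG (a := a') (b := b) (by omega) (by omega)
  obtain ⟨S, hS, hmem⟩ := h.cross i hi
  refine absurd hS (not_le.2 (Finset.two_lt_card.2 ⟨(a, b), hmem _ _ hab ha hb, (a, b'),
    hmem _ _ hab' ha hb', (a', c), hmem _ _ hc (by omega) (by omega), ?_, ?_, ?_⟩))
  · exact fun h => hne (Prod.mk.inj h).2
  · exact fun h => hne' (Prod.mk.inj h).1.symm
  · exact fun h => hne' (Prod.mk.inj h).1.symm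

theorem eq_of_adj_down (h : IsLadder G lev m) (hG : IsKConnected G 2) {a a' b : V} {i : ℕ}
    (hi : i + 1 < m) (ha : lev a = i) (ha' : lev a' = i) (hb : lev b = i + 1)
    (hab : G.Adj a b) (hab' : G.Adj a' b) : a = a' := by
  by_contra hne
  obtain ⟨b', hne', hlb, -⟩ := h.exists_partner (a := b) (by omega)
  obtain ⟨c, hc, hc'⟩ := h.exists_adj_down hG hi ha (b := b') (by omega)
  obtain ⟨S, hS, hmem⟩ := h.cross i hi
  refine absurd hS (not_le.2 (Finset.two_lt_card.2 ⟨(a, b), hmem _ _ hab ha hb, (a', b),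
    hmem _ _ hab' ha' hb, (c, b'), hmem _ _ hc (by omega) (by omega), ?_, ?_, ?_⟩))
  · exact fun h => hne (Prod.mk.inj h).1
  · exact fun h => hne' (Prod.mk.inj h).2.symm
  · exact fun h => hne' (Prod.mk.inj h).2.symm

/-- Each side starts at one of the two lowest vertices and follows the unique neighbour on the next
level. -/
theorem exists_isAligned (h : IsLadder G lev m) (hG : IsKConnected G 2) (hm : 0 < m) :
    ∃ L R, IsAligned G lev m L R := by
  classical
  have hup : ∀ a, ∃ v, lev a + 1 < m → G.Adj a v ∧ lev v = lev a + 1 := by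
    intro a
    by_cases ha : lev a + 1 < m
    · obtain ⟨b, _, _, hb⟩ := h.pair _ ha
      have hlb := (hb b).2 (Or.inl rfl)
      obtain ⟨v, hv⟩ := h.exists_adj_up hG (a := a) (b := b) (by omega) (by omega)
      exact ⟨v, fun _ => hv⟩
    · exact ⟨a, fun h => absurd h ha⟩
  choose f hf using hup
  obtain ⟨l, r, hlr, hlev⟩ := h.pair 0 hm
  have hl : lev l = 0 := (hlev l).2 (Or.inl rfl)
  have hr : lev r = 0 := (hlev r).2 (Or.inr rfl)
  have hit : ∀ a, lev a = 0 → ∀ i, i < m → lev (f^[i] a) = i := by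
    intro a ha i
    induction i with
    | zero => exact fun _ => ha
    | succ i ih =>
      intro hi
      rw [Function.iterate_succ_apply']
      have := ih (by omega)
      rw [(hf (f^[i] a) (by omega)).2, this]
  have hadj : ∀ a, lev a = 0 → ∀ i, i + 1 < m → G.Adj (f^[i] a) (f^[i + 1] a) := by
    intro a ha i hi
    rw [Function.iterate_succ_apply']
    exact (hf _ (by rw [hit a ha i (by omega)]; omega)).1
  have hne : ∀ i, i < m → f^[i] l ≠ f^[i] r := by
    intro i
    induction i with
    | zero => exact fun _ => hlr
    | succ i ih =>
      intro hi heq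
      have h1 := hadj r hr i hi
      rw [← heq] at h1
      exact ih (by omega) (h.eq_of_adj_down hG hi (hit l hl i (by omega)) (hit r hr i (by omega))
        (hit l hl _ hi) (hadj l hl i hi) h1)
  -- edges between the sides join equal levels
  have hcross : ∀ a b, lev a = 0 → lev b = 0 → (∀ i, i < m → f^[i] a ≠ f^[i] b) → ∀ i k, i < m →
      k < m → G.Adj (f^[i] a) (f^[k] b) → k ≤ i := by
    intro a b ha hb hab i k hi hk hadj'
    have h1 := h.near _ _ hadj'
    rw [hit a ha i hi, hit b hb k hk] at h1
    by_contra hcon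
    obtain rfl : k = i + 1 := by omega
    exact hab (i + 1) hk (h.eq_of_adj_up hG hk (hit a ha i hi) (hit a ha _ hk) (hit b hb _ hk)
      (hadj a ha i hk) hadj')
  have hside : ∀ a, lev a = 0 → ∀ i k, i < m → k < m →
      (G.Adj (f^[i] a) (f^[k] a) ↔ i = k + 1 ∨ k = i + 1) := by
    intro a ha i k hi hk
    constructor
    · intro hik
      have h1 := h.near _ _ hik
      have h2 := h.near _ _ hik.symm
      rw [hit a ha i hi, hit a ha k hk] at h1 h2
      have h3 : i ≠ k := by
        rintro rfl
        exact hik.ne rfl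
      omega
    · rintro (rfl | rfl)
      · exact (hadj a ha k hi).symm
      · exact hadj a ha i hk
  refine ⟨fun i => f^[i] l, fun i => f^[i] r, hit l hl, hit r hr, hne, fun v hv => ?_,
    hside l hl, hside r hr, fun i k hi hk hik => ?_⟩
  · obtain ⟨a, b, -, hab⟩ := h.pair _ hv
    have h1 := (hab _).1 (hit l hl _ hv)
    have h2 := (hab _).1 (hit r hr _ hv)
    have h3 := (hab v).1 rfl
    have h4 := hne _ hv
    rcases h1 with h1 | h1 <;> rcases h2 with h2 | h2 <;> rcases h3 with h3 | h3 <;>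
      first
      | exact absurd (h1.trans h2.symm) h4
      | exact Or.inl (h3.trans h1.symm)
      | exact Or.inr (h3.trans h2.symm)
  · exact le_antisymm (hcross r l hr hl (fun i hi => (hne i hi).symm) k i hk hi hik.symm)
      (hcross l r hl hr hne i k hi hk hik)

end IsLadder

/-! ### Isomorphisms from ladders -/

theorem nonempty_iso_of_forall_adj_iff {V W : Type*} [Fintype V] [Fintype W] {G : SimpleGraph V}
    {H : SimpleGraph W} (φ : W → V) (hφ : Function.Surjective φ)
    (hcard : Fintype.card W = Fintype.card V) (hadj : ∀ a b, G.Adj (φ a) (φ b) ↔ H.Adj a b) :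
    Nonempty (G ≃g H) := by
  have hbij : Function.Bijective φ := (Fintype.bijective_iff_surjective_and_card φ).2 ⟨hφ, hcard⟩
  exact ⟨(SimpleGraph.Iso.symm ⟨Equiv.ofBijective φ hbij, hadj _ _⟩)⟩

theorem cycleGraph_adj_iff {n : ℕ} (hn : 3 ≤ n) (x y : Fin n) :
    (SimpleGraph.cycleGraph n).Adj x y ↔ (x : ℕ) + 1 = y ∨ (y : ℕ) + 1 = x ∨
      ((x : ℕ) = 0 ∧ (y : ℕ) + 1 = n) ∨ ((y : ℕ) = 0 ∧ (x : ℕ) + 1 = n) := by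
  have key : ∀ a b : Fin n, ((a - b : Fin n) : ℕ) = 1 ↔
      (b : ℕ) + 1 = a ∨ ((a : ℕ) = 0 ∧ (b : ℕ) + 1 = n) := by
    intro a b
    have ha := a.2
    have hb := b.2
    rw [Fin.sub_def]
    dsimp only
    rcases le_or_gt (b : ℕ) a with h | h
    · rw [show n - (b : ℕ) + a = (a - b) + n by omega, Nat.add_mod_right,
        Nat.mod_eq_of_lt (by omega)]
      omega
    · rw [Nat.mod_eq_of_lt (by omega)]
      omega
  rw [SimpleGraph.cycleGraph_adj', key, key]
  tauto

theorem chordedCycle_adj_iff {n : ℕ} (hn : 3 ≤ n) (I : Finset ℕ) (x y : Fin n) :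
    (chordedCycle n I).Adj x y ↔ ((x : ℕ) + 1 = y ∨ (y : ℕ) + 1 = x ∨
      ((x : ℕ) = 0 ∧ (y : ℕ) + 1 = n) ∨ ((y : ℕ) = 0 ∧ (x : ℕ) + 1 = n)) ∨
      ((x : ℕ) ≠ y ∧ (((x : ℕ) ∈ I ∧ (x : ℕ) + y = n) ∨ ((y : ℕ) ∈ I ∧ (y : ℕ) + x = n))) := by
  rw [chordedCycle, SimpleGraph.sup_adj, cycleGraph_adj_iff hn, SimpleGraph.fromRel_adj, Ne,
    Fin.ext_iff]

theorem chordedCycle_empty (n : ℕ) : chordedCycle n ∅ = SimpleGraph.cycleGraph n := by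
  ext x y
  simp [chordedCycle]

section Isomorphism

variable {V : Type*} [Fintype V] {G : SimpleGraph V} {lev : V → ℕ} {m : ℕ}

/-- A ladder with a single vertex on top is a chorded cycle: the top vertex is `v_0`, the two sides
are the two arcs that leave it, and the rungs above the lowest one are the chords. -/
theorem IsLadder.nonempty_iso_chordedCycle (h : IsLadder G lev m) (hG : IsKConnected G 2)
    (hm : 0 < m) (hcard : Fintype.card V = 2 * m + 1) {a : V} (ha : lev a = m)
    (hall : ∀ v, lev v < m ∨ v = a) :
    ∃ I ⊆ Finset.Icc 1 ((2 * m + 1 - 3) / 2), Nonempty (G ≃g chordedCycle (2 * m + 1) I) := by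
  classical
  obtain ⟨L, R, hLR⟩ := h.exists_isAligned hG hm
  have hnear : ∀ v, G.Adj a v → lev v = m - 1 ∧ (v = L (m - 1) ∨ v = R (m - 1)) := by
    intro v hv
    have h1 := h.near _ _ hv.symm
    have h2 := (hall v).resolve_right hv.ne'
    have h3 : lev v = m - 1 := by omega
    have h4 := hLR.eq_or v h2
    rw [h3] at h4
    exact ⟨h3, h4⟩
  have hL : ∀ i, i < m → (G.Adj a (L i) ↔ i = m - 1) := by
    intro i hi
    constructor
    · intro hadj
      rw [← (hnear _ hadj).1, hLR.lev_left i hi]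
    · rintro rfl
      obtain ⟨v, hv, hne⟩ := hG.exists_adj_vertex_ne a (R (m - 1))
      exact (hnear v hv).2.resolve_right hne ▸ hv
  have hR : ∀ i, i < m → (G.Adj a (R i) ↔ i = m - 1) := by
    intro i hi
    constructor
    · intro hadj
      rw [← (hnear _ hadj).1, hLR.lev_right i hi]
    · rintro rfl
      obtain ⟨v, hv, hne⟩ := hG.exists_adj_vertex_ne a (L (m - 1))
      exact (hnear v hv).2.resolve_left hne ▸ hv
  -- the lowest pair is an edge, since its vertices have two neighbours each
  have h0 : G.Adj (L 0) (R 0) := by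
    obtain ⟨v, hv, hne⟩ := hG.exists_adj_vertex_ne (L 0) (if m = 1 then a else L 1)
    by_cases hva : v = a
    · subst hva
      have := (hL 0 hm).1 hv.symm
      rw [if_pos (by omega)] at hne
      exact absurd rfl hne
    · have hvl := (hall v).resolve_right hva
      rcases hLR.eq_or v hvl with hv' | hv'
      · rw [hv', hLR.adj_left 0 _ hm hvl] at hv
        have h1 : lev v = 1 := by omega
        rw [if_neg (by omega), hv', h1] at hne
        exact absurd rfl hne
      · rw [hv'] at hv
        have := hLR.adj_left_right 0 _ hm hvl hv
        rwa [← this] at hv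
  set I := (Finset.Icc 1 ((2 * m + 1 - 3) / 2)).filter fun d => G.Adj (L (m - d)) (R (m - d))
    with hI
  have hmemI : ∀ d, d ∈ I ↔ (1 ≤ d ∧ d < m) ∧ G.Adj (L (m - d)) (R (m - d)) := by
    intro d
    rw [hI, Finset.mem_filter, Finset.mem_Icc]
    have : (1 ≤ d ∧ d ≤ (2 * m + 1 - 3) / 2) ↔ (1 ≤ d ∧ d < m) := by omega
    rw [this]
  refine ⟨I, Finset.filter_subset _ _, nonempty_iso_of_forall_adj_iff
    (fun t : Fin (2 * m + 1) => if (t : ℕ) = 0 then a else if (t : ℕ) ≤ m then L (m - t)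
      else R (t - m - 1)) ?_ (by rw [hcard, Fintype.card_fin]) ?_⟩
  · intro v
    rcases hall v with hv | rfl
    · rcases hLR.eq_or v hv with hv' | hv'
      · refine ⟨⟨m - lev v, by omega⟩, ?_⟩
        change (if m - lev v = 0 then a else if m - lev v ≤ m then L (m - (m - lev v))
          else R (m - lev v - m - 1)) = v
        rw [if_neg (by omega), if_pos (by omega), show m - (m - lev v) = lev v by omega, ← hv']
      · refine ⟨⟨lev v + m + 1, by omega⟩, ?_⟩
        change (if lev v + m + 1 = 0 then a else if lev v + m + 1 ≤ m then L (m - (lev v + m + 1))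
          else R (lev v + m + 1 - m - 1)) = v
        rw [if_neg (by omega), if_neg (by omega), show lev v + m + 1 - m - 1 = lev v by omega,
          ← hv']
    · exact ⟨⟨0, by omega⟩, if_pos rfl⟩
  · intro x y
    wlog hxy : (x : ℕ) ≤ y generalizing x y
    · rw [SimpleGraph.adj_comm, SimpleGraph.adj_comm (chordedCycle _ _)]
      exact this y x (by omega)
    have hx := x.2
    have hy := y.2
    rw [chordedCycle_adj_iff (by omega), hmemI, hmemI]
    rcases hxy.eq_or_lt with heq | hlt
    · have : x = y := Fin.ext heq
      subst this
      simp only [SimpleGraph.irrefl, false_iff]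
      omega
    rw [if_neg (show ¬ (y : ℕ) = 0 by omega)]
    by_cases hx0 : (x : ℕ) = 0
    · rw [if_pos hx0]
      split_ifs with hym
      · rw [hL _ (by omega)]
        omega
      · rw [hR _ (by omega)]
        omega
    · rw [if_neg hx0]
      by_cases hxm : (x : ℕ) ≤ m
      · rw [if_pos hxm]
        split_ifs with hym
        · rw [hLR.adj_left _ _ (by omega) (by omega)]
          omega
        · constructor
          · intro hadj
            have h1 := hLR.adj_left_right _ _ (by omega) (by omega) hadj
            rw [← h1] at hadj
            by_cases hxm' : (x : ℕ) = m
            · omega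
            · exact Or.inr ⟨by omega, Or.inl ⟨⟨by omega, hadj⟩, by omega⟩⟩
          · rintro (h1 | ⟨-, ⟨⟨-, hadj⟩, hsum⟩ | ⟨⟨h1, -⟩, -⟩⟩)
            · rw [show m - (x : ℕ) = 0 by omega, show (y : ℕ) - m - 1 = 0 by omega]
              exact h0
            · rwa [show (y : ℕ) - m - 1 = m - x by omega]
            · omega
      · rw [if_neg hxm, if_neg (by omega), hLR.adj_right _ _ (by omega) (by omega)]
        omega

/-- A ladder with two nonadjacent vertices on top and no rung above the lowest level is `Θ`. -/
theorem IsLadder.nonempty_iso_thetaGraph {p : ℕ} (h : IsLadder G lev p) (hG : IsKConnected G 2)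
    (hp : 0 < p) (hcard : Fintype.card V = 2 * p + 2) {a c : V} (ha : lev a = p)
    (hc : lev c = p) (hall : ∀ v, lev v < p ∨ v = a ∨ v = c) (htop : ¬ G.Adj a c)
    (hin : ∀ u v, G.Adj u v → lev u = lev v → lev u = 0) (hex : ∃ u v, G.Adj u v ∧ lev u = lev v) :
    Nonempty (G ≃g thetaGraph (2 * p + 2)) := by
  classical
  obtain ⟨L, R, hLR⟩ := h.exists_isAligned hG hp
  have hnear : ∀ w, (w = a ∨ w = c) → ∀ v, G.Adj w v →
      lev v = p - 1 ∧ (v = L (p - 1) ∨ v = R (p - 1)) := by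
    intro w hw v hv
    have hwp : lev w = p := by rcases hw with rfl | rfl <;> assumption
    have h1 := h.near _ _ hv.symm
    have h2 : lev v < p := by
      rcases hall v with h | rfl | rfl
      · exact h
      · rcases hw with rfl | rfl
        · exact absurd rfl hv.ne
        · exact absurd hv.symm htop
      · rcases hw with rfl | rfl
        · exact absurd hv htop
        · exact absurd rfl hv.ne
    have h3 : lev v = p - 1 := by omega
    have h4 := hLR.eq_or v h2
    rw [h3] at h4
    exact ⟨h3, h4⟩
  have hL : ∀ w, (w = a ∨ w = c) → ∀ i, i < p → (G.Adj w (L i) ↔ i = p - 1) := by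
    intro w hw i hi
    constructor
    · intro hadj
      rw [← (hnear w hw _ hadj).1, hLR.lev_left i hi]
    · rintro rfl
      obtain ⟨v, hv, hne⟩ := hG.exists_adj_vertex_ne w (R (p - 1))
      exact (hnear w hw v hv).2.resolve_right hne ▸ hv
  have hR : ∀ w, (w = a ∨ w = c) → ∀ i, i < p → (G.Adj w (R i) ↔ i = p - 1) := by
    intro w hw i hi
    constructor
    · intro hadj
      rw [← (hnear w hw _ hadj).1, hLR.lev_right i hi]
    · rintro rfl
      obtain ⟨v, hv, hne⟩ := hG.exists_adj_vertex_ne w (L (p - 1))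
      exact (hnear w hw v hv).2.resolve_left hne ▸ hv
  have h0 : ∀ i k, i < p → k < p → (G.Adj (L i) (R k) ↔ i = 0 ∧ k = 0) := by
    intro i k hi hk
    constructor
    · intro hadj
      obtain rfl := hLR.adj_left_right i k hi hk hadj
      have := hin _ _ hadj (by rw [hLR.lev_left i hi, hLR.lev_right i hk])
      rw [hLR.lev_left i hi] at this
      exact ⟨this, this⟩
    · rintro ⟨rfl, rfl⟩
      obtain ⟨u, v, huv, hlev⟩ := hex
      have hu := hin u v huv hlev
      have h1 := hLR.eq_or u (by omega)
      have h2 := hLR.eq_or v (by omega)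
      rw [← hlev, hu] at h2
      rw [hu] at h1
      rcases h1 with rfl | rfl <;> rcases h2 with rfl | rfl
      · exact absurd rfl huv.ne
      · exact huv
      · exact huv.symm
      · exact absurd rfl huv.ne
  refine nonempty_iso_of_forall_adj_iff
    (fun t : Fin (2 * p + 2) => if (t : ℕ) = 0 then a else if (t : ℕ) = 1 then c else
      if (t : ℕ) ≤ p + 1 then L (p + 1 - t) else R (t - p - 2)) ?_
      (by rw [hcard, Fintype.card_fin]) ?_
  · intro v
    rcases hall v with hv | rfl | rfl
    · rcases hLR.eq_or v hv with hv' | hv'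
      · refine ⟨⟨p + 1 - lev v, by omega⟩, ?_⟩
        change (if p + 1 - lev v = 0 then a else if p + 1 - lev v = 1 then c else
          if p + 1 - lev v ≤ p + 1 then L (p + 1 - (p + 1 - lev v))
          else R (p + 1 - lev v - p - 2)) = v
        rw [if_neg (by omega), if_neg (by omega), if_pos (by omega),
          show p + 1 - (p + 1 - lev v) = lev v by omega, ← hv']
      · refine ⟨⟨lev v + p + 2, by omega⟩, ?_⟩
        change (if lev v + p + 2 = 0 then a else if lev v + p + 2 = 1 then c else
          if lev v + p + 2 ≤ p + 1 then L (p + 1 - (lev v + p + 2))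
          else R (lev v + p + 2 - p - 2)) = v
        rw [if_neg (by omega), if_neg (by omega), if_neg (by omega),
          show lev v + p + 2 - p - 2 = lev v by omega, ← hv']
    · exact ⟨⟨0, by omega⟩, if_pos rfl⟩
    · exact ⟨⟨1, by omega⟩, (if_neg one_ne_zero).trans (if_pos rfl)⟩
  · intro x y
    wlog hxy : (x : ℕ) ≤ y generalizing x y
    · rw [SimpleGraph.adj_comm, SimpleGraph.adj_comm (thetaGraph _)]
      exact this y x (by omega)
    have hx := x.2
    have hy := y.2
    rw [thetaGraph, SimpleGraph.fromRel_adj, Ne, Fin.ext_iff]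
    rcases hxy.eq_or_lt with heq | hlt
    · have : x = y := Fin.ext heq
      subst this
      simp
    rw [if_neg (show ¬ (y : ℕ) = 0 by omega)]
    by_cases hx0 : (x : ℕ) = 0
    · rw [if_pos hx0]
      split_ifs with hy1 hym
      · simp only [htop, false_iff]
        omega
      · rw [hL a (Or.inl rfl) _ (by omega)]
        omega
      · rw [hR a (Or.inl rfl) _ (by omega)]
        omega
    rw [if_neg hx0, if_neg (show ¬ (y : ℕ) = 1 by omega)]
    by_cases hx1 : (x : ℕ) = 1
    · rw [if_pos hx1]
      split_ifs with hym
      · rw [hL c (Or.inr rfl) _ (by omega)]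
        omega
      · rw [hR c (Or.inr rfl) _ (by omega)]
        omega
    rw [if_neg hx1]
    by_cases hxm : (x : ℕ) ≤ p + 1
    · rw [if_pos hxm]
      split_ifs with hym
      · rw [hLR.adj_left _ _ (by omega) (by omega)]
        omega
      · rw [h0 _ _ (by omega) (by omega)]
        omega
    · rw [if_neg hxm, if_neg (by omega), hLR.adj_right _ _ (by omega) (by omega)]
      omega

end Isomorphism

/-! ### Ladders from rankings -/

theorem rank_eq_iff {V : Type*} {n : ℕ} {ρ : V ≃ Fin n} {i : ℕ} (hi : i < n) (v : V) :
    (ρ v : ℕ) = i ↔ v = ρ.symm ⟨i, hi⟩ := by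
  rw [Equiv.eq_symm_apply, Fin.ext_iff]

section RankLadder

variable {V : Type*} [Fintype V] {n : ℕ} {G : SimpleGraph V} {ρ : V ≃ Fin n} {s : V → Bool}

/-- The pairs of ranks `2 i` and `2 i + 1` form a ladder if no edge skips a pair and at most two
edges rise to each pair. -/
theorem isLadder_of_even_gaps {m : ℕ} (hm : 2 * m ≤ n)
    (hempty : ∀ i l, i < l → 2 * l < n → gapDarts G ρ s (2 * i) (2 * l) = ∅)
    (hcard : ∀ i, 1 ≤ i → i < m → (gapDarts G ρ s (2 * i) (2 * i)).card ≤ 2) :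
    IsLadder G (fun v => (ρ v : ℕ) / 2) m := by
  classical
  refine ⟨fun i hi => ⟨ρ.symm ⟨2 * i, by omega⟩, ρ.symm ⟨2 * i + 1, by omega⟩, ?_, fun v => ?_⟩,
    fun u v huv => ?_, fun i hi => ?_⟩
  · exact ne_of_rank_ne (ρ := ρ) (by rw [rank_symm, rank_symm]; omega)
  · rw [← rank_eq_iff, ← rank_eq_iff]
    omega
  · by_contra! hcon
    have h1 := (ρ v).2
    have h2 := hempty (ρ u / 2 + 1) (ρ v / 2) (by omega) (by omega)
    exact Finset.notMem_empty (v, u)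
      (h2 ▸ mem_gapDarts.2 ⟨huv.symm, by omega, Or.inl (by omega)⟩)
  · refine ⟨(gapDarts G ρ s (2 * (i + 1)) (2 * (i + 1))).image Prod.swap,
      Finset.card_image_le.trans (hcard _ (by omega) hi), fun u v huv hu hv => ?_⟩
    exact Finset.mem_image.2 ⟨(v, u), mem_gapDarts.2 ⟨huv.symm, by omega, Or.inl (by omega)⟩, rfl⟩

/-- The pairs of ranks `2 i + 1` and `2 i + 2`, numbered from the top, form a ladder with the vertex
of rank `0` in the role of the highest level. -/
theorem isLadder_of_odd_gaps {m : ℕ} (hm : n = 2 * m + 1)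
    (hempty : ∀ i l, i < l → 2 * l + 1 < n → gapDarts G ρ s (2 * i + 1) (2 * l + 1) = ∅)
    (hcard : ∀ i, i < m → (gapDarts G ρ s (2 * i + 1) (2 * i + 1)).card ≤ 2) :
    IsLadder G (fun v => m - ((ρ v : ℕ) + 1) / 2) m := by
  refine ⟨fun i hi => ⟨ρ.symm ⟨2 * (m - i) - 1, by omega⟩, ρ.symm ⟨2 * (m - i), by omega⟩, ?_,
    fun v => ?_⟩, fun u v huv => ?_, fun i hi => ?_⟩
  · exact ne_of_rank_ne (ρ := ρ) (by rw [rank_symm, rank_symm]; omega)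
  · have := (ρ v).2
    rw [← rank_eq_iff, ← rank_eq_iff]
    omega
  · by_contra! hcon
    have h1 := (ρ u).2
    have h2 := hempty ((ρ v + 1) / 2) ((ρ u - 1) / 2) (by omega) (by omega)
    exact Finset.notMem_empty (u, v)
      (h2 ▸ mem_gapDarts.2 ⟨huv, by omega, Or.inl (by omega)⟩)
  · refine ⟨gapDarts G ρ s (2 * (m - i - 1) + 1) (2 * (m - i - 1) + 1), hcard _ (by omega),
      fun u v huv hu hv => ?_⟩
    have h1 := (ρ u).2
    have h2 := (ρ v).2
    exact mem_gapDarts.2 ⟨huv, by omega, Or.inl (by omega)⟩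

/-- A graph of even order whose least eigenvalue is at most `q(Θ)` is isomorphic to `Θ`. -/
theorem nonempty_iso_thetaGraph_of_leastQEigenvalue_le {p : ℕ} (hp : 1 ≤ p) (hG : IsKConnected G 2)
    (hb : ¬ G.IsBipartite) (hV : Fintype.card V = 2 * p + 2)
    (hle : leastQEigenvalue G ≤ leastQEigenvalue (thetaGraph (2 * p + 2))) :
    Nonempty (G ≃g thetaGraph (2 * p + 2)) := by
  classical
  obtain ⟨ρ, s, hcard, hempty⟩ := exists_levels_of_leastQEigenvalue_le hp hG hb hV hle
  have hlad : IsLadder G (fun v => (ρ v : ℕ) / 2) p :=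
    isLadder_of_even_gaps (by omega) (fun i l hil hl => hempty i l hil (by omega)) hcard
  have hlow : ∀ u v, G.Adj u v → s u = s v → (ρ u : ℕ) < 2 := by
    intro u v huv hs
    by_contra! hcon
    exact Finset.notMem_empty (u, v)
      (hempty 0 1 (by omega) hp ▸ mem_gapDarts.2 ⟨huv, hcon, Or.inr hs⟩)
  obtain ⟨a, ha⟩ : ∃ a, (ρ a : ℕ) = 2 * p := ⟨ρ.symm ⟨2 * p, by omega⟩, rank_symm _⟩
  obtain ⟨c, hc⟩ : ∃ c, (ρ c : ℕ) = 2 * p + 1 := ⟨ρ.symm ⟨2 * p + 1, by omega⟩, rank_symm _⟩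
  have hall : ∀ v, (ρ v : ℕ) / 2 < p ∨ v = a ∨ v = c := by
    intro v
    have h1 := (ρ v).2
    by_cases h2 : (ρ v : ℕ) = 2 * p
    · exact Or.inr (Or.inl (ρ.injective (Fin.ext (h2.trans ha.symm))))
    · by_cases h3 : (ρ v : ℕ) = 2 * p + 1
      · exact Or.inr (Or.inr (ρ.injective (Fin.ext (h3.trans hc.symm))))
      · left
        omega
  -- every vertex above the lowest level has a neighbour on the level below
  have hdown : ∀ i v, i + 1 ≤ p → (ρ v : ℕ) / 2 = i + 1 → ∃ u, G.Adj u v ∧ (ρ u : ℕ) / 2 = i := by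
    intro i v hi hv
    rcases hi.lt_or_eq with hi | rfl
    · obtain ⟨w, w', -, hw⟩ := hlad.pair i (by omega)
      exact hlad.exists_adj_down hG hi ((hw w).2 (Or.inl rfl)) hv
    · obtain ⟨u, hu, hne⟩ := hG.exists_adj_vertex_ne v (if v = a then c else a)
      have h1 := hlad.near u v hu.symm
      refine ⟨u, hu.symm, ?_⟩
      rcases hall u with h | rfl | rfl
      · omega
      · rw [if_neg hu.ne] at hne
        exact absurd rfl hne
      · by_cases hva : v = a
        · rw [if_pos hva] at hne
          exact absurd rfl hne
        · rcases hall v with h | h | h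
          · omega
          · exact absurd h hva
          · exact absurd h hu.ne
  obtain ⟨u₀, v₀, huv₀, hs₀⟩ := exists_adj_same_sign hb s
  have hu₀ := hlow u₀ v₀ huv₀ hs₀
  have hv₀ := hlow v₀ u₀ huv₀.symm hs₀.symm
  have hsign : ∀ i, i ≤ p → ∃ c, ∀ v, (ρ v : ℕ) / 2 = i → s v = c := by
    intro i
    induction i with
    | zero =>
      refine fun _ => ⟨s u₀, fun v hv => ?_⟩
      have h1 := rank_ne (ρ := ρ) huv₀.ne
      rcases (show (ρ v : ℕ) = ρ u₀ ∨ (ρ v : ℕ) = ρ v₀ by omega) with h | h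
      · rw [ρ.injective (Fin.ext h)]
      · rw [ρ.injective (Fin.ext h), hs₀]
    | succ i ih =>
      intro hi
      obtain ⟨c, hc⟩ := ih (by omega)
      refine ⟨!c, fun v hv => ?_⟩
      obtain ⟨u, huv, hu⟩ := hdown i v hi hv
      have h1 := hc u hu
      have h2 : s v ≠ s u := fun h => by
        have := hlow v u huv.symm h
        omega
      rw [h1] at h2
      revert h2
      cases s v <;> cases c <;> simp
  have hin : ∀ u v, G.Adj u v → (ρ u : ℕ) / 2 = ρ v / 2 → (ρ u : ℕ) / 2 = 0 := by
    intro u v huv hlev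
    have h1 := (ρ u).2
    obtain ⟨c, hc⟩ := hsign (ρ u / 2) (by omega)
    have := hlow u v huv (by rw [hc u rfl, hc v hlev.symm])
    omega
  refine hlad.nonempty_iso_thetaGraph hG hp hV (a := a) (c := c) (by omega) (by omega) hall
    (fun hac => ?_) hin ⟨u₀, v₀, huv₀, by omega⟩
  have := hin a c hac (by omega)
  omega

end RankLadder

/-! ### Graphs of odd order -/

/-- The sequence `A` laid out along the odd cycle: the even terms up one side, the odd terms down
the other, with alternating signs. -/
noncomputable def zigzagVector (m : ℕ) (A : ℕ → ℝ) (t : ℕ) : ℝ :=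
  if t ≤ m then (-1) ^ t * A (2 * m + 2 - 2 * t) else (-1) ^ (t + 1) * A (2 * t - (2 * m + 1))

theorem zigzagVector_left {m i t : ℕ} (A : ℕ → ℝ) (h : i + t = m) :
    zigzagVector m A t = (-1) ^ t * A (2 * i + 2) := by
  rw [zigzagVector, if_pos (by omega)]
  congr 2
  omega

theorem zigzagVector_right (m i : ℕ) (A : ℕ → ℝ) :
    zigzagVector m A (m + 1 + i) = (-1) ^ (m + i) * A (2 * i + 1) := by
  rw [zigzagVector, if_neg (by omega), show m + 1 + i + 1 = m + i + 2 by ring, pow_add _ _ 2,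
    neg_one_sq, mul_one]
  congr 2
  omega

theorem sum_zigzagVector_sq {m : ℕ} {A : ℕ → ℝ} (htop : A (2 * m + 2) = A (2 * m + 1)) :
    ∑ t ∈ Finset.range (2 * m + 1), zigzagVector m A t ^ 2 =
      ∑ k ∈ Finset.range (2 * m + 1), A (k + 1) ^ 2 := by
  have h1 : ∑ t ∈ Finset.range (m + 1), zigzagVector m A t ^ 2 =
      ∑ i ∈ Finset.range (m + 1), A (2 * i + 2) ^ 2 := by
    rw [← Finset.sum_range_reflect]
    refine Finset.sum_congr rfl fun i hi => ?_
    have := Finset.mem_range.1 hi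
    rw [zigzagVector_left (i := i) A (by omega), neg_one_pow_mul_sq]
  have h2 : ∑ i ∈ Finset.range m, zigzagVector m A (m + 1 + i) ^ 2 =
      ∑ i ∈ Finset.range m, A (2 * i + 1) ^ 2 :=
    Finset.sum_congr rfl fun i _ => by rw [zigzagVector_right, neg_one_pow_mul_sq]
  have h3 := sum_range_two_mul_add_one (fun k => A k ^ 2) m
  rw [Finset.sum_range_succ'] at h3
  rw [show 2 * m + 1 = m + 1 + m by ring, Finset.sum_range_add, h1, h2, Finset.sum_range_succ,
    htop, show m + 1 + m = 2 * m + 1 by ring, Finset.sum_range_succ,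
    add_right_cancel (h3.trans (add_comm _ _)), Finset.sum_add_distrib]
  ring

theorem qForm_zigzagVector_le {m : ℕ} (hm : 1 ≤ m) {A : ℕ → ℝ} (hbot : A 0 = -A 1)
    (htop : A (2 * m + 2) = A (2 * m + 1)) :
    qForm (SimpleGraph.cycleGraph (2 * m + 1)) (fun t => zigzagVector m A t)
      (fun t => zigzagVector m A t) ≤ ∑ k ∈ Finset.range (2 * m + 1), (A (k + 2) - A k) ^ 2 := by
  let v : ℕ → Fin (2 * m + 1) := Fin.ofNat _
  have hv : ∀ k, k < 2 * m + 1 → (v k : ℕ) = k := fun k hk => Nat.mod_eq_of_lt hk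
  have hv' : ∀ a : Fin (2 * m + 1), v a = a := fun a => Fin.ext (hv a a.2)
  obtain ⟨e, he⟩ : ∃ e : ℕ ⊕ ℕ ⊕ Unit → Fin (2 * m + 1) × Fin (2 * m + 1), e =
      Sum.elim (fun i => (v (m - 1 - i), v (m - i)))
        (Sum.elim (fun i => (v (m + 1 + i), if i + 1 = m then v 0 else v (m + 2 + i)))
          fun _ => (v m, v (m + 1))) := ⟨_, rfl⟩
  refine (qForm_le_sum_of_cover _ ((Finset.range m).disjSum ((Finset.range m).disjSum
    Finset.univ)) e ?_).trans (le_of_eq ?_)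
  · have key : ∀ a c : Fin (2 * m + 1),
        ((a : ℕ) + 1 = c ∨ ((a : ℕ) = 0 ∧ (c : ℕ) + 1 = 2 * m + 1)) →
        ∃ i ∈ (Finset.range m).disjSum ((Finset.range m).disjSum Finset.univ),
          e i = (a, c) ∨ e i = (c, a) := by
      intro a c h
      have ha := a.2
      have hc := c.2
      rw [he]
      rcases h with h | ⟨h1, h2⟩
      · rcases lt_trichotomy (a : ℕ) m with h3 | h3 | h3
        · refine ⟨Sum.inl (m - 1 - a), Finset.inl_mem_disjSum.2 (Finset.mem_range.2 (by omega)),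
            Or.inl ?_⟩
          rw [Sum.elim_inl, show m - 1 - (m - 1 - (a : ℕ)) = a by omega,
            show m - (m - 1 - (a : ℕ)) = c by omega, hv', hv']
        · refine ⟨Sum.inr (Sum.inr ()), by simp, Or.inl ?_⟩
          rw [Sum.elim_inr, Sum.elim_inr, ← hv' a, ← hv' c, ← h, h3]
        · refine ⟨Sum.inr (Sum.inl (a - m - 1)), by simp; omega, Or.inl ?_⟩
          rw [Sum.elim_inr, Sum.elim_inl, if_neg (by omega),
            show m + 1 + ((a : ℕ) - m - 1) = a by omega,
            show m + 2 + ((a : ℕ) - m - 1) = c by omega, hv', hv']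
      · refine ⟨Sum.inr (Sum.inl (m - 1)), by simp; omega, Or.inr ?_⟩
        rw [Sum.elim_inr, Sum.elim_inl, if_pos (by omega), show m + 1 + (m - 1) = c by omega, ← h1,
          hv', hv']
    intro a c h
    rw [cycleGraph_adj_iff (by omega)] at h
    rcases h with h | h | h | h
    · exact key a c (Or.inl h)
    · obtain ⟨i, hi, hi'⟩ := key c a (Or.inl h)
      exact ⟨i, hi, hi'.symm⟩
    · exact key a c (Or.inr h)
    · obtain ⟨i, hi, hi'⟩ := key c a (Or.inr h)
      exact ⟨i, hi, hi'.symm⟩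
  · rw [he]
    simp only [Finset.sum_disjSum, Sum.elim_inl, Sum.elim_inr, Finset.univ_unique,
      Finset.sum_singleton]
    have e1 : ∀ i ∈ Finset.range m, (zigzagVector m A (v (m - 1 - i)) +
        zigzagVector m A (v (m - i))) ^ 2 = (A (2 * i + 4) - A (2 * i + 2)) ^ 2 := fun i hi => by
      have hi := Finset.mem_range.1 hi
      rw [hv _ (by omega), hv _ (by omega), zigzagVector_left (i := i + 1) A (by omega),
        zigzagVector_left (i := i) A (by omega), show m - i = m - 1 - i + 1 by omega, pow_succ,
        ← neg_one_pow_mul_sq (m - 1 - i) (A (2 * i + 4) - A (2 * i + 2))]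
      ring_nf
    have e0 : zigzagVector m A 0 = A (2 * m + 1) := by
      rw [zigzagVector_left (i := m) A (by omega), htop]
      ring
    have e2 : ∀ i ∈ Finset.range m, (zigzagVector m A (v (m + 1 + i)) +
        zigzagVector m A (if i + 1 = m then v 0 else v (m + 2 + i) : Fin _)) ^ 2 =
          (A (2 * i + 3) - A (2 * i + 1)) ^ 2 := fun i hi => by
      have hi := Finset.mem_range.1 hi
      rw [hv _ (by omega), zigzagVector_right]
      split_ifs with h
      · have hs : (-1 : ℝ) ^ (2 * i + 1) = -1 := by
          rw [pow_succ, pow_mul, neg_one_sq, one_pow, one_mul]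
        rw [hv 0 (by omega), e0, ← h, show i + 1 + i = 2 * i + 1 by ring, hs,
          show 2 * (i + 1) + 1 = 2 * i + 3 by ring]
        ring
      · rw [hv _ (by omega), show m + 2 + i = m + 1 + (i + 1) by ring, zigzagVector_right,
          ← add_assoc, pow_succ, show 2 * (i + 1) + 1 = 2 * i + 3 by ring,
          ← neg_one_pow_mul_sq (m + i) (A (2 * i + 3) - A (2 * i + 1))]
        ring
    rw [Finset.sum_congr rfl e1, Finset.sum_congr rfl e2, hv _ (by omega), hv _ (by omega),
      zigzagVector_left (i := 0) A (by omega), show m + 1 = m + 1 + 0 from rfl,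
      zigzagVector_right, sum_range_two_mul_add_one, hbot]
    have := neg_one_pow_mul_sq m (A 1 + A 2)
    simp only [mul_zero, zero_add, add_zero, sub_neg_eq_add, Finset.sum_add_distrib] at *
    linarith

/-- Rayleigh's principle for the odd cycle, in terms of the zigzag arrangement. -/
theorem cycle_rayleigh {m : ℕ} (hm : 1 ≤ m) {A : ℕ → ℝ} (hbot : A 0 = -A 1)
    (htop : A (2 * m + 2) = A (2 * m + 1)) :
    leastQEigenvalue (SimpleGraph.cycleGraph (2 * m + 1)) *
      ∑ k ∈ Finset.range (2 * m + 1), A (k + 1) ^ 2 ≤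
        ∑ k ∈ Finset.range (2 * m + 1), (A (k + 2) - A k) ^ 2 := by
  have h1 := leastQEigenvalue_mul_le (SimpleGraph.cycleGraph (2 * m + 1))
    (fun t => zigzagVector m A t)
  rw [Fin.sum_univ_eq_sum_range (fun t => zigzagVector m A t ^ 2), sum_zigzagVector_sq htop] at h1
  exact h1.trans (qForm_zigzagVector_le hm hbot htop)

/-- A sequence attaining `q(C_n)`, with the reflections of the zigzag at both ends. -/
structure IsZigzagMinimizer (m : ℕ) (A : ℕ → ℝ) : Prop where
  bot : A 0 = -A 1
  top : A (2 * m + 2) = A (2 * m + 1)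
  eq : ∑ k ∈ Finset.range (2 * m + 1), (A (k + 2) - A k) ^ 2 =
    leastQEigenvalue (SimpleGraph.cycleGraph (2 * m + 1)) *
      ∑ k ∈ Finset.range (2 * m + 1), A (k + 1) ^ 2

namespace IsZigzagMinimizer

variable {m : ℕ} {A : ℕ → ℝ}

/-- The eigenvalue equation of the cycle in weak form. -/
theorem sum_mul_eq (h : IsZigzagMinimizer m A) (hm : 1 ≤ m) {δ : ℕ → ℝ} (hbot : δ 0 = -δ 1)
    (htop : δ (2 * m + 2) = δ (2 * m + 1)) :
    ∑ k ∈ Finset.range (2 * m + 1), (A (k + 2) - A k) * (δ (k + 2) - δ k) =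
      leastQEigenvalue (SimpleGraph.cycleGraph (2 * m + 1)) *
        ∑ k ∈ Finset.range (2 * m + 1), A (k + 1) * δ (k + 1) := by
  set q := leastQEigenvalue (SimpleGraph.cycleGraph (2 * m + 1)) with hq
  have key := eq_of_quadratic_nonneg
    (B := 2 * (∑ k ∈ Finset.range (2 * m + 1), (A (k + 2) - A k) * (δ (k + 2) - δ k) -
      q * ∑ k ∈ Finset.range (2 * m + 1), A (k + 1) * δ (k + 1)))
    (C := ∑ k ∈ Finset.range (2 * m + 1), (δ (k + 2) - δ k) ^ 2 -
      q * ∑ k ∈ Finset.range (2 * m + 1), δ (k + 1) ^ 2) (fun ε => by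
    have h1 := cycle_rayleigh hm (A := fun k => A k + ε * δ k)
      (by rw [h.bot, hbot]; ring) (by rw [h.top, htop])
    have e1 : ∑ k ∈ Finset.range (2 * m + 1), (A (k + 1) + ε * δ (k + 1)) ^ 2 =
        ∑ k ∈ Finset.range (2 * m + 1), A (k + 1) ^ 2 +
        2 * ε * ∑ k ∈ Finset.range (2 * m + 1), A (k + 1) * δ (k + 1) +
        ε ^ 2 * ∑ k ∈ Finset.range (2 * m + 1), δ (k + 1) ^ 2 := by
      rw [Finset.mul_sum, Finset.mul_sum, ← Finset.sum_add_distrib, ← Finset.sum_add_distrib]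
      exact Finset.sum_congr rfl fun k _ => by ring
    have e2 : ∑ k ∈ Finset.range (2 * m + 1), (A (k + 2) + ε * δ (k + 2) - (A k + ε * δ k)) ^ 2 =
        ∑ k ∈ Finset.range (2 * m + 1), (A (k + 2) - A k) ^ 2 +
        2 * ε * ∑ k ∈ Finset.range (2 * m + 1), (A (k + 2) - A k) * (δ (k + 2) - δ k) +
        ε ^ 2 * ∑ k ∈ Finset.range (2 * m + 1), (δ (k + 2) - δ k) ^ 2 := by
      rw [Finset.mul_sum, Finset.mul_sum, ← Finset.sum_add_distrib, ← Finset.sum_add_distrib]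
      exact Finset.sum_congr rfl fun k _ => by ring
    rw [e1, e2, h.eq, ← hq] at h1
    linarith)
  linarith

theorem recurrence (h : IsZigzagMinimizer m A) (hm : 1 ≤ m) {k : ℕ} (hk : k + 2 ≤ 2 * m) :
    2 * A (k + 2) - A k - A (k + 4) =
      leastQEigenvalue (SimpleGraph.cycleGraph (2 * m + 1)) * A (k + 2) := by
  have h1 := h.sum_mul_eq hm (δ := fun i => if i = k + 2 then 1 else 0)
    (by simp) (by rw [if_neg (by omega), if_neg (by omega)])
  simp only [mul_sub, mul_ite, mul_one, mul_zero, Finset.sum_sub_distrib, Nat.add_right_cancel_iff,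
    Finset.sum_ite_eq', Finset.mem_range] at h1
  rw [if_pos (by omega), if_pos (by omega), if_pos (by omega)] at h1
  linarith

theorem recurrence_bot (h : IsZigzagMinimizer m A) (hm : 1 ≤ m) :
    2 * A 1 + A 2 - A 3 = leastQEigenvalue (SimpleGraph.cycleGraph (2 * m + 1)) * A 1 := by
  have h1 := h.sum_mul_eq hm (δ := fun i => (if i = 1 then 1 else 0) - if i = 0 then 1 else 0)
    (by simp) (by simp; omega)
  simp only [mul_sub, mul_ite, mul_one, mul_zero, Finset.sum_sub_distrib,
    show ∀ i, i + 1 = 1 ↔ i = 0 by omega,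
    show ∀ i, ¬ i + 2 = 0 by omega, show ∀ i, ¬ i + 1 = 0 by omega, if_false,
    Finset.sum_const_zero, Finset.sum_ite_eq', Finset.mem_range] at h1
  rw [if_pos (by omega), if_pos (by omega), if_pos (by omega)] at h1
  have := h.bot
  simp only [zero_add] at h1
  linarith

theorem recurrence_top (h : IsZigzagMinimizer m A) (hm : 1 ≤ m) :
    2 * A (2 * m + 1) - A (2 * m) - A (2 * m - 1) =
      leastQEigenvalue (SimpleGraph.cycleGraph (2 * m + 1)) * A (2 * m + 1) := by
  obtain ⟨r, rfl⟩ : ∃ r, m = r + 1 := ⟨m - 1, by omega⟩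
  have h1 := h.sum_mul_eq hm
    (δ := fun i => (if i = 2 * r + 3 then 1 else 0) + if i = 2 * r + 4 then 1 else 0)
    (by simp)
    (by
      rw [if_neg (by omega), if_pos (by omega), if_pos (by omega), if_neg (by omega)]
      norm_num)
  simp only [mul_sub, mul_add, mul_ite, mul_one, mul_zero, Finset.sum_sub_distrib,
    Finset.sum_add_distrib,
    show ∀ i, i + 2 = 2 * r + 3 ↔ i = 2 * r + 1 by omega,
    show ∀ i, i + 2 = 2 * r + 4 ↔ i = 2 * r + 2 by omega,
    show ∀ i, i + 1 = 2 * r + 3 ↔ i = 2 * r + 2 by omega,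
    show ∀ i, i + 1 = 2 * r + 4 ↔ i = 2 * r + 3 by omega,
    Finset.sum_ite_eq', Finset.mem_range] at h1
  rw [if_pos (by omega), if_pos (by omega), if_neg (by omega), if_neg (by omega), if_pos (by omega),
    if_neg (by omega)] at h1
  have := h.top
  rw [show 2 * (r + 1) - 1 = 2 * r + 1 by omega]
  ring_nf at *
  linarith

/-- A gap which vanishes makes the neighbouring gaps of the same parity vanish. -/
theorem gap_eq_zero (h : IsZigzagMinimizer m A) (hm : 1 ≤ m) (hA : Monotone A) {k : ℕ}
    (hk : k ≤ 2 * m) (h0 : A (k + 1) = A k) :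
    (k + 2 ≤ 2 * m → A (k + 3) = A (k + 2)) ∧ ∀ i, k = i + 2 → A (i + 1) = A i := by
  set q := leastQEigenvalue (SimpleGraph.cycleGraph (2 * m + 1)) with hq
  have hbot := h.recurrence_bot hm
  have htop := h.recurrence_top hm
  have hmid := fun k hk => h.recurrence hm (k := k) hk
  rw [← hq] at hbot htop
  have m3 := hA (show k + 2 ≤ k + 3 by omega)
  rcases k with _ | _ | k
  · refine ⟨fun _ => ?_, fun i hi => by omega⟩
    have h1 : A 1 = 0 := by
      have := h.bot
      simp only [zero_add] at h0
      linarith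
    rw [h1] at hbot
    simp only [zero_add]
    linarith
  · refine ⟨fun hk' => ?_, fun i hi => by omega⟩
    have h1 := hmid 0 (by omega)
    have := h.bot
    simp only [zero_add] at h1 h0 ⊢
    rw [h0] at h1 hbot
    show A 4 = A 3
    linarith
  · have h1 := hmid k (by omega)
    rw [h0.symm] at h1
    have m4 := hA (show k ≤ k + 1 by omega)
    by_cases hk' : k + 3 ≤ 2 * m
    · have h2 := hmid (k + 1) (by omega)
      rw [show k + 1 + 2 = k + 2 + 1 by ring, show k + 1 + 4 = k + 2 + 3 by ring] at h2
      rw [show k + 4 = k + 2 + 2 by ring] at h1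
      refine ⟨fun _ => ?_, fun i hi => ?_⟩
      · show A (k + 2 + 3) = A (k + 2 + 2)
        linarith
      · obtain rfl : i = k := by omega
        linarith
    · refine ⟨fun h => by omega, fun i hi => ?_⟩
      obtain rfl : i = k := by omega
      rw [show 2 * m + 1 = i + 2 + 1 by omega, show 2 * m = i + 2 by omega,
        show i + 2 - 1 = i + 1 by omega, h0] at htop
      have ht := h.top
      rw [show 2 * m + 2 = i + 4 by omega, show 2 * m + 1 = i + 2 + 1 by omega] at ht
      rw [ht, h0] at h1
      linarith

/-- Vanishing propagates along the gaps of each parity, and not all gaps vanish; hence all gaps of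
one of the two parities are positive. -/
theorem gaps_pos (h : IsZigzagMinimizer m A) (hm : 1 ≤ m) (hA : Monotone A)
    (hne : ∃ k ≤ 2 * m, A (k + 1) ≠ 0) :
    (∀ i, i ≤ m → A (2 * i) < A (2 * i + 1)) ∨ ∀ i, i < m → A (2 * i + 1) < A (2 * i + 2) := by
  by_contra! hcon
  obtain ⟨⟨i, hi, hi'⟩, j, hj, hj'⟩ := hcon
  have hz : ∀ k, k ≤ 2 * m → A (k + 1) = A k := by
    have down : ∀ r k, k + 2 * r ≤ 2 * m → A (k + 2 * r + 1) = A (k + 2 * r) → A (k + 1) = A k := by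
      intro r
      induction r with
      | zero => exact fun k _ h => h
      | succ r ih =>
        intro k hk hz
        exact ih k (by omega) ((h.gap_eq_zero hm hA hk hz).2 (k + 2 * r) (by ring))
    have up : ∀ r k, k + 2 * r ≤ 2 * m → A (k + 1) = A k → A (k + 2 * r + 1) = A (k + 2 * r) := by
      intro r
      induction r with
      | zero => exact fun k _ h => h
      | succ r ih =>
        intro k hk hz
        exact (h.gap_eq_zero hm hA (by omega) (ih k (by omega) hz)).1 (by omega)
    have h0 := down i 0 (by omega) (by rw [zero_add]; exact le_antisymm hi' (hA (by omega)))
    have h1 := down j 1 (by omega) (by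
      rw [show 1 + 2 * j = 2 * j + 1 by ring]
      exact le_antisymm hj' (hA (by omega)))
    intro k hk
    obtain ⟨r, hr | hr⟩ := Nat.even_or_odd' k
    · have := up r 0 (by omega) h0
      rwa [zero_add, ← hr] at this
    · have := up r 1 (by omega) h1
      rwa [add_comm 1, ← hr] at this
  obtain ⟨k, hk, hk'⟩ := hne
  have h1 : A 1 = 0 := by
    have := hz 0 (by omega)
    have := h.bot
    simp only [zero_add] at *
    linarith
  have : ∀ k, k ≤ 2 * m → A (k + 1) = 0 := by
    intro k
    induction k with
    | zero => exact fun _ => h1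
    | succ k ih => exact fun hk => (hz (k + 1) hk).trans (ih (by omega))
  exact hk' (this k hk)

end IsZigzagMinimizer

/-- The odd order case, with the cycle itself included as the chorded cycle without chords. Equality
leaves the edge counts no freedom at the positive gaps, so that the vertices form a ladder, read
from the bottom or from the top according to the parity of these gaps. -/
theorem cycle_le_and_iso {V : Type*} [Fintype V] {G : SimpleGraph V} {m : ℕ} (hm : 1 ≤ m)
    (hG : IsKConnected G 2) (hb : ¬ G.IsBipartite) (hV : Fintype.card V = 2 * m + 1) :
    leastQEigenvalue (SimpleGraph.cycleGraph (2 * m + 1)) ≤ leastQEigenvalue G ∧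
      (leastQEigenvalue (SimpleGraph.cycleGraph (2 * m + 1)) = leastQEigenvalue G →
        ∃ I ⊆ Finset.Icc 1 ((2 * m + 1 - 3) / 2),
          Nonempty (G ≃g chordedCycle (2 * m + 1) I)) := by
  have hne : Nonempty V := Fintype.card_pos_iff.1 (by omega)
  obtain ⟨x, hx, hQ⟩ := exists_leastQEigenvector G
  obtain ⟨ρ, s, A, h, -⟩ := exists_isSignedRanking_no_source hG hb hV hx hQ
  have hEq := qForm_self_of_mulVec hQ
  have hxx := sum_sq_pos hx
  have hZ := h.zigzag_add_le_qForm hG hb ∅ (fun _ => 0) (by simp)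
  rw [Finset.sum_empty, add_zero] at hZ
  have htop := h.top (2 * m + 2) (by omega)
  have hC := cycle_rayleigh hm h.zero htop
  rw [← h.sum_sq] at hC
  refine ⟨le_of_mul_le_mul_right ((hC.trans hZ).trans hEq.le) hxx, fun heq => ?_⟩
  rw [heq] at hC
  have hexact : qForm G x x = ∑ k ∈ Finset.range (2 * m + 1), (A (k + 2) - A k) ^ 2 :=
    le_antisymm (hEq.trans_le hC) hZ
  have hmin : IsZigzagMinimizer m A := ⟨h.zero, htop, by rw [← hexact, hEq, heq, h.sum_sq]⟩
  have hbound : ∀ k l, A k < A (k + 1) → A l < A (l + 1) → k ≤ l → 1 ≤ l →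
      ((gapDarts G ρ s k l).card : ℝ) ≤ zigzagCoeff k l := fun k l hk hl hkl hl1 => by
    have := qForm_layer_le_of_eq h hG hb ∅ (fun _ => 0) (by simp) (by simpa using hexact) hk hl
    rw [Finset.filter_empty, Finset.sum_empty, add_zero] at this
    exact (card_gapDarts_le hkl hl1).trans this
  have hbound2 : ∀ k, A k < A (k + 1) → 1 ≤ k → (gapDarts G ρ s k k).card ≤ 2 := fun k hk hk1 => by
    have := hbound k k hk hk le_rfl hk1
    rw [zigzagCoeff, if_pos rfl, if_neg (by omega)] at this
    exact_mod_cast this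
  have hbound0 : ∀ k l, A k < A (k + 1) → A l < A (l + 1) → k + 2 ≤ l →
      gapDarts G ρ s k l = ∅ := fun k l hk hl hkl => by
    have := hbound k l hk hl (by omega) (by omega)
    rw [zigzagCoeff, if_neg (by omega), if_neg (by omega)] at this
    have h3 : (gapDarts G ρ s k l).card ≤ 0 := by exact_mod_cast this
    exact Finset.card_eq_zero.1 (by omega)
  have hA : ∃ k ≤ 2 * m, A (k + 1) ≠ 0 := by
    by_contra! hcon
    refine hx (funext fun v => ?_)
    rw [h.eq_sign_mul, hcon _ (Nat.lt_succ_iff.1 (ρ v).2), mul_zero, Pi.zero_apply]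
  rcases hmin.gaps_pos hm h.mono hA with hpos | hpos
  · have hlad : IsLadder G (fun v => (ρ v : ℕ) / 2) m := isLadder_of_even_gaps (by omega)
      (fun i l hil hl => hbound0 _ _ (hpos i (by omega)) (hpos l (by omega)) (by omega))
      (fun i hi hi' => hbound2 _ (hpos i hi'.le) (by omega))
    refine hlad.nonempty_iso_chordedCycle hG hm hV (a := ρ.symm ⟨2 * m, by omega⟩)
      (by rw [rank_symm]; omega) fun v => ?_
    have := (ρ v).2
    rw [← rank_eq_iff]
    omega
  · have hlad := isLadder_of_odd_gaps (G := G) (ρ := ρ) (s := s) rfl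
      (fun i l hil hl => hbound0 _ _ (hpos i (by omega)) (hpos l (by omega)) (by omega))
      (fun i hi => hbound2 _ (hpos i hi) (by omega))
    refine hlad.nonempty_iso_chordedCycle hG hm hV (a := ρ.symm ⟨0, by omega⟩)
      (by rw [rank_symm]; omega) fun v => ?_
    rw [← rank_eq_iff]
    omega

/-! ### The bounds for odd and for even order -/

theorem theorem1p1 {V : Type*} [Fintype V] (G : SimpleGraph V) (n : ℕ) (hn : 3 ≤ n)
    (hcard : Fintype.card V = n) (hconn : IsKConnected G 2) (hbip : ¬ G.IsBipartite) :
    (Odd n →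
      leastQEigenvalue (SimpleGraph.cycleGraph n) ≤ leastQEigenvalue G ∧
      (leastQEigenvalue (SimpleGraph.cycleGraph n) = leastQEigenvalue G →
        Nonempty (G ≃g SimpleGraph.cycleGraph n) ∨
        ∃ I : Finset ℕ, I.Nonempty ∧ I ⊆ Finset.Icc 1 ((n - 3) / 2) ∧
          Nonempty (G ≃g chordedCycle n I))) ∧
    (Even n →
      leastQEigenvalue (thetaGraph n) ≤ leastQEigenvalue G ∧
      (leastQEigenvalue (thetaGraph n) = leastQEigenvalue G ↔
        Nonempty (G ≃g thetaGraph n))) := by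
  have hne : Nonempty V := Fintype.card_pos_iff.1 (by omega)
  constructor
  · rintro ⟨m, rfl⟩
    obtain ⟨h1, h2⟩ := cycle_le_and_iso (by omega) hconn hbip hcard
    refine ⟨h1, fun heq => ?_⟩
    obtain ⟨I, hI, hiso⟩ := h2 heq
    rcases I.eq_empty_or_nonempty with rfl | hI'
    · rw [chordedCycle_empty] at hiso
      exact Or.inl hiso
    · exact Or.inr ⟨I, hI', hI, hiso⟩
  · rintro ⟨m, hm⟩
    obtain ⟨p, rfl⟩ : ∃ p, n = 2 * p + 2 := ⟨m - 1, by omega⟩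
    have key : leastQEigenvalue G ≤ leastQEigenvalue (thetaGraph (2 * p + 2)) →
        Nonempty (G ≃g thetaGraph (2 * p + 2)) :=
      nonempty_iso_thetaGraph_of_leastQEigenvalue_le (by omega) hconn hbip hcard
    have hiso : Nonempty (G ≃g thetaGraph (2 * p + 2)) →
        leastQEigenvalue G = leastQEigenvalue (thetaGraph (2 * p + 2)) :=
      fun ⟨e⟩ => leastQEigenvalue_eq_of_iso e
    refine ⟨?_, fun heq => key heq.ge, fun h => (hiso h).symm⟩
    by_contra! hlt
    exact absurd (hiso (key hlt.le)) hlt.ne
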